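/- Setting. Let $H$ be a separable real Hilbert space with a non-empty orthonormal basis $\mathbb H$. Let $\mathbb N=\{1,2,\dots\}$, $T,c,\varphi\in(0,\infty)$, $\epsilon\in[0,1)$, $\rho\in[0,\frac12)$, $\gamma\in(\rho,\frac12]$, $\chi\in\big(0,\frac{\gamma-\rho}{1+\varphi/2}\big]\cap\big(0,\frac{1-\rho}{1+\varphi}\big]$, let $\mathcal D$ be a set of non-empty finite subsets of $\mathbb H$, and let $\mu\colon\mathbb H\to\mathbb R$ satisfy $\sup_{h}\mu_h<0$. Let $A$ be the diagonal operator $Av=\sum_{h\in\mathbb H}\mu_h\langle h,v\rangle_H h$ on $D(A)=\{v\in H:\sum_h|\mu_h\langle h,v\rangle_H|^2<\infty\}$. For $r\ge0$ let $H_r=D((-A)^r)$ with $\langle u,v\rangle_{H_r}=\langle(-A)^ru,(-A)^rv\rangle_H$, and for finite $I\subseteq\mathbb H$ let $P_Iv=\sum_{h\in I}\langle h,v\rangle_Hh$. For $h\in(0,\infty)$, $t\in\mathbb R$ let $\lfloor t\rfloor_h=\max(\{0,h,-h,2h,-2h,\dots\}\cap(-\infty,t])$. Let $V$ be a real Banach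 space with $H_\rho\subseteq V\subseteq H$ continuously and densely, let $\phi,\Phi\colon C([0,T],H_1)\to[0,\infty)$ be Borel measurable, and let $F\in C(V,H)$ be such that for all finite $I\subseteq\mathbb H$, all $v,w\in P_I(H)$ and all $x\in C([0,T],H_1)$ $$\langle v-w,Av+F(v)-Aw-F(w)\rangle_H\le c\|v-w\|_H^2,$$ $$\sup_{t\in[0,T]}\big(\langle v,P_IF(v+x_t)\rangle_{H_{1/2}}+\phi(x)\langle v,F(v+x_t)\rangle_H\big)\le\epsilon\|v\|_{H_1}^2+(c+\phi(x))\|v\|_{H_{1/2}}^2+c\,\phi(x)\|v\|_H^2+\Phi(x),$$ $$\|F(v)-F(w)\|_H^2\le c\|v-w\|_V^2\big(1+\|v\|_V^\varphi+\|w\|_V^\varphi\big).$$ Let $(\Omega,\mathcal F,\mathbb P)$ be a probability space, let $X,O\colon[0,T]\times\Omega\to V$ and $O^{M,I}\colon[0,T]\times\Omega\to H_1$ ($M\in\mathbb N$, $I\in\mathcal D$) be stochastic processes with continuous sample paths, $O^{M,I}$ taking values in $P_I(H)$, and let $Y^{M,I}\colon[0,T]\times\Omega\to H_\gamma$ be stochastic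 processes, such that for all $t\in[0,T]$, $M\in\mathbb N$, $I\in\mathcal D$, $\mathbb P$-almost surely, $$X_t=\int_0^te^{(t-s)A}F(X_s)\,ds+O_t,$$ $$Y^{M,I}_t=\int_0^tP_Ie^{(t-s)A}\,\mathbb 1_{\{\|Y^{M,I}_{\lfloor s\rfloor_{T/M}}\|_{H_\gamma}+\|O^{M,I}_{\lfloor s\rfloor_{T/M}}\|_{H_\gamma}\le(M/T)^\chi\}}F(Y^{M,I}_{\lfloor s\rfloor_{T/M}})\,ds+O^{M,I}_t.$$ Theorem. Let $\vartheta\in(0,\infty)$, $p\in[\max\{2,1/\varphi\},\infty)$, $\varrho\in[0,1-\rho)$, and assume $$\sup_{t\in[0,T]}\sup_{I\in\mathcal D}\mathbb E\big[\|X_t\|_V^{p(1+\varphi/2)\max\{2,\varphi\}}+\|P_IO_t\|_V^{p\varphi}\big]+\sup_{M\in\mathbb N}\sup_{I\in\mathcal D}\sup_{t\in[0,T]}\mathbb E\Big[\big|\|O^{M,I}_t\|_{H_\gamma}^2+\Phi(O^{M,I})+\phi(O^{M,I})\big|^{p\max\{2\vartheta,\,2+\varphi,\,(1+\varphi/2)\varphi/2\}}\Big]<\infty.$$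 Then (i) $\displaystyle\sup_{M\in\mathbb N}\sup_{I\in\mathcal D}\sup_{t\in[0,T]}\mathbb E\big[\|Y^{M,I}_t\|_{H_\gamma}^{p\max\{4\vartheta,\,4+2\varphi,\,\varphi(1+\varphi/2)\}}\big]<\infty$; and (ii) there is $C\in(0,\infty)$ such that for all $M\in\mathbb N$, $I\in\mathcal D$ $$\sup_{t\in[0,T]}\big(\mathbb E\|X_t-Y^{M,I}_t\|_H^p\big)^{1/p}\le C\Big[M^{-\min\{\vartheta\chi,\varrho\}}+\|(-A)^{-\varrho}(\mathrm{Id}_H-P_I)\|_{L(H)}$$ $$+\sup_{t\in[0,T]}\Big(\mathbb E\big[\|(\mathrm{Id}_H-P_I)O_t\|_V^{2p}+\|P_IO_t-O^{M,I}_t\|_V^{2p}+\|P_I(O_t-O_{\lfloor t\rfloor_{T/M}})\|_V^{2p}\big]\Big)^{\frac1{2p}}\Big].$$ -/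

import Mathlib

open Set MeasureTheory
open scoped ENNReal

noncomputable section

section Diagonal

variable {ι H : Type*} [NormedAddCommGroup H] [InnerProductSpace ℝ H]

/-- The maximal domain `{v ∈ H : ∑ᵢ |dᵢ ⟨bᵢ, v⟩|² < ∞}` of the diagonal operator with entries `d`
in the orthonormal basis `b`. -/
def diagDom (b : HilbertBasis ι ℝ H) (d : ι → ℝ) : Submodule ℝ H where
  carrier := {v | Summable fun i => (d i * inner ℝ (b i) v) ^ 2}
  zero_mem' := by simp
  add_mem' := by
    intro u v hu hv
    refine Summable.of_nonneg_of_le (fun i => sq_nonneg _) (fun i => ?_)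
      ((hu.add hv).mul_left 2)
    rw [inner_add_right]
    nlinarith [sq_nonneg (d i * inner ℝ (b i) u - d i * inner ℝ (b i) v)]
  smul_mem' := by
    intro a v hv
    refine (hv.mul_left (a ^ 2)).congr (fun i => ?_)
    rw [inner_smul_right]; ring

theorem mem_diagDom {b : HilbertBasis ι ℝ H} {d : ι → ℝ} {v : H} :
    v ∈ diagDom b d ↔ Summable fun i => (d i * inner ℝ (b i) v) ^ 2 := Iff.rfl

theorem memlp_of_mem_diagDom {b : HilbertBasis ι ℝ H} {d : ι → ℝ} {v : H} (hv : v ∈ diagDom b d) :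
    Memℓp (fun i => d i * inner ℝ (b i) v) 2 := by
  refine memℓp_gen ((mem_diagDom.1 hv).congr (fun i => ?_))
  simp [mul_pow, sq_abs]

/-- The diagonal operator `v ↦ ∑ᵢ dᵢ ⟨bᵢ, v⟩ bᵢ` on its maximal domain. -/
def diagOp (b : HilbertBasis ι ℝ H) (d : ι → ℝ) : diagDom b d →ₗ[ℝ] H where
  toFun v := b.repr.symm ⟨fun i => d i * inner ℝ (b i) (v : H), memlp_of_mem_diagDom v.2⟩
  map_add' u v := by
    rw [← map_add]
    congr 1
    ext i
    exact (congrArg (d i * ·) (inner_add_right _ _ _)).trans (mul_add _ _ _)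
  map_smul' a v := by
    rw [RingHom.id_apply, ← map_smul]
    congr 1
    ext i
    exact (congrArg (d i * ·) (inner_smul_right _ _ _)).trans (mul_left_comm _ _ _)

theorem hasSum_diagOp (b : HilbertBasis ι ℝ H) (d : ι → ℝ) (v : diagDom b d) :
    HasSum (fun i => (d i * inner ℝ (b i) (v : H)) • b i) (diagOp b d v) :=
  b.hasSum_repr_symm ⟨fun i => d i * inner ℝ (b i) (v : H), memlp_of_mem_diagDom v.2⟩

theorem inner_diagOp (b : HilbertBasis ι ℝ H) (d : ι → ℝ) (v : diagDom b d) (i : ι) :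
    inner ℝ (b i) (diagOp b d v) = d i * inner ℝ (b i) (v : H) := by
  rw [← b.repr_apply_apply]
  simp [diagOp]

theorem summable_inner_sq (b : HilbertBasis ι ℝ H) (v : H) :
    Summable fun i => (inner ℝ (b i) v : ℝ) ^ 2 := by
  refine (b.summable_inner_mul_inner v v).congr (fun i => ?_)
  rw [real_inner_comm v (b i)]; ring

theorem norm_sq_eq_tsum (b : HilbertBasis ι ℝ H) (v : H) :
    ‖v‖ ^ 2 = ∑' i, (inner ℝ (b i) v : ℝ) ^ 2 := by
  rw [← real_inner_self_eq_norm_sq, ← b.tsum_inner_mul_inner v v]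
  refine tsum_congr (fun i => ?_)
  rw [real_inner_comm v (b i)]; ring

theorem mem_diagDom_of_bounded (b : HilbertBasis ι ℝ H) {d : ι → ℝ} {C : ℝ}
    (hd : ∀ i, |d i| ≤ C) (v : H) : v ∈ diagDom b d := by
  refine Summable.of_nonneg_of_le (fun i => sq_nonneg _) (fun i => ?_)
    ((summable_inner_sq b v).mul_left (C ^ 2))
  rw [mul_pow]
  exact mul_le_mul_of_nonneg_right (sq_le_sq' (by linarith [neg_abs_le (d i), hd i])
    ((le_abs_self _).trans (hd i))) (sq_nonneg _)

open Classical in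
/-- For bounded `d` the bounded diagonal operator `v ↦ ∑ᵢ dᵢ ⟨bᵢ, v⟩ bᵢ` on `H`
(the value `0` for unbounded `d` is never used). -/
def diagBdd (b : HilbertBasis ι ℝ H) (d : ι → ℝ) : H →L[ℝ] H :=
  if hd : ∃ C, ∀ i, |d i| ≤ C then
    LinearMap.mkContinuousOfExistsBound
      ((diagOp b d).comp (LinearMap.codRestrict (diagDom b d) LinearMap.id
        (fun v => mem_diagDom_of_bounded b hd.choose_spec v))) (by
      obtain ⟨C, hC⟩ := hd
      refine ⟨|C|, fun v => ?_⟩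
      refine le_of_sq_le_sq ?_ (by positivity)
      rw [norm_sq_eq_tsum b, mul_pow, norm_sq_eq_tsum b v, ← tsum_mul_left]
      have hle : ∀ i, (inner ℝ (b i) (diagOp b d ⟨v, mem_diagDom_of_bounded b hC v⟩) : ℝ) ^ 2
          ≤ |C| ^ 2 * (inner ℝ (b i) v : ℝ) ^ 2 := by
        intro i
        rw [inner_diagOp, mul_pow]
        refine mul_le_mul_of_nonneg_right ?_ (sq_nonneg _)
        exact sq_le_sq' (by linarith [neg_abs_le (d i), hC i, le_abs_self C])
          ((le_abs_self _).trans ((hC i).trans (le_abs_self C)))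
      exact Summable.tsum_le_tsum hle (summable_inner_sq b _)
        ((summable_inner_sq b v).mul_left _))
  else 0

theorem hasSum_diagBdd (b : HilbertBasis ι ℝ H) {d : ι → ℝ} {C : ℝ} (hd : ∀ i, |d i| ≤ C) (v : H) :
    HasSum (fun i => (d i * inner ℝ (b i) v) • b i) (diagBdd b d v) := by
  have h : ∃ C, ∀ i, |d i| ≤ C := ⟨C, hd⟩
  have := hasSum_diagOp b d ⟨v, mem_diagDom_of_bounded b hd v⟩
  rw [diagBdd, dif_pos h]
  exact this

end Diagonal

/-- The data of a diagonal negative operator: an orthonormal basis `(bᵢ)` of `H` and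
eigenvalues `(μᵢ)` with `supᵢ μᵢ < 0`. -/
structure DiagNegOp (ι H : Type*) [NormedAddCommGroup H] [InnerProductSpace ℝ H] where
  basis : HilbertBasis ι ℝ H
  eig : ι → ℝ
  eig_neg : ∃ δ : ℝ, 0 < δ ∧ ∀ i, eig i ≤ -δ

namespace DiagNegOp

variable {ι H : Type*} [NormedAddCommGroup H] [InnerProductSpace ℝ H] (A : DiagNegOp ι H)

theorem neg_eig_pos (i : ι) : 0 < -A.eig i := by
  obtain ⟨δ, hδ, h⟩ := A.eig_neg
  linarith [h i]

/-- For `r ≥ 0`, the interpolation space `H_r = D((-A)^r)` associated to `-A`, a subspace of `H`;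
it carries the inner product `⟨u, v⟩_{H_r} = ⟨(-A)^r u, (-A)^r v⟩_H` (see below). -/
def Interp (r : ℝ) : Type _ := diagDom A.basis (fun i => (-A.eig i) ^ r)

variable {A} in
/-- The inclusion `H_r ⊆ H`. -/
def Interp.toH {r : ℝ} (v : A.Interp r) : H := v.1

variable {A} in
theorem Interp.mem {r : ℝ} (v : A.Interp r) :
    v.toH ∈ diagDom A.basis (fun i => (-A.eig i) ^ r) := v.2

instance (r : ℝ) : AddCommGroup (A.Interp r) :=
  inferInstanceAs (AddCommGroup (diagDom A.basis (fun i => (-A.eig i) ^ r)))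

instance (r : ℝ) : Module ℝ (A.Interp r) :=
  inferInstanceAs (Module ℝ (diagDom A.basis (fun i => (-A.eig i) ^ r)))

/-- The fractional power `(-A)^r : H_r → H`, `v ↦ ∑ᵢ (-μᵢ)^r ⟨bᵢ, v⟩ bᵢ`. -/
def fracPow (r : ℝ) : A.Interp r →ₗ[ℝ] H := diagOp A.basis (fun i => (-A.eig i) ^ r)

theorem fracPow_injective (r : ℝ) : Function.Injective (A.fracPow r) := by
  intro u v huv
  apply Subtype.ext
  apply A.basis.repr.injective
  ext i
  rw [A.basis.repr_apply_apply, A.basis.repr_apply_apply]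
  have h : inner ℝ (A.basis i) (A.fracPow r u) = inner ℝ (A.basis i) (A.fracPow r v) := by rw [huv]
  erw [inner_diagOp, inner_diagOp] at h
  exact mul_left_cancel₀ (Real.rpow_pos_of_pos (A.neg_eig_pos i) r).ne' h

/-- `‖v‖_{H_r} = ‖(-A)^r v‖_H`. -/
instance (r : ℝ) : NormedAddCommGroup (A.Interp r) :=
  NormedAddCommGroup.induced _ _ (A.fracPow r) (A.fracPow_injective r)

/-- `⟨u, v⟩_{H_r} = ⟨(-A)^r u, (-A)^r v⟩_H`. -/
instance (r : ℝ) : InnerProductSpace ℝ (A.Interp r) := InnerProductSpace.induced (A.fracPow r)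

theorem norm_interp {r : ℝ} (v : A.Interp r) : ‖v‖ = ‖A.fracPow r v‖ := rfl

theorem inner_interp {r : ℝ} (u v : A.Interp r) :
    inner ℝ u v = inner ℝ (A.fracPow r u) (A.fracPow r v) := rfl

instance (r : ℝ) : MeasurableSpace (A.Interp r) := borel _

instance (r : ℝ) : BorelSpace (A.Interp r) := ⟨rfl⟩

theorem diagDom_mono {r s : ℝ} (hrs : r ≤ s) :
    diagDom A.basis (fun i => (-A.eig i) ^ s) ≤ diagDom A.basis (fun i => (-A.eig i) ^ r) := by
  obtain ⟨δ, hδ, hd⟩ := A.eig_neg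
  intro v hv
  refine Summable.of_nonneg_of_le (fun i => sq_nonneg _) (fun i => ?_)
    (hv.mul_left ((δ ^ (r - s)) ^ 2))
  have hpos := A.neg_eig_pos i
  have h1 : (-A.eig i) ^ r = (-A.eig i) ^ (r - s) * (-A.eig i) ^ s := by
    rw [← Real.rpow_add hpos]; congr 1; ring
  have h2 : (-A.eig i) ^ (r - s) ≤ δ ^ (r - s) :=
    Real.rpow_le_rpow_of_nonpos hδ (by linarith [hd i]) (by linarith)
  have h3 : 0 ≤ (-A.eig i) ^ (r - s) := Real.rpow_nonneg hpos.le _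
  simp only
  rw [h1, mul_assoc, mul_pow]
  gcongr

/-- The inclusion `H_s ⊆ H_r` for `r ≤ s`. -/
def incl {r s : ℝ} (hrs : r ≤ s) (v : A.Interp s) : A.Interp r := ⟨v.toH, A.diagDom_mono hrs v.mem⟩

theorem mem_diagDom_eig (v : A.Interp 1) : v.toH ∈ diagDom A.basis A.eig := by
  refine (mem_diagDom.1 v.mem).congr (fun i => ?_)
  simp only [Real.rpow_one]; ring

/-- The operator `A : D(A) = H_1 → H`, `A v = ∑ᵢ μᵢ ⟨bᵢ, v⟩ bᵢ`. -/
def op (v : A.Interp 1) : H := diagOp A.basis A.eig ⟨v.toH, A.mem_diagDom_eig v⟩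

/-- The semigroup `e^{tA}`, for `t ≥ 0`. -/
def semigroup (t : ℝ) : H →L[ℝ] H := diagBdd A.basis (fun i => Real.exp (t * A.eig i))

theorem hasSum_semigroup {t : ℝ} (ht : 0 ≤ t) (v : H) :
    HasSum (fun i => (Real.exp (t * A.eig i) * inner ℝ (A.basis i) v) • A.basis i)
      (A.semigroup t v) := by
  refine hasSum_diagBdd A.basis (C := 1) (fun i => ?_) v
  rw [abs_of_pos (Real.exp_pos _), Real.exp_le_one_iff]
  nlinarith [A.neg_eig_pos i]

/-- The bounded operator `(-A)^{-r}` on `H`, for `r ≥ 0`. -/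
def negFracPow (r : ℝ) : H →L[ℝ] H := diagBdd A.basis (fun i => (-A.eig i) ^ (-r))

theorem hasSum_negFracPow {r : ℝ} (hr : 0 ≤ r) (v : H) :
    HasSum (fun i => ((-A.eig i) ^ (-r) * inner ℝ (A.basis i) v) • A.basis i)
      (A.negFracPow r v) := by
  obtain ⟨δ, hδ, hd⟩ := A.eig_neg
  refine hasSum_diagBdd A.basis (C := δ ^ (-r)) (fun i => ?_) v
  rw [abs_of_pos (Real.rpow_pos_of_pos (A.neg_eig_pos i) _)]
  exact Real.rpow_le_rpow_of_nonpos hδ (by linarith [hd i]) (by linarith)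

/-- The spectral projection `P_I v = ∑_{i ∈ I} ⟨bᵢ, v⟩ bᵢ`. -/
def proj (I : Finset ι) : H →L[ℝ] H :=
  ∑ i ∈ I, (innerSL ℝ (A.basis i)).smulRight (A.basis i)

theorem proj_apply (I : Finset ι) (v : H) :
    A.proj I v = ∑ i ∈ I, (inner ℝ (A.basis i) v : ℝ) • A.basis i := by
  simp [proj]

theorem proj_mem_diagDom (I : Finset ι) (d : ι → ℝ) (v : H) :
    A.proj I v ∈ diagDom A.basis d := by
  classical
  rw [proj_apply]
  refine Submodule.sum_mem _ (fun j _ => Submodule.smul_mem _ _ ?_)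
  refine summable_of_ne_finset_zero (s := {j}) (fun i hi => ?_)
  have : i ≠ j := by simpa using hi
  simp [A.basis.orthonormal.inner_eq_zero this]

/-- `P_I v`, as an element of `H_r`. -/
def projTo (I : Finset ι) (r : ℝ) (v : H) : A.Interp r := ⟨A.proj I v, A.proj_mem_diagDom I _ v⟩

end DiagNegOp

/-- `⌊t⌋_h = max ({0, h, -h, 2h, -2h, …} ∩ (-∞, t])`. -/
def gridFloor (h t : ℝ) : ℝ := ⌊t / h⌋ * h

theorem isGreatest_gridFloor {h : ℝ} (hh : 0 < h) (t : ℝ) :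
    IsGreatest ({x : ℝ | ∃ k : ℤ, x = k * h} ∩ Iic t) (gridFloor h t) := by
  refine ⟨⟨⟨⌊t / h⌋, rfl⟩, ?_⟩, ?_⟩
  · exact (le_div_iff₀ hh).1 (Int.floor_le _)
  · rintro x ⟨⟨k, rfl⟩, hk⟩
    refine mul_le_mul_of_nonneg_right ?_ hh.le
    exact_mod_cast Int.le_floor.2 ((le_div_iff₀ hh).2 hk)

/-- The expectation `E[f] ∈ [0, ∞]` of a nonnegative random variable `f`. -/
def expect {Ω : Type*} [MeasurableSpace Ω] (P : Measure Ω) (f : Ω → ℝ) : ℝ≥0∞ :=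
  ∫⁻ ω, ENNReal.ofReal (f ω) ∂P

end

/-! Write Z = Y − O^{M,I} and h = T/M. In the eigenbasis of A every convolution with the semigroup
splits into scalar convolutions z_i(t) = ∫₀ᵗ e^{(t-s)μ_i} g_i(s) ds, so P_I(X − O) and Z are both
finite sums of modes (`modeConv`) solving z_i' = μ_i z_i + g_i. The drift of the scheme is a step
function, so these equations hold only for right derivatives, which is enough for a Gronwall
argument (`sum_expConv_sq_le_of_dissipative`).

A priori bound. While the truncation is inactive, the H_γ-norms of Y and O^{M,I} at the grid point
are at most h^{-χ}. Over one cell Z then moves in V by at most a constant times h^{γ-ρ} h^{-χ} +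
h^{1-ρ} h^{-χ(1+φ/2)}. The local Lipschitz bound multiplies this by h^{-χφ/2}, and the two
conditions on χ are exactly what keeps the products bounded (`exists_norm_nonlinearity_sub_le`). Up
to a bounded error the drift is therefore F(Z_t + O^{M,I}) with the noise frozen at the grid point.
Coercivity controls the energy ‖Z‖²_{H_{1/2}} + ϕ‖Z‖²_H, and the error is absorbed by the spare (1 −
ε)‖Z‖²_{H_1}. If the drift is truncated to zero, the energy dissipates. This gives ‖Y‖²_{H_γ} ≤ C(1
+ ‖O^{M,I}‖²_{H_γ} + Φ + ϕ) almost surely at each fixed time, hence (i).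

Error. Decompose X − Y into X − P_I X, P_I O − O^{M,I} and e = P_I X − P_I O − Z. The first term
gains ‖(-A)^{-ϱ}(Id − P_I)‖ from the smoothing of the semigroup, at the price of the kernel (t −
s)^{-(ρ+ϱ)}, integrable since ρ + ϱ < 1. For e, the one-sided Lipschitz condition between P_I X and
Z + P_I O gives ‖e_t‖² ≤ C ∫ ‖F(X) − F(P_I X)‖² + ‖F(Z + P_I O) − drift‖². Both integrands are a
small factor times a polynomial weight: the first by the projection error just described, the second
because over one cell Z moves by O(h^ϱ) while the noise contributes its increment and its
approximation error. Where the truncation is active, h^χ(‖Y‖ + ‖O^{M,I}‖) > 1, and its ϑ-th power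
pays the rate h^{χϑ}.

Moments. Small factors and weights are separated by Cauchy–Schwarz in L^{2p} × L^{2p}. Jensen's
inequality for the kernel measure and Tonelli's theorem pass moments through the time integrals. All
this is done for families indexed by (M, I), with bounds proportional to a rate R(M, I)
(`MomentBound`); in the end R is the right-hand side of (ii). -/

open Filter Topology

namespace DiagNegOp

/-! ### Coordinates in the eigenbasis, spectral projections, inclusions between the spaces H_r. -/

section Coordinates

variable {ι H : Type*} [NormedAddCommGroup H] [InnerProductSpace ℝ H] (A : DiagNegOp ι H)

variable {A} in
theorem Interp.ext_toH {r : ℝ} {u v : A.Interp r} (h : u.toH = v.toH) : u = v := Subtype.ext h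

variable {A} in
@[simp] theorem Interp.toH_add {r : ℝ} (u v : A.Interp r) : (u + v).toH = u.toH + v.toH := rfl

variable {A} in
@[simp] theorem Interp.toH_sub {r : ℝ} (u v : A.Interp r) : (u - v).toH = u.toH - v.toH := rfl

variable {A} in
theorem Interp.toH_mk {r : ℝ} (x : H) (hx : x ∈ diagDom A.basis (fun i => (-A.eig i) ^ r)) :
    Interp.toH (⟨x, hx⟩ : A.Interp r) = x := rfl

variable {A} in
@[simp] theorem Interp.toH_smul {r : ℝ} (a : ℝ) (v : A.Interp r) : (a • v).toH = a • v.toH := rfl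

@[simp] theorem toH_incl {r s : ℝ} (hrs : r ≤ s) (v : A.Interp s) :
    (A.incl hrs v).toH = v.toH := Interp.toH_mk _ _

@[simp] theorem toH_projTo (I : Finset ι) (r : ℝ) (v : H) :
    (A.projTo I r v).toH = A.proj I v := Interp.toH_mk _ _

@[simp] theorem incl_projTo {r s : ℝ} (hrs : r ≤ s) (I : Finset ι) (v : H) :
    A.incl hrs (A.projTo I s v) = A.projTo I r v := Interp.ext_toH (by simp)

theorem inner_basis_fracPow {r : ℝ} (v : A.Interp r) (i : ι) :
    inner ℝ (A.basis i) (A.fracPow r v) = (-A.eig i) ^ r * inner ℝ (A.basis i) v.toH :=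
  inner_diagOp _ _ _ _

theorem inner_basis_op (v : A.Interp 1) (i : ι) :
    inner ℝ (A.basis i) (A.op v) = A.eig i * inner ℝ (A.basis i) v.toH :=
  inner_diagOp _ _ _ _

theorem inner_basis_basis_of_ne {i j : ι} (h : i ≠ j) :
    inner ℝ (A.basis i) (A.basis j) = 0 := A.basis.orthonormal.inner_eq_zero h

theorem inner_basis_self (i : ι) : inner ℝ (A.basis i) (A.basis i) = 1 := by
  rw [real_inner_self_eq_norm_sq, A.basis.orthonormal.norm_eq_one]; norm_num

theorem inner_basis_sum_mem (I : Finset ι) (c : ι → ℝ) {i : ι} (hi : i ∈ I) :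
    inner ℝ (A.basis i) (∑ j ∈ I, c j • A.basis j) = c i := by
  rw [inner_sum, Finset.sum_eq_single_of_mem i hi]
  · rw [inner_smul_right, A.inner_basis_self, mul_one]
  · intro j _ hj
    rw [inner_smul_right, A.inner_basis_basis_of_ne hj.symm, mul_zero]

theorem inner_basis_sum_notMem (I : Finset ι) (c : ι → ℝ) {i : ι} (hi : i ∉ I) :
    inner ℝ (A.basis i) (∑ j ∈ I, c j • A.basis j) = 0 := by
  rw [inner_sum]
  refine Finset.sum_eq_zero fun j hj => ?_
  rw [inner_smul_right, A.inner_basis_basis_of_ne (fun h : i = j => hi (h ▸ hj)), mul_zero]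

theorem inner_basis_proj_mem {I : Finset ι} {i : ι} (hi : i ∈ I) (v : H) :
    inner ℝ (A.basis i) (A.proj I v) = inner ℝ (A.basis i) v := by
  rw [A.proj_apply, A.inner_basis_sum_mem I _ hi]

theorem inner_basis_proj_notMem {I : Finset ι} {i : ι} (hi : i ∉ I) (v : H) :
    inner ℝ (A.basis i) (A.proj I v) = 0 := by
  rw [A.proj_apply, A.inner_basis_sum_notMem I _ hi]

theorem ext_inner_basis {u v : H} (h : ∀ i, inner ℝ (A.basis i) u = inner ℝ (A.basis i) v) :
    u = v := by
  apply A.basis.repr.injective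
  ext i
  rw [A.basis.repr_apply_apply, A.basis.repr_apply_apply, h]

theorem proj_proj (I : Finset ι) (v : H) : A.proj I (A.proj I v) = A.proj I v := by
  refine A.ext_inner_basis fun i => ?_
  by_cases hi : i ∈ I
  · rw [A.inner_basis_proj_mem hi]
  · rw [A.inner_basis_proj_notMem hi, A.inner_basis_proj_notMem hi]

theorem proj_eq_self {I : Finset ι} {v : H} (hv : v ∈ range (A.proj I)) : A.proj I v = v := by
  obtain ⟨w, rfl⟩ := hv
  exact A.proj_proj I w

theorem inner_basis_of_mem_range {I : Finset ι} {v : H} (hv : v ∈ range (A.proj I)) {i : ι}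
    (hi : i ∉ I) : inner ℝ (A.basis i) v = 0 := by
  rw [← A.proj_eq_self hv, A.inner_basis_proj_notMem hi]

theorem inner_eq_sum_of_mem_range {I : Finset ι} {v : H} (hv : v ∈ range (A.proj I)) (w : H) :
    inner ℝ v w = ∑ i ∈ I, inner ℝ (A.basis i) v * inner ℝ (A.basis i) w := by
  conv_lhs => rw [← A.proj_eq_self hv, A.proj_apply]
  rw [sum_inner]
  refine Finset.sum_congr rfl fun i _ => ?_
  rw [inner_smul_left]; rfl

theorem norm_sq_eq_sum_of_mem_range {I : Finset ι} {v : H} (hv : v ∈ range (A.proj I)) :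
    ‖v‖ ^ 2 = ∑ i ∈ I, (inner ℝ (A.basis i) v) ^ 2 := by
  rw [← real_inner_self_eq_norm_sq, A.inner_eq_sum_of_mem_range hv]
  exact Finset.sum_congr rfl fun i _ => (sq _).symm

theorem norm_sq_interp {r : ℝ} (v : A.Interp r) :
    ‖v‖ ^ 2 = ∑' i, ((-A.eig i) ^ r * inner ℝ (A.basis i) v.toH) ^ 2 := by
  rw [norm_interp, norm_sq_eq_tsum A.basis]
  simp only [inner_basis_fracPow]

theorem fracPow_mem_range {r : ℝ} {I : Finset ι} {v : A.Interp r}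
    (hv : v.toH ∈ range (A.proj I)) : A.fracPow r v ∈ range (A.proj I) := by
  refine ⟨A.fracPow r v, A.ext_inner_basis fun i => ?_⟩
  by_cases hi : i ∈ I
  · rw [A.inner_basis_proj_mem hi]
  · rw [A.inner_basis_proj_notMem hi, inner_basis_fracPow, A.inner_basis_of_mem_range hv hi,
      mul_zero]

theorem norm_sq_interp_eq_sum {r : ℝ} {I : Finset ι} {v : A.Interp r}
    (hv : v.toH ∈ range (A.proj I)) :
    ‖v‖ ^ 2 = ∑ i ∈ I, ((-A.eig i) ^ r * inner ℝ (A.basis i) v.toH) ^ 2 := by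
  rw [norm_interp, A.norm_sq_eq_sum_of_mem_range (A.fracPow_mem_range hv)]
  simp only [inner_basis_fracPow]

theorem inner_interp_eq_sum {r : ℝ} {I : Finset ι} {v : A.Interp r}
    (hv : v.toH ∈ range (A.proj I)) (w : A.Interp r) :
    inner ℝ v w = ∑ i ∈ I, ((-A.eig i) ^ r * inner ℝ (A.basis i) v.toH)
      * ((-A.eig i) ^ r * inner ℝ (A.basis i) w.toH) := by
  rw [inner_interp, A.inner_eq_sum_of_mem_range (A.fracPow_mem_range hv)]
  simp only [inner_basis_fracPow]

/-- By Parseval, bounds on diagonal operators into H_r can be checked coefficient by coefficient. -/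
theorem norm_interp_le_of_forall {r : ℝ} (v : A.Interp r) (w : H) {C : ℝ} (hC : 0 ≤ C)
    (h : ∀ i, |(-A.eig i) ^ r * inner ℝ (A.basis i) v.toH| ≤ C * |inner ℝ (A.basis i) w|) :
    ‖v‖ ≤ C * ‖w‖ := by
  refine le_of_sq_le_sq ?_ (by positivity)
  rw [mul_pow, A.norm_sq_interp, norm_sq_eq_tsum A.basis w, ← tsum_mul_left]
  have hs := (summable_inner_sq A.basis w).mul_left (C ^ 2)
  have hle : ∀ i, ((-A.eig i) ^ r * inner ℝ (A.basis i) v.toH) ^ 2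
      ≤ C ^ 2 * (inner ℝ (A.basis i) w) ^ 2 := by
    intro i
    rw [← sq_abs, ← sq_abs (inner ℝ (A.basis i) w), ← mul_pow]
    exact pow_le_pow_left₀ (abs_nonneg _) (h i) 2
  exact Summable.tsum_le_tsum hle
    (Summable.of_nonneg_of_le (fun i => sq_nonneg _) hle hs) hs

theorem norm_interp_le_of_sum_le {r : ℝ} (v : A.Interp r) {C : ℝ} (hC : 0 ≤ C)
    (h : ∀ I : Finset ι, ∑ i ∈ I, ((-A.eig i) ^ r * inner ℝ (A.basis i) v.toH) ^ 2 ≤ C ^ 2) :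
    ‖v‖ ≤ C := by
  refine le_of_sq_le_sq ?_ hC
  rw [A.norm_sq_interp]
  exact Real.tsum_le_of_sum_le (fun i => sq_nonneg _) h

theorem sum_inner_sq_le (I : Finset ι) (v : H) :
    ∑ i ∈ I, (inner ℝ (A.basis i) v) ^ 2 ≤ ‖v‖ ^ 2 := by
  rw [norm_sq_eq_tsum A.basis v]
  exact (summable_inner_sq A.basis v).sum_le_tsum I fun i _ => sq_nonneg _

theorem exists_norm_incl_le {r s : ℝ} (hrs : r ≤ s) :
    ∃ C : ℝ, 0 < C ∧ ∀ v : A.Interp s, ‖A.incl hrs v‖ ≤ C * ‖v‖ := by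
  obtain ⟨δ, hδ, hd⟩ := A.eig_neg
  refine ⟨δ ^ (r - s), Real.rpow_pos_of_pos hδ _, fun v => ?_⟩
  rw [A.norm_interp v]
  refine A.norm_interp_le_of_forall _ _ (Real.rpow_nonneg hδ.le _) fun i => ?_
  have hpos := A.neg_eig_pos i
  have h1 : (-A.eig i) ^ r = (-A.eig i) ^ (r - s) * (-A.eig i) ^ s := by
    rw [← Real.rpow_add hpos]; congr 1; ring
  have h2 : (-A.eig i) ^ (r - s) ≤ δ ^ (r - s) :=
    Real.rpow_le_rpow_of_nonpos hδ (by linarith [hd i]) (by linarith)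
  rw [toH_incl, inner_basis_fracPow, h1, mul_assoc, abs_mul,
    abs_of_pos (Real.rpow_pos_of_pos hpos _)]
  gcongr

theorem incl_add {r s : ℝ} (hrs : r ≤ s) (u v : A.Interp s) :
    A.incl hrs (u + v) = A.incl hrs u + A.incl hrs v :=
  Interp.ext_toH (by rw [Interp.toH_add, toH_incl, toH_incl, toH_incl, Interp.toH_add])

theorem incl_smul {r s : ℝ} (hrs : r ≤ s) (a : ℝ) (v : A.Interp s) :
    A.incl hrs (a • v) = a • A.incl hrs v :=
  Interp.ext_toH (by rw [Interp.toH_smul, toH_incl, toH_incl, Interp.toH_smul])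

/-- The inclusion `H_s ⊆ H_r` as a linear map. -/
noncomputable def inclLin {r s : ℝ} (hrs : r ≤ s) : A.Interp s →ₗ[ℝ] A.Interp r where
  toFun := A.incl hrs
  map_add' := A.incl_add hrs
  map_smul' := A.incl_smul hrs

theorem inclLin_apply {r s : ℝ} (hrs : r ≤ s) (v : A.Interp s) :
    A.inclLin hrs v = A.incl hrs v := rfl

/-- The inclusion `H_s ⊆ H_r` as a continuous linear map. -/
noncomputable def inclL {r s : ℝ} (hrs : r ≤ s) : A.Interp s →L[ℝ] A.Interp r :=
  LinearMap.mkContinuousOfExistsBound (A.inclLin hrs)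
    (by
      obtain ⟨C, -, h⟩ := A.exists_norm_incl_le hrs
      exact ⟨C, fun v => by rw [inclLin_apply]; exact h v⟩)

@[simp] theorem inclL_apply {r s : ℝ} (hrs : r ≤ s) (v : A.Interp s) :
    A.inclL hrs v = A.incl hrs v := rfl

/-- The spectral projection `P_I` as a continuous linear map into `H_r`. -/
noncomputable def projToL (I : Finset ι) (r : ℝ) : H →L[ℝ] A.Interp r :=
  LinearMap.mkContinuousOfExistsBound
    { toFun := A.projTo I r
      map_add' := fun u v => Interp.ext_toH (map_add (A.proj I) u v)
      map_smul' := fun a v => Interp.ext_toH (map_smul (A.proj I) a v) }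
    (by
      refine ⟨∑ i ∈ I, (-A.eig i) ^ r, fun v => A.norm_interp_le_of_forall _ _
        (Finset.sum_nonneg fun i _ => Real.rpow_nonneg (A.neg_eig_pos i).le _) fun i => ?_⟩
      change |_ * inner ℝ (A.basis i) (A.proj I v)| ≤ _
      by_cases hi : i ∈ I
      · rw [A.inner_basis_proj_mem hi, abs_mul,
          abs_of_pos (Real.rpow_pos_of_pos (A.neg_eig_pos i) r)]
        refine mul_le_mul_of_nonneg_right ?_ (abs_nonneg _)
        exact Finset.single_le_sum (f := fun i => (-A.eig i) ^ r)
          (fun i _ => Real.rpow_nonneg (A.neg_eig_pos i).le _) hi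
      · rw [A.inner_basis_proj_notMem hi, mul_zero, abs_zero]
        exact mul_nonneg (Finset.sum_nonneg fun i _ => Real.rpow_nonneg (A.neg_eig_pos i).le _)
          (abs_nonneg _))

@[simp] theorem projToL_apply (I : Finset ι) (r : ℝ) (v : H) :
    A.projToL I r v = A.projTo I r v := rfl

theorem fracPow_projTo {r : ℝ} (I : Finset ι) (v : A.Interp r) :
    A.fracPow r (A.projTo I r v.toH) = A.proj I (A.fracPow r v) := by
  refine A.ext_inner_basis fun i => ?_
  rw [inner_basis_fracPow, toH_projTo]
  by_cases hi : i ∈ I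
  · rw [A.inner_basis_proj_mem hi, A.inner_basis_proj_mem hi, inner_basis_fracPow]
  · rw [A.inner_basis_proj_notMem hi, A.inner_basis_proj_notMem hi, mul_zero]

theorem isometry_fracPow (r : ℝ) : Isometry (A.fracPow r) :=
  AddMonoidHomClass.isometry_of_norm _ fun _ => rfl

theorem tendsto_proj (v : H) : Tendsto (fun I => A.proj I v) atTop (𝓝 v) := by
  have h := A.basis.hasSum_repr v
  simp only [A.basis.repr_apply_apply] at h
  simpa only [HasSum, proj_apply, SummationFilter.unconditional_filter] using h

/-- (-A)^r is an isometry of H_r into H commuting with P_I, so the strong convergence P_I → Id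
transfers from H. This lets the Lipschitz hypothesis leave the finite-dimensional subspaces. -/
theorem tendsto_projTo {r : ℝ} (v : A.Interp r) :
    Tendsto (fun I => A.projTo I r v.toH) atTop (𝓝 v) := by
  rw [(A.isometry_fracPow r).isEmbedding.isInducing.tendsto_nhds_iff]
  refine (A.tendsto_proj (A.fracPow r v)).congr fun I => ?_
  exact (A.fracPow_projTo I v).symm

instance [TopologicalSpace.SeparableSpace H] (r : ℝ) :
    SecondCountableTopology (A.Interp r) := by
  have := UniformSpace.secondCountable_of_separable H
  exact (A.isometry_fracPow r).isEmbedding.isInducing.secondCountableTopology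

/-- Distinct basis vectors have distance √2, so balls of radius 1/2 around them are disjoint.
Countability makes the finite subsets of the index set a countably generated directed set, along
which measurability survives limits. -/
theorem countable_index [TopologicalSpace.SeparableSpace H] (A : DiagNegOp ι H) :
    Countable ι := by
  refine Pairwise.countable_of_isOpen_disjoint (s := fun i => Metric.ball (A.basis i) (1 / 2))
    (fun i j hij => ?_) (fun i => Metric.isOpen_ball) (fun i => ⟨_, Metric.mem_ball_self (by norm_num)⟩)
  refine Metric.ball_disjoint_ball ?_
  have h : ‖A.basis i - A.basis j‖ ^ 2 = 2 := by
    rw [norm_sub_sq_real, A.inner_basis_basis_of_ne hij, A.basis.orthonormal.norm_eq_one,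
      A.basis.orthonormal.norm_eq_one]
    norm_num
  rw [dist_eq_norm]
  nlinarith [norm_nonneg (A.basis i - A.basis j)]

theorem inner_basis_semigroup [CompleteSpace H] {t : ℝ} (ht : 0 ≤ t) (v : H) (i : ι) :
    inner ℝ (A.basis i) (A.semigroup t v)
      = Real.exp (t * A.eig i) * inner ℝ (A.basis i) v := by
  have h := (A.hasSum_semigroup ht v).mapL (innerSL ℝ (A.basis i))
  refine h.unique ?_
  convert hasSum_single i ?_ using 1
  · rw [innerSL_apply_apply, inner_smul_right, A.inner_basis_self, mul_one]
  · intro j hj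
    simp [A.inner_basis_basis_of_ne hj.symm]

theorem norm_semigroup_apply_le [CompleteSpace H] {t : ℝ} (ht : 0 ≤ t) (v : H) :
    ‖A.semigroup t v‖ ≤ ‖v‖ := by
  refine le_of_sq_le_sq ?_ (norm_nonneg _)
  rw [norm_sq_eq_tsum A.basis, norm_sq_eq_tsum A.basis v]
  refine Summable.tsum_le_tsum (fun i => ?_) (summable_inner_sq _ _) (summable_inner_sq _ _)
  rw [A.inner_basis_semigroup ht, mul_pow]
  refine mul_le_of_le_one_left (sq_nonneg _) (pow_le_one₀ (Real.exp_pos _).le ?_)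
  rw [Real.exp_le_one_iff]
  nlinarith [A.neg_eig_pos i]

end Coordinates

end DiagNegOp

/-! ### A class of drifts containing both continuous functions and grid step functions. -/

/-- Strongly measurable, locally bounded, right-continuous functions on the real line. -/
structure RightRegular {E : Type*} [NormedAddCommGroup E] (f : ℝ → E) : Prop where
  meas : StronglyMeasurable f
  bdd : ∀ R : ℝ, ∃ C : ℝ, ∀ s, |s| ≤ R → ‖f s‖ ≤ C
  right : ∀ t, ContinuousWithinAt f (Ici t) t

namespace RightRegular

variable {E G : Type*} [NormedAddCommGroup E] [NormedAddCommGroup G]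

theorem of_continuous {f : ℝ → E} (hf : Continuous f) : RightRegular f where
  meas := hf.stronglyMeasurable
  bdd R := by
    obtain ⟨C, hC⟩ := (isCompact_Icc (a := -R) (b := R)).exists_bound_of_continuousOn
      hf.continuousOn
    exact ⟨C, fun s hs => hC s (abs_le.1 hs)⟩
  right t := hf.continuousWithinAt

/-- The floor function is constant immediately to the right of each point. The drifts of the scheme,
frozen on grid cells, are of this form. -/
theorem comp_floor (g : ℤ → E) {h : ℝ} (hh : 0 < h) : RightRegular fun s => g ⌊s / h⌋ where
  meas := (StronglyMeasurable.of_discrete (f := g)).comp_measurable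
    (Int.measurable_floor.comp (measurable_id.div_const h))
  bdd R := by
    obtain ⟨C, hC⟩ := ((finite_Icc ⌊-R / h⌋ ⌊R / h⌋).image fun k => ‖g k‖).bddAbove
    refine ⟨C, fun s hs => hC ⟨_, ⟨?_, ?_⟩, rfl⟩⟩
    · exact Int.floor_le_floor (div_le_div_of_nonneg_right (abs_le.1 hs).1 hh.le)
    · exact Int.floor_le_floor (div_le_div_of_nonneg_right (abs_le.1 hs).2 hh.le)
  right t := by
    have h1 : Tendsto (fun s : ℝ => s / h) (𝓝[≥] t) (𝓝[≥] (t / h)) := by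
      refine tendsto_nhdsWithin_iff.2 ⟨?_, ?_⟩
      · exact ((continuous_id.div_const h).tendsto t).mono_left nhdsWithin_le_nhds
      · filter_upwards [self_mem_nhdsWithin] with s hs
        exact div_le_div_of_nonneg_right hs hh.le
    have h2 := (tendsto_floor_right_pure_floor (t / h)).comp h1
    exact (tendsto_pure_nhds g ⌊t / h⌋).comp h2

theorem sub {f g : ℝ → E} (hf : RightRegular f) (hg : RightRegular g) :
    RightRegular fun s => f s - g s where
  meas := hf.meas.sub hg.meas
  bdd R := by
    obtain ⟨C, hC⟩ := hf.bdd R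
    obtain ⟨D, hD⟩ := hg.bdd R
    exact ⟨C + D, fun s hs => (norm_sub_le _ _).trans (add_le_add (hC s hs) (hD s hs))⟩
  right t := (hf.right t).sub (hg.right t)

theorem add {f g : ℝ → E} (hf : RightRegular f) (hg : RightRegular g) :
    RightRegular fun s => f s + g s where
  meas := hf.meas.add hg.meas
  bdd R := by
    obtain ⟨C, hC⟩ := hf.bdd R
    obtain ⟨D, hD⟩ := hg.bdd R
    exact ⟨C + D, fun s hs => (norm_add_le _ _).trans (add_le_add (hC s hs) (hD s hs))⟩
  right t := (hf.right t).add (hg.right t)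

theorem mul {f g : ℝ → ℝ} (hf : RightRegular f) (hg : RightRegular g) :
    RightRegular fun s => f s * g s where
  meas := hf.meas.mul hg.meas
  bdd R := by
    obtain ⟨C, hC⟩ := hf.bdd R
    obtain ⟨D, hD⟩ := hg.bdd R
    refine ⟨C * D, fun s hs => (norm_mul_le _ _).trans ?_⟩
    exact mul_le_mul (hC s hs) (hD s hs) (norm_nonneg _) ((norm_nonneg _).trans (hC s hs))
  right t := (hf.right t).mul (hg.right t)

theorem norm_sq {f : ℝ → E} (hf : RightRegular f) : RightRegular fun s => ‖f s‖ ^ 2 where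
  meas := (hf.meas.norm.pow 2)
  bdd R := by
    obtain ⟨C, hC⟩ := hf.bdd R
    refine ⟨C ^ 2, fun s hs => ?_⟩
    rw [Real.norm_of_nonneg (sq_nonneg _)]
    exact pow_le_pow_left₀ (norm_nonneg _) (hC s hs) 2
  right t := (hf.right t).norm.pow 2

theorem clm [NormedSpace ℝ E] [NormedSpace ℝ G] (L : E →L[ℝ] G) {f : ℝ → E}
    (hf : RightRegular f) : RightRegular fun s => L (f s) where
  meas := L.continuous.comp_stronglyMeasurable hf.meas
  bdd R := by
    obtain ⟨C, hC⟩ := hf.bdd R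
    refine ⟨‖L‖ * C, fun s hs => (L.le_opNorm _).trans ?_⟩
    exact mul_le_mul_of_nonneg_left (hC s hs) (norm_nonneg _)
  right t := L.continuous.continuousAt.comp_continuousWithinAt (hf.right t)

theorem intervalIntegrable {f : ℝ → E} (hf : RightRegular f) (a b : ℝ) :
    IntervalIntegrable f volume a b := by
  obtain ⟨C, hC⟩ := hf.bdd (max |a| |b|)
  rw [intervalIntegrable_iff]
  refine Measure.integrableOn_of_bounded (M := C) (by simp) hf.meas.aestronglyMeasurable ?_
  filter_upwards [ae_restrict_mem measurableSet_uIoc] with s hs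
  refine hC s ?_
  rcases le_total a b with hab | hab
  · rw [uIoc_of_le hab] at hs
    exact abs_le_max_abs_abs hs.1.le hs.2
  · rw [uIoc_of_ge hab] at hs
    rw [max_comm]
    exact abs_le_max_abs_abs hs.1.le hs.2

end RightRegular

/-! ### Scalar exponential convolutions and their differential equation. -/

/-- The convolution `∫₀ᵗ e^{(t-s)m} g(s) ds`. -/
noncomputable def expConv (m : ℝ) (g : ℝ → ℝ) (t : ℝ) : ℝ :=
  ∫ s in (0 : ℝ)..t, Real.exp ((t - s) * m) * g s

theorem expConv_eq (m : ℝ) (g : ℝ → ℝ) (t : ℝ) :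
    expConv m g t = Real.exp (t * m) * ∫ s in (0 : ℝ)..t, Real.exp (-s * m) * g s := by
  rw [expConv, ← intervalIntegral.integral_const_mul]
  congr 1
  ext s
  rw [← mul_assoc, ← Real.exp_add]
  congr 2
  ring

theorem RightRegular.exp_mul {g : ℝ → ℝ} (hg : RightRegular g) (a m : ℝ) :
    RightRegular fun s => Real.exp ((a - s) * m) * g s :=
  (RightRegular.of_continuous (by fun_prop : Continuous fun s : ℝ => Real.exp ((a - s) * m))).mul hg

theorem RightRegular.exp_neg_mul {g : ℝ → ℝ} (hg : RightRegular g) (m : ℝ) :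
    RightRegular fun s => Real.exp (-s * m) * g s :=
  (RightRegular.of_continuous (by fun_prop : Continuous fun s : ℝ => Real.exp (-s * m))).mul hg

/-- Variation of constants. Only a right derivative can be claimed, because g may jump at grid
points. -/
theorem hasDerivWithinAt_expConv (m : ℝ) {g : ℝ → ℝ} (hg : RightRegular g) (t : ℝ) :
    HasDerivWithinAt (expConv m g) (m * expConv m g t + g t) (Ici t) t := by
  have hr := hg.exp_neg_mul m
  have h1 : HasDerivWithinAt (fun u => ∫ s in (0 : ℝ)..u, Real.exp (-s * m) * g s)
      (Real.exp (-t * m) * g t) (Ici t) t :=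
    intervalIntegral.integral_hasDerivWithinAt_right (hr.intervalIntegrable 0 t) (t := Ioi t)
      hr.meas.stronglyMeasurableAtFilter ((hr.right t).mono Ioi_subset_Ici_self)
  have h2 : HasDerivWithinAt (fun u : ℝ => Real.exp (u * m)) (Real.exp (t * m) * m) (Ici t) t := by
    have := ((hasDerivAt_id t).mul_const m).exp.hasDerivWithinAt (s := Ici t)
    simpa using this
  have h3 := h2.mul h1
  have h4 : expConv m g = fun u => Real.exp (u * m) * ∫ s in (0 : ℝ)..u, Real.exp (-s * m) * g s :=
    funext (expConv_eq m g)
  rw [h4]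
  refine h3.congr_deriv ?_
  have h5 : Real.exp (t * m) * (Real.exp (-t * m) * g t) = g t := by
    rw [← mul_assoc, ← Real.exp_add]; simp
  rw [h5]
  ring

theorem continuous_expConv (m : ℝ) {g : ℝ → ℝ} (hg : RightRegular g) :
    Continuous (expConv m g) := by
  have h4 : expConv m g = fun u => Real.exp (u * m) * ∫ s in (0 : ℝ)..u, Real.exp (-s * m) * g s :=
    funext (expConv_eq m g)
  rw [h4]
  have := intervalIntegral.continuous_primitive
    (fun a b => (hg.exp_neg_mul m).intervalIntegrable a b) 0
  fun_prop

theorem expConv_zero (m : ℝ) (g : ℝ → ℝ) : expConv m g 0 = 0 := by simp [expConv]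

theorem expConv_sub (m : ℝ) {f g : ℝ → ℝ} (hf : RightRegular f) (hg : RightRegular g) (t : ℝ) :
    expConv m (fun s => f s - g s) t = expConv m f t - expConv m g t := by
  simp only [expConv, mul_sub]
  exact intervalIntegral.integral_sub ((hf.exp_mul t m).intervalIntegrable 0 t)
    ((hg.exp_mul t m).intervalIntegrable 0 t)

theorem integral_exp_sub_mul {m : ℝ} (hm : m ≠ 0) (a t : ℝ) :
    ∫ s in a..t, Real.exp ((t - s) * m) = (1 - Real.exp ((t - a) * m)) / -m := by
  have h : ∀ s ∈ uIcc a t, HasDerivAt (fun s => -(Real.exp ((t - s) * m) / m))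
      (Real.exp ((t - s) * m)) s := by
    intro s _
    have h1 := ((((hasDerivAt_id s).const_sub t).mul_const m).exp.div_const m).neg
    refine h1.congr_deriv ?_
    simp only [id_eq]
    field_simp
  rw [intervalIntegral.integral_eq_sub_of_hasDerivAt h
    ((by fun_prop : Continuous fun s : ℝ => Real.exp ((t - s) * m)).intervalIntegrable _ _)]
  simp only [sub_self, zero_mul, Real.exp_zero]
  field_simp
  ring

/-- Restarting variation of constants at time a. Constancy on the half-open interval suffices, as t
may be the next grid point and a single time is negligible. -/
theorem expConv_eq_of_const {m : ℝ} (hm : m ≠ 0) {g : ℝ → ℝ} (hg : RightRegular g) {a t c : ℝ}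
    (hat : a ≤ t) (hc : ∀ s ∈ Ico a t, g s = c) :
    expConv m g t = Real.exp ((t - a) * m) * expConv m g a
      + (1 - Real.exp ((t - a) * m)) / -m * c := by
  have hi := hg.exp_mul t m
  rw [expConv, ← intervalIntegral.integral_add_adjacent_intervals (hi.intervalIntegrable 0 a)
    (hi.intervalIntegrable a t)]
  congr 1
  · rw [expConv, ← intervalIntegral.integral_const_mul]
    congr 1
    ext s
    rw [← mul_assoc, ← Real.exp_add]
    congr 2
    ring
  · rw [← integral_exp_sub_mul hm, ← intervalIntegral.integral_mul_const]
    refine intervalIntegral.integral_congr_ae ?_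
    have hne : ∀ᵐ s : ℝ, s ≠ t := by simp [ae_iff]
    filter_upwards [hne] with s hs hs'
    rw [uIoc_of_le hat] at hs'
    rw [hc s ⟨hs'.1.le, lt_of_le_of_ne hs'.2 hs⟩]

/-! ### Scalar smoothing estimates and the singular time kernel. -/

theorem rpow_mul_exp_neg_le_one {x r : ℝ} (hx : 0 ≤ x) (hr0 : 0 ≤ r) (hr1 : r ≤ 1) :
    x ^ r * Real.exp (-x) ≤ 1 := by
  have h1 : x ^ r ≤ (1 + x) ^ r := Real.rpow_le_rpow hx (by linarith) hr0
  have h2 : (1 + x) ^ r ≤ (1 + x) ^ (1 : ℝ) :=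
    Real.rpow_le_rpow_of_exponent_le (by linarith) hr1
  rw [Real.rpow_one] at h2
  have h3 := Real.add_one_le_exp x
  rw [Real.exp_neg, ← div_eq_mul_inv, div_le_one (Real.exp_pos x)]
  linarith

/-- The left side is at most min(x, 1), and min(x, 1) ≤ x^a. This gives Hölder continuity of the
semigroup in time, mode by mode. -/
theorem one_sub_exp_neg_le_rpow {x a : ℝ} (hx : 0 ≤ x) (ha0 : 0 ≤ a) (ha1 : a ≤ 1) :
    1 - Real.exp (-x) ≤ x ^ a := by
  rcases le_total x 1 with h | h
  · have h1 := Real.add_one_le_exp (-x)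
    have h2 : x ^ (1 : ℝ) ≤ x ^ a := by
      rcases hx.eq_or_lt with rfl | hx
      · rw [Real.zero_rpow one_ne_zero]; exact Real.rpow_nonneg le_rfl _
      · exact Real.rpow_le_rpow_of_exponent_ge hx h ha1
    rw [Real.rpow_one] at h2
    linarith
  · have := Real.one_le_rpow h ha0
    linarith [Real.exp_pos (-x)]

/-- Analytic smoothing of one mode, by scaling from x^r ≤ 1 + x ≤ e^x; the constant 1 does not
depend on the eigenvalue. -/
theorem rpow_mul_exp_le {l r τ : ℝ} (hl : 0 < l) (hr0 : 0 ≤ r) (hr1 : r ≤ 1) (hτ : 0 < τ) :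
    l ^ r * Real.exp (τ * -l) ≤ τ ^ (-r) := by
  have h := rpow_mul_exp_neg_le_one (mul_pos hτ hl).le hr0 hr1
  rw [Real.mul_rpow hτ.le hl.le, mul_assoc] at h
  rw [Real.rpow_neg hτ.le, ← one_div, le_div_iff₀' (Real.rpow_pos_of_pos hτ r), mul_neg]
  exact h

/-- Reflecting s to t − s turns the integral into one of s^{-θ} from 0 to t, and extending it to T
makes the bound uniform in t. -/
theorem exists_lintegral_kernel_le (T : ℝ) {θ : ℝ} (hθ : θ < 1) :
    ∃ K : ℝ≥0∞, K ≠ ∞ ∧ ∀ t ∈ Icc (0 : ℝ) T,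
      ∫⁻ s in Ioc 0 t, ENNReal.ofReal ((t - s) ^ (-θ)) ≤ K := by
  refine ⟨ENNReal.ofReal (∫ s in (0 : ℝ)..T, s ^ (-θ)), ENNReal.ofReal_ne_top, fun t ht => ?_⟩
  have hi : ∀ u, IntervalIntegrable (fun s : ℝ => s ^ (-θ)) volume 0 u := fun u =>
    intervalIntegral.intervalIntegrable_rpow' (by linarith)
  have hit : IntervalIntegrable (fun s : ℝ => (t - s) ^ (-θ)) volume 0 t := by
    have := ((hi t).comp_sub_left t).symm
    simpa using this
  have hnn : 0 ≤ᵐ[volume.restrict (Ioc 0 t)] fun s : ℝ => (t - s) ^ (-θ) := by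
    filter_upwards [ae_restrict_mem measurableSet_Ioc] with s hs
    exact Real.rpow_nonneg (by linarith [hs.2]) _
  rw [← ofReal_integral_eq_lintegral_ofReal
    ((intervalIntegrable_iff_integrableOn_Ioc_of_le ht.1).1 hit) hnn,
    ← intervalIntegral.integral_of_le ht.1,
    intervalIntegral.integral_comp_sub_left (fun x : ℝ => x ^ (-θ)) t, sub_self, sub_zero]
  refine ENNReal.ofReal_le_ofReal ?_
  refine intervalIntegral.integral_mono_interval le_rfl ht.1 ht.2 ?_ (hi T)
  filter_upwards [ae_restrict_mem measurableSet_Ioc] with s hs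
  exact Real.rpow_nonneg hs.1.le _

/-! ### Smoothing of the semigroup convolution. -/

namespace DiagNegOp

variable {ι H : Type*} [NormedAddCommGroup H] [InnerProductSpace ℝ H] (A : DiagNegOp ι H)

theorem rightRegular_inner {f : ℝ → H} (hf : RightRegular f) (i : ι) :
    RightRegular fun s => inner ℝ (A.basis i) (f s) :=
  hf.clm (innerSL ℝ (A.basis i))

theorem norm_sq_sum_smul_basis (I : Finset ι) (c : ι → ℝ) :
    ‖∑ i ∈ I, c i • A.basis i‖ ^ 2 = ∑ i ∈ I, c i ^ 2 := by
  have h : ∑ i ∈ I, c i • A.basis i ∈ range (A.proj I) := by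
    refine ⟨∑ i ∈ I, c i • A.basis i, ?_⟩
    rw [A.proj_apply]
    exact Finset.sum_congr rfl fun i hi => by rw [A.inner_basis_sum_mem I c hi]
  rw [A.norm_sq_eq_sum_of_mem_range h]
  exact Finset.sum_congr rfl fun i hi => by rw [A.inner_basis_sum_mem I c hi]

variable [CompleteSpace H]

/-- The finite sum is one H-valued integral, so its norm is at most the integral of the norms, and
Parseval bounds the diagonal operator inside by g. The free multipliers d allow both fractional
powers and cut-offs to I or its complement. -/
theorem enorm_sum_expConv_le {f : ℝ → H} (hf : RightRegular f) {t : ℝ} (ht : 0 ≤ t)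
    (J : Finset ι) {d : ι → ℝ} {g : ℝ → ℝ}
    (hd : ∀ i, ∀ τ, 0 < τ → |d i| * Real.exp (τ * A.eig i) ≤ g τ) :
    ‖∑ i ∈ J, (d i * expConv (A.eig i) (fun s => inner ℝ (A.basis i) (f s)) t) • A.basis i‖ₑ
      ≤ ∫⁻ s in Ioc 0 t, ENNReal.ofReal (g (t - s)) * ‖f s‖ₑ := by
  set u : ℝ → H := fun s => ∑ i ∈ J,
    (d i * (Real.exp ((t - s) * A.eig i) * inner ℝ (A.basis i) (f s))) • A.basis i with hu
  have hi : ∀ i, IntervalIntegrable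
      (fun s => Real.exp ((t - s) * A.eig i) * inner ℝ (A.basis i) (f s)) volume 0 t := fun i =>
    ((A.rightRegular_inner hf i).exp_mul t (A.eig i)).intervalIntegrable 0 t
  have hint : ∑ i ∈ J, (d i * expConv (A.eig i) (fun s => inner ℝ (A.basis i) (f s)) t) • A.basis i
      = ∫ s in Ioc 0 t, u s := by
    rw [← intervalIntegral.integral_of_le ht, hu, intervalIntegral.integral_finsetSum]
    · refine Finset.sum_congr rfl fun i _ => ?_
      rw [intervalIntegral.integral_smul_const, intervalIntegral.integral_const_mul]
      rfl
    · intro i _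
      have h := (hi i).const_mul (d i)
      exact ⟨h.1.smul_const _, h.2.smul_const _⟩
  rw [hint]
  refine (enorm_integral_le_lintegral_enorm _).trans (lintegral_mono_ae ?_)
  -- The multiplier bound is available only for strictly positive time lags.
  have hne : ∀ᵐ s ∂(volume.restrict (Ioc 0 t)), s ≠ t :=
    ae_restrict_of_ae (by simp [ae_iff])
  filter_upwards [ae_restrict_mem measurableSet_Ioc, hne] with s hs hst
  have hτ : 0 < t - s := sub_pos.2 (lt_of_le_of_ne hs.2 hst)
  have hub : ‖u s‖ ≤ |g (t - s)| * ‖f s‖ := by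
    refine le_of_sq_le_sq ?_ (by positivity)
    rw [hu, A.norm_sq_sum_smul_basis, mul_pow]
    refine le_trans ?_ (mul_le_mul_of_nonneg_left (A.sum_inner_sq_le J (f s)) (sq_nonneg _))
    rw [Finset.mul_sum]
    refine Finset.sum_le_sum fun i _ => ?_
    rw [← mul_assoc, mul_pow]
    refine mul_le_mul_of_nonneg_right (sq_le_sq.2 ?_) (sq_nonneg _)
    rw [abs_mul, abs_of_pos (Real.exp_pos _), abs_abs]
    exact (hd i _ hτ).trans (le_abs_self _)
  -- Nonnegativity of g at t − s is read off from the bound at some index; the empty sum is trivial.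
  rcases J.eq_empty_or_nonempty with rfl | ⟨i, -⟩
  · simp [hu]
  have hg : 0 ≤ g (t - s) := le_trans (by positivity) (hd i _ hτ)
  rw [abs_of_nonneg hg] at hub
  rw [← ofReal_norm, ← ofReal_norm, ← ENNReal.ofReal_mul hg]
  exact ENNReal.ofReal_le_ofReal hub

theorem sum_expConv_sq_le {f : ℝ → H} (hf : RightRegular f) {t : ℝ} (ht : 0 ≤ t)
    (J : Finset ι) {d : ι → ℝ} {g : ℝ → ℝ}
    (hd : ∀ i, ∀ τ, 0 < τ → |d i| * Real.exp (τ * A.eig i) ≤ g τ)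
    (hfin : ∫⁻ s in Ioc 0 t, ENNReal.ofReal (g (t - s)) * ‖f s‖ₑ ≠ ∞) :
    ∑ i ∈ J, (d i * expConv (A.eig i) (fun s => inner ℝ (A.basis i) (f s)) t) ^ 2
      ≤ (∫⁻ s in Ioc 0 t, ENNReal.ofReal (g (t - s)) * ‖f s‖ₑ).toReal ^ 2 := by
  rw [← A.norm_sq_sum_smul_basis]
  refine pow_le_pow_left₀ (norm_nonneg _) ?_ 2
  rw [← toReal_enorm]
  exact ENNReal.toReal_mono hfin (A.enorm_sum_expConv_le hf ht J hd)

theorem enorm_interp_le_lintegral {f : ℝ → H} (hf : RightRegular f) {t : ℝ} (ht : 0 ≤ t)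
    {d : ι → ℝ} {g : ℝ → ℝ} (hd : ∀ i, ∀ τ, 0 < τ → |d i| * Real.exp (τ * A.eig i) ≤ g τ)
    {r : ℝ} (v : A.Interp r) (hv : ∀ i, (-A.eig i) ^ r * inner ℝ (A.basis i) v.toH
      = d i * expConv (A.eig i) (fun s => inner ℝ (A.basis i) (f s)) t) :
    ‖v‖ₑ ≤ ∫⁻ s in Ioc 0 t, ENNReal.ofReal (g (t - s)) * ‖f s‖ₑ := by
  by_cases hfin : ∫⁻ s in Ioc 0 t, ENNReal.ofReal (g (t - s)) * ‖f s‖ₑ = ∞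
  · rw [hfin]; exact le_top
  rw [← ofReal_norm]
  refine ENNReal.ofReal_le_of_le_toReal ?_
  refine A.norm_interp_le_of_sum_le v ENNReal.toReal_nonneg fun J => ?_
  simp only [hv]
  exact A.sum_expConv_sq_le hf ht J hd hfin

/-- A convolution gains any r < 1 powers of −A, since the kernel τ^{-r} is integrable and f is
bounded. Thus X − O lies in H_ρ although X and O are only V-valued. -/
theorem mem_diagDom_of_expConv {f : ℝ → H} (hf : RightRegular f) {t : ℝ} (ht : 0 ≤ t)
    {r : ℝ} (hr0 : 0 ≤ r) (hr1 : r < 1) {w : H} (hw : ∀ i, inner ℝ (A.basis i) w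
      = expConv (A.eig i) (fun s => inner ℝ (A.basis i) (f s)) t) :
    w ∈ diagDom A.basis (fun i => (-A.eig i) ^ r) := by
  have hd : ∀ i, ∀ τ, 0 < τ → |(-A.eig i) ^ r| * Real.exp (τ * A.eig i) ≤ τ ^ (-r) := by
    intro i τ hτ
    rw [abs_of_pos (Real.rpow_pos_of_pos (A.neg_eig_pos i) r)]
    have := rpow_mul_exp_le (A.neg_eig_pos i) hr0 hr1.le hτ
    rwa [neg_neg] at this
  have hfin : ∫⁻ s in Ioc 0 t, ENNReal.ofReal ((t - s) ^ (-r)) * ‖f s‖ₑ ≠ ∞ := by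
    obtain ⟨C, hC⟩ := hf.bdd t
    obtain ⟨K, hK, hKt⟩ := exists_lintegral_kernel_le t hr1
    refine ne_top_of_le_ne_top (b := K * ENNReal.ofReal C) (by finiteness) ?_
    calc ∫⁻ s in Ioc 0 t, ENNReal.ofReal ((t - s) ^ (-r)) * ‖f s‖ₑ
        ≤ ∫⁻ s in Ioc 0 t, ENNReal.ofReal ((t - s) ^ (-r)) * ENNReal.ofReal C := by
          refine setLIntegral_mono' measurableSet_Ioc fun s hs => ?_
          rw [← ofReal_norm]
          gcongr
          exact hC s (abs_le.2 ⟨by linarith [hs.1, hs.2], hs.2⟩)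
      _ = (∫⁻ s in Ioc 0 t, ENNReal.ofReal ((t - s) ^ (-r))) * ENNReal.ofReal C :=
          lintegral_mul_const' _ _ ENNReal.ofReal_ne_top
      _ ≤ K * ENNReal.ofReal C := by
          gcongr
          exact hKt t ⟨ht, le_rfl⟩
  rw [mem_diagDom]
  refine summable_of_sum_le (fun i => sq_nonneg _)
    (c := (∫⁻ s in Ioc 0 t, ENNReal.ofReal ((t - s) ^ (-r)) * ‖f s‖ₑ).toReal ^ 2) fun J => ?_
  simp only [hw]
  exact A.sum_expConv_sq_le hf ht J hd hfin

variable [TopologicalSpace.SeparableSpace H]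

/-- Measurability comes from writing the integrand as the limit of its finite eigen-expansions;
boundedness from contractivity of the semigroup. -/
theorem integrableOn_semigroup {f : ℝ → H} (hf : RightRegular f) {t : ℝ} (ht : 0 ≤ t) :
    IntervalIntegrable (fun s => A.semigroup (t - s) (f s)) volume 0 t := by
  have : Countable ι := countable_index A
  rw [intervalIntegrable_iff_integrableOn_Ioc_of_le ht]
  obtain ⟨C, hC⟩ := hf.bdd t
  refine Integrable.of_bound ?_ C ?_
  · refine aestronglyMeasurable_of_tendsto_ae (u := atTop) (f := fun J s => ∑ i ∈ J,
      (Real.exp ((t - s) * A.eig i) * inner ℝ (A.basis i) (f s)) • A.basis i) ?_ ?_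
    · intro J
      refine (Finset.stronglyMeasurable_fun_sum J fun i _ => ?_).aestronglyMeasurable
      exact ((A.rightRegular_inner hf i).exp_mul t (A.eig i)).meas.smul_const _
    · filter_upwards [ae_restrict_mem measurableSet_Ioc] with s hs
      have := A.hasSum_semigroup (sub_nonneg.2 hs.2) (f s)
      simpa only [HasSum, SummationFilter.unconditional_filter] using this
  · filter_upwards [ae_restrict_mem measurableSet_Ioc] with s hs
    refine (A.norm_semigroup_apply_le (sub_nonneg.2 hs.2) _).trans (hC s ?_)
    exact abs_le.2 ⟨by linarith [hs.1, hs.2], hs.2⟩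

theorem inner_basis_integral_semigroup {f : ℝ → H} (hf : RightRegular f) {t : ℝ} (ht : 0 ≤ t)
    (i : ι) : inner ℝ (A.basis i) (∫ s in (0 : ℝ)..t, A.semigroup (t - s) (f s))
      = expConv (A.eig i) (fun s => inner ℝ (A.basis i) (f s)) t := by
  have h := (innerSL ℝ (A.basis i)).intervalIntegral_comp_comm (A.integrableOn_semigroup hf ht)
  simp only [innerSL_apply_apply] at h
  rw [← h, expConv]
  refine intervalIntegral.integral_congr fun s hs => ?_
  rw [uIcc_of_le ht] at hs
  exact A.inner_basis_semigroup (sub_nonneg.2 hs.2) _ _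

theorem integral_proj_semigroup {f : ℝ → H} (hf : RightRegular f) {t : ℝ} (ht : 0 ≤ t)
    (I : Finset ι) : ∫ s in (0 : ℝ)..t, A.proj I (A.semigroup (t - s) (f s))
      = A.proj I (∫ s in (0 : ℝ)..t, A.semigroup (t - s) (f s)) :=
  (A.proj I).intervalIntegral_comp_comm (A.integrableOn_semigroup hf ht)

end DiagNegOp

/-! ### Finite mode sums: time regularity and a Gronwall inequality. -/

namespace DiagNegOp

section ModeConv

variable {ι H : Type*} [NormedAddCommGroup H] [InnerProductSpace ℝ H] (A : DiagNegOp ι H)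

/-- The spectral projection `P_I ∫₀ᵗ e^{(t-s)A} f(s) ds` of a stochastic-convolution-type integral,
given by its finitely many modes. -/
noncomputable def modeConv (I : Finset ι) (f : ℝ → H) (t : ℝ) : H :=
  ∑ i ∈ I, expConv (A.eig i) (fun s => inner ℝ (A.basis i) (f s)) t • A.basis i

theorem inner_basis_modeConv {I : Finset ι} {i : ι} (hi : i ∈ I) (f : ℝ → H) (t : ℝ) :
    inner ℝ (A.basis i) (A.modeConv I f t)
      = expConv (A.eig i) (fun s => inner ℝ (A.basis i) (f s)) t :=
  A.inner_basis_sum_mem I _ hi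

theorem inner_basis_modeConv_notMem {I : Finset ι} {i : ι} (hi : i ∉ I) (f : ℝ → H) (t : ℝ) :
    inner ℝ (A.basis i) (A.modeConv I f t) = 0 :=
  A.inner_basis_sum_notMem I _ hi

theorem proj_modeConv (I : Finset ι) (f : ℝ → H) (t : ℝ) :
    A.proj I (A.modeConv I f t) = A.modeConv I f t := by
  refine A.ext_inner_basis fun i => ?_
  by_cases hi : i ∈ I
  · rw [A.inner_basis_proj_mem hi]
  · rw [A.inner_basis_proj_notMem hi, A.inner_basis_modeConv_notMem hi]

theorem continuous_modeConv (I : Finset ι) {f : ℝ → H} (hf : RightRegular f) :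
    Continuous (A.modeConv I f) := by
  refine continuous_finsetSum I fun i _ => ?_
  exact (continuous_expConv _ (A.rightRegular_inner hf i)).smul continuous_const

theorem integral_proj_semigroup_eq_modeConv [CompleteSpace H] [TopologicalSpace.SeparableSpace H]
    {f : ℝ → H} (hf : RightRegular f) {t : ℝ} (ht : 0 ≤ t) (I : Finset ι) :
    ∫ s in (0 : ℝ)..t, A.proj I (A.semigroup (t - s) (f s)) = A.modeConv I f t := by
  rw [A.integral_proj_semigroup hf ht, A.proj_apply]
  exact Finset.sum_congr rfl fun i _ => by rw [A.inner_basis_integral_semigroup hf ht]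

theorem projTo_sub (I : Finset ι) (r : ℝ) (u v : H) :
    A.projTo I r (u - v) = A.projTo I r u - A.projTo I r v :=
  map_sub (A.projToL I r) u v

theorem projTo_add (I : Finset ι) (r : ℝ) (u v : H) :
    A.projTo I r (u + v) = A.projTo I r u + A.projTo I r v :=
  map_add (A.projToL I r) u v

/-- Inside a grid cell the drift is constant, so with τ the time since the grid point the increment
is (e^{τA} − Id) applied to the grid value plus (-A)^{-1}(Id − e^{τA}) applied to the drift. Trading
s − r, respectively 1 − r, powers of −A for powers of τ gives the two terms. It is used with s = γ
for the a priori bound and with s = ρ + ϱ for the rate. -/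
theorem norm_modeConv_sub_le (I : Finset ι) {g : ℤ → H} {h : ℝ} (hh : 0 < h) {r s : ℝ}
    (hr : 0 ≤ r) (hrs : r ≤ s) (hs : s ≤ 1) (t : ℝ) :
    ‖A.projTo I r (A.modeConv I (fun q => g ⌊q / h⌋) t
        - A.modeConv I (fun q => g ⌊q / h⌋) (gridFloor h t))‖
      ≤ h ^ (s - r) * ‖A.projTo I s (A.modeConv I (fun q => g ⌊q / h⌋) (gridFloor h t))‖
        + h ^ (1 - r) * ‖g ⌊t / h⌋‖ := by
  set f : ℝ → H := fun q => g ⌊q / h⌋ with hfdef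
  have hf : RightRegular f := RightRegular.comp_floor g hh
  set a := gridFloor h t with ha
  have hat : a ≤ t := (isGreatest_gridFloor hh t).1.2
  have hta : t - a ≤ h := by
    have : t / h < ⌊t / h⌋ + 1 := Int.lt_floor_add_one _
    rw [div_lt_iff₀ hh] at this
    rw [ha, gridFloor]; linarith
  have hfc : ∀ q ∈ Ico a t, f q = g ⌊t / h⌋ := by
    intro q hq
    simp only [hfdef]
    congr 1
    refine le_antisymm (Int.floor_le_floor (div_le_div_of_nonneg_right hq.2.le hh.le)) ?_
    exact Int.le_floor.2 ((le_div_iff₀ hh).2 hq.1)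
  set τ := t - a with hτ
  have hτ0 : 0 ≤ τ := sub_nonneg.2 hat
  set z := A.modeConv I f a with hz
  set u₁ : H := ∑ i ∈ I, ((Real.exp (τ * A.eig i) - 1) * inner ℝ (A.basis i) z) • A.basis i
  set u₂ : H := ∑ i ∈ I, ((1 - Real.exp (τ * A.eig i)) / -A.eig i
    * inner ℝ (A.basis i) (g ⌊t / h⌋)) • A.basis i
  have hdec : A.modeConv I f t - z = u₁ + u₂ := by
    refine A.ext_inner_basis fun i => ?_
    rw [inner_sub_right, inner_add_right]
    by_cases hi : i ∈ I
    · rw [A.inner_basis_sum_mem I _ hi, A.inner_basis_sum_mem I _ hi, hz,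
        A.inner_basis_modeConv hi, A.inner_basis_modeConv hi,
        expConv_eq_of_const (by have := A.neg_eig_pos i; linarith) (A.rightRegular_inner hf i) hat
          (c := inner ℝ (A.basis i) (g ⌊t / h⌋)) (fun q hq => by simp only [hfc q hq])]
      ring
    · rw [A.inner_basis_sum_notMem I _ hi, A.inner_basis_sum_notMem I _ hi, hz,
        A.inner_basis_modeConv_notMem hi, A.inner_basis_modeConv_notMem hi]
      ring
  have hexp : ∀ i, Real.exp (τ * A.eig i) ≤ 1 := fun i => by
    rw [Real.exp_le_one_iff]; nlinarith [A.neg_eig_pos i]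
  have hone : ∀ i, ∀ b : ℝ, 0 ≤ b → b ≤ 1 →
      1 - Real.exp (τ * A.eig i) ≤ τ ^ b * (-A.eig i) ^ b := by
    intro i b hb0 hb1
    rw [← Real.mul_rpow hτ0 (A.neg_eig_pos i).le]
    have := one_sub_exp_neg_le_rpow (mul_nonneg hτ0 (A.neg_eig_pos i).le) hb0 hb1
    rwa [show -(τ * -A.eig i) = τ * A.eig i by ring] at this
  have h₁ : ‖A.projTo I r u₁‖ ≤ h ^ (s - r) * ‖A.projTo I s z‖ := by
    rw [A.norm_interp (A.projTo I s z)]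
    refine A.norm_interp_le_of_forall _ _ (Real.rpow_nonneg hh.le _) fun i => ?_
    rw [inner_basis_fracPow, toH_projTo, toH_projTo]
    by_cases hi : i ∈ I
    · have hl := A.neg_eig_pos i
      rw [A.inner_basis_proj_mem hi, A.inner_basis_proj_mem hi, A.inner_basis_sum_mem I _ hi,
        abs_mul, abs_mul, abs_mul, abs_sub_comm, abs_of_nonneg (sub_nonneg.2 (hexp i)),
        abs_of_pos (Real.rpow_pos_of_pos hl _), abs_of_pos (Real.rpow_pos_of_pos hl _)]
      have hb := hone i (s - r) (sub_nonneg.2 hrs) (by linarith)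
      have hle : τ ^ (s - r) ≤ h ^ (s - r) := Real.rpow_le_rpow hτ0 hta (sub_nonneg.2 hrs)
      have hsp : (-A.eig i) ^ s = (-A.eig i) ^ r * (-A.eig i) ^ (s - r) := by
        rw [← Real.rpow_add hl]; congr 1; ring
      rw [hsp]
      calc (-A.eig i) ^ r * ((1 - Real.exp (τ * A.eig i)) * |inner ℝ (A.basis i) z|)
          ≤ (-A.eig i) ^ r * ((h ^ (s - r) * (-A.eig i) ^ (s - r)) * |inner ℝ (A.basis i) z|) := by
            gcongr
            exact hb.trans (by gcongr)
        _ = _ := by ring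
    · rw [A.inner_basis_proj_notMem hi, mul_zero, abs_zero]
      positivity
  have h₂ : ‖A.projTo I r u₂‖ ≤ h ^ (1 - r) * ‖g ⌊t / h⌋‖ := by
    refine A.norm_interp_le_of_forall _ _ (Real.rpow_nonneg hh.le _) fun i => ?_
    rw [toH_projTo]
    by_cases hi : i ∈ I
    · have hl := A.neg_eig_pos i
      rw [A.inner_basis_proj_mem hi, A.inner_basis_sum_mem I _ hi,
        abs_mul, abs_mul, abs_of_nonneg (div_nonneg (sub_nonneg.2 (hexp i)) hl.le),
        abs_of_pos (Real.rpow_pos_of_pos hl _), ← mul_assoc]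
      refine mul_le_mul_of_nonneg_right ?_ (abs_nonneg _)
      have hb := hone i (1 - r) (by linarith) (by linarith)
      have hle : τ ^ (1 - r) ≤ h ^ (1 - r) := Real.rpow_le_rpow hτ0 hta (by linarith)
      rw [← mul_div_assoc, div_le_iff₀ hl]
      have hsp : (-A.eig i) ^ r * (-A.eig i) ^ (1 - r) = -A.eig i := by
        rw [← Real.rpow_add hl, show r + (1 - r) = (1 : ℝ) by ring, Real.rpow_one]
      calc (-A.eig i) ^ r * (1 - Real.exp (τ * A.eig i))
          ≤ (-A.eig i) ^ r * (h ^ (1 - r) * (-A.eig i) ^ (1 - r)) := by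
            gcongr
            exact hb.trans (by gcongr)
        _ = h ^ (1 - r) * ((-A.eig i) ^ r * (-A.eig i) ^ (1 - r)) := by ring
        _ = _ := by rw [hsp]
    · rw [A.inner_basis_proj_notMem hi, mul_zero, abs_zero]
      positivity
  rw [hdec, A.projTo_add]
  exact (norm_add_le _ _).trans (add_le_add h₁ h₂)

/-- Gronwall: with E the weighted square sum, e^{-Kt}E(t) has right derivative at most a(t). The
weights let one statement serve both the energy estimate (−μ_i plus a constant) and the plain H-norm
(weight 1). -/
theorem sum_expConv_sq_le_of_dissipative (I : Finset ι) {f : ℝ → H} (hf : RightRegular f)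
    {w : ι → ℝ} (hw : ∀ i, 0 ≤ w i) {T K : ℝ} (hK : 0 ≤ K) {a : ℝ → ℝ} (ha : ∀ s, 0 ≤ a s)
    (hai : ∀ t, IntegrableOn a (Icc 0 t))
    (hdis : ∀ t ∈ Ioo 0 T,
      2 * ∑ i ∈ I, w i * (expConv (A.eig i) (fun s => inner ℝ (A.basis i) (f s)) t
          * (A.eig i * expConv (A.eig i) (fun s => inner ℝ (A.basis i) (f s)) t
            + inner ℝ (A.basis i) (f t)))
        ≤ K * (∑ i ∈ I, w i * expConv (A.eig i) (fun s => inner ℝ (A.basis i) (f s)) t ^ 2)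
          + a t) {t : ℝ} (ht : t ∈ Icc 0 T) :
    ∑ i ∈ I, w i * expConv (A.eig i) (fun s => inner ℝ (A.basis i) (f s)) t ^ 2
      ≤ Real.exp (K * T) * ∫ s in (0 : ℝ)..t, a s := by
  set z : ι → ℝ → ℝ := fun i => expConv (A.eig i) (fun s => inner ℝ (A.basis i) (f s)) with hz
  have hzd : ∀ i s, HasDerivWithinAt (z i) (A.eig i * z i s + inner ℝ (A.basis i) (f s))
      (Ioi s) s := fun i s =>
    (hasDerivWithinAt_expConv _ (A.rightRegular_inner hf i) s).mono Ioi_subset_Ici_self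
  have hzc : ∀ i, Continuous (z i) := fun i => continuous_expConv _ (A.rightRegular_inner hf i)
  set E : ℝ → ℝ := fun s => ∑ i ∈ I, w i * z i s ^ 2 with hE
  have hEd : ∀ s, HasDerivWithinAt E
      (2 * ∑ i ∈ I, w i * (z i s * (A.eig i * z i s + inner ℝ (A.basis i) (f s)))) (Ioi s) s := by
    intro s
    have h1 := HasDerivWithinAt.fun_sum (u := I) fun i (_ : i ∈ I) =>
      ((hzd i s).fun_pow 2).const_mul (w i)
    refine h1.congr_deriv ?_
    rw [Finset.mul_sum]
    refine Finset.sum_congr rfl fun i _ => ?_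
    norm_num
    ring
  have hexpd : ∀ s, HasDerivWithinAt (fun s : ℝ => Real.exp (-K * s))
      (Real.exp (-K * s) * -K) (Ioi s) s := by
    intro s
    have := ((hasDerivAt_id s).const_mul (-K)).exp.hasDerivWithinAt (s := Ioi s)
    simpa using this
  have hE0 : E 0 = 0 := by simp [hE, hz, expConv_zero]
  have hEnn : 0 ≤ E t := Finset.sum_nonneg fun i _ => mul_nonneg (hw i) (sq_nonneg _)
  have key := intervalIntegral.sub_le_integral_of_hasDeriv_right_of_le ht.1
    (g := fun s => Real.exp (-K * s) * E s) (φ := a)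
    (by
      refine Continuous.continuousOn ?_
      have : Continuous E := continuous_finsetSum I fun i _ =>
        continuous_const.mul ((hzc i).pow 2)
      fun_prop)
    (fun s _ => (hexpd s).fun_mul (hEd s)) (hai t)
    (by
      intro s hs
      have h1 := hdis s ⟨hs.1, hs.2.trans_le ht.2⟩
      have h2 : Real.exp (-K * s) ≤ 1 := by
        rw [Real.exp_le_one_iff]; nlinarith [hs.1]
      have h3 : Real.exp (-K * s) * (2 * ∑ i ∈ I, w i * (z i s * (A.eig i * z i s
          + inner ℝ (A.basis i) (f s)))) ≤ Real.exp (-K * s) * (K * E s + a s) :=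
        mul_le_mul_of_nonneg_left h1 (Real.exp_pos _).le
      have h4 : Real.exp (-K * s) * a s ≤ 1 * a s := mul_le_mul_of_nonneg_right h2 (ha s)
      linarith)
  simp only [hE0, mul_zero, sub_zero] at key
  have hI : 0 ≤ ∫ s in (0 : ℝ)..t, a s := intervalIntegral.integral_nonneg ht.1 fun s _ => ha s
  calc E t = Real.exp (K * t) * (Real.exp (-K * t) * E t) := by
        rw [← mul_assoc, ← Real.exp_add]; simp
    _ ≤ Real.exp (K * t) * ∫ s in (0 : ℝ)..t, a s :=
        mul_le_mul_of_nonneg_left key (Real.exp_pos _).le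
    _ ≤ _ := by
        refine mul_le_mul_of_nonneg_right (Real.exp_le_exp.2 ?_) hI
        exact mul_le_mul_of_nonneg_left ht.2 hK

end ModeConv

end DiagNegOp

/-! ### Local Lipschitz and growth bounds of F on all of V. -/

section Nonlinearity

/-- Two closure arguments: P_I v → v in H_ρ removes the restriction to finitely many modes, and
density of H_ρ in V does the rest. The growth factor is then rewritten as one power of 1 + ‖v‖ +
‖w‖, which is easier to take moments of. -/
theorem exists_norm_sub_le_of_forall_proj {ι H V : Type*} [NormedAddCommGroup H]
    [InnerProductSpace ℝ H] [NormedAddCommGroup V] [NormedSpace ℝ V] (A : DiagNegOp ι H) {c φ ρ : ℝ} (hc : 0 < c)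
    (hφ : 0 < φ) (jV : A.Interp ρ →L[ℝ] V) (hjd : DenseRange jV) {F : V → H} (hF : Continuous F)
    (hlip : ∀ (I : Finset ι) (v w : A.Interp ρ), v.toH ∈ range (A.proj I) →
      w.toH ∈ range (A.proj I) →
      ‖F (jV v) - F (jV w)‖ ^ 2 ≤ c * ‖jV v - jV w‖ ^ 2 * (1 + ‖jV v‖ ^ φ + ‖jV w‖ ^ φ)) :
    ∃ C : ℝ, 0 < C ∧ ∀ v w : V, ‖F v - F w‖ ≤ C * ‖v - w‖ * (1 + ‖v‖ + ‖w‖) ^ (φ / 2) := by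
  have hpow : ∀ v : V, ContinuousAt (fun v : V => ‖v‖ ^ φ) v := fun v =>
    (continuous_norm.rpow_const fun _ => Or.inr hφ.le).continuousAt
  have hpc : Continuous fun v : V => ‖v‖ ^ φ := continuous_norm.rpow_const fun _ => Or.inr hφ.le
  have h1 : ∀ v w : A.Interp ρ,
      ‖F (jV v) - F (jV w)‖ ^ 2 ≤ c * ‖jV v - jV w‖ ^ 2 * (1 + ‖jV v‖ ^ φ + ‖jV w‖ ^ φ) := by
    intro v w
    have hv := (jV.continuous.tendsto v).comp (A.tendsto_projTo v)
    have hw := (jV.continuous.tendsto w).comp (A.tendsto_projTo w)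
    have hcl : Continuous fun q : V × V => ‖F q.1 - F q.2‖ ^ 2 := by fun_prop
    have hcr : Continuous fun q : V × V =>
        c * ‖q.1 - q.2‖ ^ 2 * (1 + ‖q.1‖ ^ φ + ‖q.2‖ ^ φ) := by
      have h3 := hpc.comp (continuous_fst (X := V) (Y := V))
      have h4 := hpc.comp (continuous_snd (X := V) (Y := V))
      simp only [Function.comp_def] at h3 h4
      fun_prop
    have hp := hv.prodMk_nhds hw
    refine le_of_tendsto_of_tendsto ((hcl.tendsto (jV v, jV w)).comp hp)
      ((hcr.tendsto (jV v, jV w)).comp hp) (Eventually.of_forall fun I => ?_)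
    exact hlip I _ _ ⟨v.toH, by simp⟩ ⟨w.toH, by simp⟩
  have h2 : ∀ v w : V,
      ‖F v - F w‖ ^ 2 ≤ c * ‖v - w‖ ^ 2 * (1 + ‖v‖ ^ φ + ‖w‖ ^ φ) := by
    intro v w
    refine hjd.induction_on₂ (p := fun v w =>
      ‖F v - F w‖ ^ 2 ≤ c * ‖v - w‖ ^ 2 * (1 + ‖v‖ ^ φ + ‖w‖ ^ φ)) ?_ h1 v w
    refine isClosed_le (by fun_prop) ?_
    have h3 := hpc.comp (continuous_fst (X := V) (Y := V))
    have h4 := hpc.comp (continuous_snd (X := V) (Y := V))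
    simp only [Function.comp_def] at h3 h4
    fun_prop
  -- The 3 comes from dominating each of the three summands 1, ‖v‖^φ, ‖w‖^φ by (1 + ‖v‖ + ‖w‖)^φ.
  refine ⟨Real.sqrt (3 * c), Real.sqrt_pos.2 (by linarith), fun v w => ?_⟩
  refine le_of_sq_le_sq ?_ (by positivity)
  refine (h2 v w).trans ?_
  have hb : 0 ≤ 1 + ‖v‖ + ‖w‖ := by positivity
  rw [mul_pow, mul_pow, Real.sq_sqrt (by linarith), ← Real.rpow_natCast (_ ^ (φ / 2)),
    ← Real.rpow_mul hb, show φ / 2 * ((2 : ℕ) : ℝ) = φ by push_cast; ring]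
  have h3 : 1 + ‖v‖ ^ φ + ‖w‖ ^ φ ≤ 3 * (1 + ‖v‖ + ‖w‖) ^ φ := by
    have e1 : (1 : ℝ) ≤ (1 + ‖v‖ + ‖w‖) ^ φ :=
      Real.one_le_rpow (by linarith [norm_nonneg v, norm_nonneg w]) hφ.le
    have e2 : ‖v‖ ^ φ ≤ (1 + ‖v‖ + ‖w‖) ^ φ :=
      Real.rpow_le_rpow (norm_nonneg _) (by linarith [norm_nonneg w]) hφ.le
    have e3 : ‖w‖ ^ φ ≤ (1 + ‖v‖ + ‖w‖) ^ φ :=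
      Real.rpow_le_rpow (norm_nonneg _) (by linarith [norm_nonneg v]) hφ.le
    linarith
  calc c * ‖v - w‖ ^ 2 * (1 + ‖v‖ ^ φ + ‖w‖ ^ φ)
      ≤ c * ‖v - w‖ ^ 2 * (3 * (1 + ‖v‖ + ‖w‖) ^ φ) := by gcongr
    _ = _ := by ring

theorem exists_norm_le_of_norm_sub_le {H V : Type*} [NormedAddCommGroup H]
    [NormedAddCommGroup V] {F : V → H} {φ C : ℝ} (hφ : 0 < φ) (hC : 0 < C)
    (hF : ∀ v w : V, ‖F v - F w‖ ≤ C * ‖v - w‖ * (1 + ‖v‖ + ‖w‖) ^ (φ / 2)) :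
    ∃ D : ℝ, 0 < D ∧ ∀ v : V, ‖F v‖ ≤ D * (1 + ‖v‖) ^ (1 + φ / 2) := by
  refine ⟨‖F 0‖ + C, by positivity, fun v => ?_⟩
  have h1 := hF v 0
  rw [sub_zero, norm_zero, add_zero] at h1
  have hb : (0 : ℝ) < 1 + ‖v‖ := by positivity
  have h2 : ‖F v‖ ≤ ‖F 0‖ + ‖F v - F 0‖ := by
    have := norm_add_le (F 0) (F v - F 0)
    rwa [add_sub_cancel] at this
  have h3 : 1 ≤ (1 + ‖v‖) ^ (1 + φ / 2) :=
    Real.one_le_rpow (by linarith [norm_nonneg v]) (by positivity)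
  have h4 : ‖v‖ * (1 + ‖v‖) ^ (φ / 2) ≤ (1 + ‖v‖) ^ (1 + φ / 2) := by
    rw [Real.rpow_add hb, Real.rpow_one]
    gcongr
    linarith
  calc ‖F v‖ ≤ ‖F 0‖ * 1 + C * (‖v‖ * (1 + ‖v‖) ^ (φ / 2)) := by linarith
    _ ≤ ‖F 0‖ * (1 + ‖v‖) ^ (1 + φ / 2) + C * (1 + ‖v‖) ^ (1 + φ / 2) := by gcongr
    _ = _ := by ring

end Nonlinearity

theorem one_add_rpow_le {x b : ℝ} (hx : 0 ≤ x) (hb : 0 ≤ b) :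
    (1 + x) ^ b ≤ 2 ^ b * (1 + x ^ b) := by
  have hxb : 0 ≤ x ^ b := Real.rpow_nonneg hx b
  have h2 : (0 : ℝ) ≤ 2 ^ b := by positivity
  rcases le_total x 1 with h | h
  · calc (1 + x) ^ b ≤ 2 ^ b := Real.rpow_le_rpow (by linarith) (by linarith) hb
      _ ≤ _ := le_mul_of_one_le_right h2 (by linarith)
  · calc (1 + x) ^ b ≤ (2 * x) ^ b := Real.rpow_le_rpow (by linarith) (by linarith) hb
      _ = 2 ^ b * x ^ b := Real.mul_rpow (by norm_num) hx
      _ ≤ _ := mul_le_mul_of_nonneg_left (by linarith) h2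

/-- The b-th power of the truncation radius costs h^{-χb}, which h^a compensates; what remains are
nonnegative powers of h ≤ T. -/
theorem exists_rpow_mul_one_add_rpow_le {T χ a b : ℝ} (hT : 0 < T) (hb : 0 ≤ b)
    (ha : 0 ≤ a) (hab : χ * b ≤ a) :
    ∃ K : ℝ, 0 ≤ K ∧ ∀ h, 0 < h → h ≤ T → h ^ a * (1 + (1 / h) ^ χ) ^ b ≤ K := by
  refine ⟨2 ^ b * (T ^ a + T ^ (a - χ * b)), by positivity, fun h hh hhT => ?_⟩
  have hx : 0 ≤ (1 / h) ^ χ := by positivity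
  calc h ^ a * (1 + (1 / h) ^ χ) ^ b ≤ h ^ a * (2 ^ b * (1 + ((1 / h) ^ χ) ^ b)) := by
        gcongr
        exact one_add_rpow_le hx hb
    _ = 2 ^ b * (h ^ a + h ^ a * ((1 / h) ^ χ) ^ b) := by ring
    _ = 2 ^ b * (h ^ a + h ^ (a - χ * b)) := by
        congr 2
        rw [← Real.rpow_mul (by positivity), one_div, Real.inv_rpow hh.le, ← Real.rpow_neg hh.le,
          ← Real.rpow_add hh]
        congr 1
    _ ≤ 2 ^ b * (T ^ a + T ^ (a - χ * b)) := by
        gcongr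

/-! ### Pathwise estimates: truncation, energy bound, perturbation. -/

section Paths

variable {ι H V : Type*} [NormedAddCommGroup H] [InnerProductSpace ℝ H]
  [NormedAddCommGroup V] [NormedSpace ℝ V]

/-- This is the purpose of the truncation. With B = 1 + h^{-χ}, the increment in V over one cell is
of order h^{γ-ρ}B + h^{1-ρ}B^{1+φ/2}, and the Lipschitz factor is of order B^{φ/2}. The two products
h^{γ-ρ}B^{1+φ/2} and h^{1-ρ}B^{1+φ} are bounded by the two conditions on χ. The noise stays frozen
at the grid point in both arguments. -/
theorem exists_norm_nonlinearity_sub_le (A : DiagNegOp ι H) {T φ ρ γ χ : ℝ} (hT : 0 < T)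
    (hφ : 0 < φ) (hρ : 0 ≤ ρ) (hργ : ρ ≤ γ) (hγ : γ ≤ 1) (hρ1 : ρ ≤ 1)
    (hχ₁ : χ * (1 + φ / 2) ≤ γ - ρ) (hχ₂ : χ * (1 + φ) ≤ 1 - ρ) (jV : A.Interp ρ →L[ℝ] V)
    {F : V → H} {C D : ℝ} (hC : 0 < C) (hD : 0 < D)
    (hF : ∀ v w : V, ‖F v - F w‖ ≤ C * ‖v - w‖ * (1 + ‖v‖ + ‖w‖) ^ (φ / 2))
    (hF' : ∀ v : V, ‖F v‖ ≤ D * (1 + ‖v‖) ^ (1 + φ / 2)) :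
    ∃ K : ℝ, 0 ≤ K ∧ ∀ (I : Finset ι) (h : ℝ), 0 < h → h ≤ T → ∀ (g : ℤ → H) (t : ℝ)
      (y : A.Interp γ) (o : A.Interp 1),
      y.toH = A.modeConv I (fun q => g ⌊q / h⌋) (gridFloor h t) + o.toH →
      o.toH ∈ range (A.proj I) →
      ‖y‖ + ‖A.incl hγ o‖ ≤ (1 / h) ^ χ →
      g ⌊t / h⌋ = F (jV (A.incl hργ y)) →
      ‖F (jV (A.incl hργ y))
        - F (jV (A.incl hρ1 (A.projTo I 1 (A.modeConv I (fun q => g ⌊q / h⌋) t) + o)))‖ ≤ K := by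
  obtain ⟨K₁, hK₁, hK₁'⟩ := exists_rpow_mul_one_add_rpow_le hT (b := 1 + φ / 2) (by positivity)
    (sub_nonneg.2 hργ) hχ₁
  obtain ⟨K₂, hK₂, hK₂'⟩ := exists_rpow_mul_one_add_rpow_le hT (b := 1 + φ) (by positivity)
    (sub_nonneg.2 hρ1) hχ₂
  obtain ⟨E, hE, hE'⟩ := A.exists_norm_incl_le hργ
  set J₀ := ‖jV‖ with hJ₀
  have hJ₀nn : 0 ≤ J₀ := norm_nonneg jV
  set J := J₀ * E with hJ
  have hJnn : 0 ≤ J := by positivity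
  set D' := D * (1 + J) ^ (1 + φ / 2) with hD'
  have hD'nn : 0 ≤ D' := by positivity
  -- In units of B: 1 for the constant, J for each occurrence of the grid value, and the last term
  -- for the increment Δ.
  set C₂ := 1 + 2 * J + J₀ * (K₁ + D' * K₂) with hC₂
  have hC₂nn : 0 ≤ C₂ := by positivity
  refine ⟨C * C₂ ^ (φ / 2) * (J₀ * (K₁ + D' * K₂)), by positivity, ?_⟩
  intro I h hh hhT g t y o hy ho hb hg
  set B := 1 + (1 / h) ^ χ with hB
  have hx : 0 ≤ (1 / h) ^ χ := by positivity
  have hB1 : 1 ≤ B := by linarith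
  have hB0 : 0 < B := by linarith
  have hk₁ := hK₁' h hh hhT
  have hk₂ := hK₂' h hh hhT
  rw [← hB] at hk₁ hk₂
  set f : ℝ → H := fun q => g ⌊q / h⌋ with hf
  set u := A.modeConv I f t with hu
  set uk := A.modeConv I f (gridFloor h t) with huk
  have hyB : ‖y‖ ≤ B := by linarith [norm_nonneg (A.incl hγ o)]
  have hjV : ∀ v, ‖jV v‖ ≤ J₀ * ‖v‖ := jV.le_opNorm
  have hjy : ‖jV (A.incl hργ y)‖ ≤ J * B := by
    calc ‖jV (A.incl hργ y)‖ ≤ J₀ * (E * ‖y‖) := (hjV _).trans (by gcongr; exact hE' y)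
      _ ≤ J₀ * (E * B) := by gcongr
      _ = J * B := by ring
  have hzk : ‖A.projTo I γ uk‖ ≤ B := by
    have e : A.projTo I γ uk = y - A.incl hγ o := by
      refine DiagNegOp.Interp.ext_toH ?_
      rw [DiagNegOp.toH_projTo, DiagNegOp.Interp.toH_sub, DiagNegOp.toH_incl, hy, huk,
        A.proj_modeConv, add_sub_cancel_right]
    rw [e]
    exact (norm_sub_le _ _).trans (by linarith)
  have hgk : ‖g ⌊t / h⌋‖ ≤ D' * B ^ (1 + φ / 2) := by
    rw [hg]
    refine (hF' _).trans ?_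
    rw [hD', mul_assoc, ← Real.mul_rpow (by positivity) hB0.le]
    gcongr
    linarith
  have hinc := A.norm_modeConv_sub_le I (g := g) hh hρ hργ hγ t
  rw [← hf, ← hu, ← huk] at hinc
  have hdiff : jV (A.incl hρ1 (A.projTo I 1 u + o)) - jV (A.incl hργ y)
      = jV (A.projTo I ρ (u - uk)) := by
    rw [← map_sub]
    congr 1
    refine DiagNegOp.Interp.ext_toH ?_
    rw [DiagNegOp.Interp.toH_sub, DiagNegOp.toH_incl, DiagNegOp.toH_incl,
      DiagNegOp.Interp.toH_add, DiagNegOp.toH_projTo, DiagNegOp.toH_projTo, hy, map_sub,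
      hu, huk, A.proj_modeConv, A.proj_modeConv]
    abel
  set Δ := ‖jV (A.incl hργ y) - jV (A.incl hρ1 (A.projTo I 1 u + o))‖ with hΔ
  have hΔle : Δ ≤ J₀ * (h ^ (γ - ρ) * B + h ^ (1 - ρ) * (D' * B ^ (1 + φ / 2))) := by
    rw [hΔ, norm_sub_rev, hdiff]
    refine (hjV _).trans ?_
    gcongr
    exact hinc.trans (by gcongr)
  have hBφ : (1 : ℝ) ≤ B ^ (φ / 2) := Real.one_le_rpow hB1 (by positivity)
  have hB2 : B ^ (1 + φ / 2) = B * B ^ (φ / 2) := by rw [Real.rpow_add hB0, Real.rpow_one]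
  have hB3 : B ^ (1 + φ) = B * B ^ (φ / 2) * B ^ (φ / 2) := by
    rw [← hB2, ← Real.rpow_add hB0]; congr 1; ring
  have hΔφ : Δ * B ^ (φ / 2) ≤ J₀ * (K₁ + D' * K₂) := by
    calc Δ * B ^ (φ / 2)
        ≤ J₀ * (h ^ (γ - ρ) * B + h ^ (1 - ρ) * (D' * B ^ (1 + φ / 2))) * B ^ (φ / 2) := by gcongr
      _ = J₀ * (h ^ (γ - ρ) * B ^ (1 + φ / 2) + D' * (h ^ (1 - ρ) * B ^ (1 + φ))) := by
          rw [hB3, hB2]; ring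
      _ ≤ _ := by gcongr
  have hΔ0 : 0 ≤ Δ := norm_nonneg _
  have hΔ1 : Δ ≤ J₀ * (K₁ + D' * K₂) * B := by
    have h1 : Δ ≤ Δ * B ^ (φ / 2) := le_mul_of_one_le_right hΔ0 hBφ
    have h2 : 0 ≤ J₀ * (K₁ + D' * K₂) := by positivity
    exact h1.trans (hΔφ.trans (le_mul_of_one_le_right h2 hB1))
  have hw : ‖jV (A.incl hρ1 (A.projTo I 1 u + o))‖ ≤ J * B + Δ := by
    have := norm_sub_norm_le (jV (A.incl hρ1 (A.projTo I 1 u + o))) (jV (A.incl hργ y))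
    rw [norm_sub_rev] at this
    linarith
  have hbase : 1 + ‖jV (A.incl hργ y)‖ + ‖jV (A.incl hρ1 (A.projTo I 1 u + o))‖ ≤ C₂ * B := by
    rw [hC₂]; nlinarith
  calc _ ≤ C * Δ * (1 + ‖jV (A.incl hργ y)‖
        + ‖jV (A.incl hρ1 (A.projTo I 1 u + o))‖) ^ (φ / 2) := hF _ _
    _ ≤ C * Δ * (C₂ * B) ^ (φ / 2) := by gcongr
    _ = C * C₂ ^ (φ / 2) * (Δ * B ^ (φ / 2)) := by
        rw [Real.mul_rpow hC₂nn hB0.le]; ring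
    _ ≤ _ := by gcongr

/-- The a priori bound: the energy `‖Z‖²_{H_{1/2}} + a ‖Z‖²_H` along a step scheme. -/
theorem norm_sq_modeConv_le_of_coercive (A : DiagNegOp ι H) {T c ε : ℝ} (hc : 0 < c)
    (hε : ε < 1) (I : Finset ι) {f : ℝ → H} (hf : RightRegular f) {a b K : ℝ}
    (ha : 0 ≤ a) (hb : 0 ≤ b)
    (hcase : ∀ t ∈ Ioo 0 T, f t = 0 ∨ ∃ f₀ : H, ‖f t - f₀‖ ≤ K ∧
      inner ℝ (A.projTo I (1 / 2) (A.modeConv I f t)) (A.projTo I (1 / 2) f₀)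
        + a * inner ℝ (A.modeConv I f t) f₀
      ≤ ε * ‖A.projTo I 1 (A.modeConv I f t)‖ ^ 2
        + (c + a) * ‖A.projTo I (1 / 2) (A.modeConv I f t)‖ ^ 2
        + c * a * ‖A.modeConv I f t‖ ^ 2 + b)
    {t : ℝ} (ht : t ∈ Icc 0 T) :
    ‖A.projTo I (1 / 2) (A.modeConv I f t)‖ ^ 2
      ≤ Real.exp (2 * (c + 1) * T) * (T * (2 * b + K ^ 2 / (2 * (1 - ε)) + a * K ^ 2)) := by
  have h1ε : 0 < 1 - ε := sub_pos.2 hε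
  set K₁ := 2 * b + K ^ 2 / (2 * (1 - ε)) + a * K ^ 2 with hK₁
  have hK₁0 : 0 ≤ K₁ := by positivity
  set z : ι → ℝ → ℝ := fun i => expConv (A.eig i) (fun s => inner ℝ (A.basis i) (f s)) with hz
  have hzI : ∀ i ∈ I, ∀ s, inner ℝ (A.basis i) (A.modeConv I f s) = z i s :=
    fun i hi s => A.inner_basis_modeConv hi f s
  have hl : ∀ i, 0 < -A.eig i := A.neg_eig_pos
  have hhalf : ∀ i, (-A.eig i) ^ (1 / 2 : ℝ) * (-A.eig i) ^ (1 / 2 : ℝ) = -A.eig i := fun i => by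
    rw [← Real.rpow_add (hl i)]; norm_num
  have hn0 : ∀ s, ‖A.modeConv I f s‖ ^ 2 = ∑ i ∈ I, z i s ^ 2 := fun s => by
    rw [A.norm_sq_eq_sum_of_mem_range ⟨_, A.proj_modeConv I f s⟩]
    exact Finset.sum_congr rfl fun i hi => by rw [hzI i hi]
  have hnr : ∀ (r : ℝ) s, ‖A.projTo I r (A.modeConv I f s)‖ ^ 2
      = ∑ i ∈ I, ((-A.eig i) ^ r * z i s) ^ 2 := fun r s => by
    rw [A.norm_sq_interp_eq_sum (I := I) (by rw [DiagNegOp.toH_projTo]; exact mem_range_self _)]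
    exact Finset.sum_congr rfl fun i hi => by
      rw [DiagNegOp.toH_projTo, A.inner_basis_proj_mem hi, hzI i hi]
  have hnh : ∀ s, ‖A.projTo I (1 / 2) (A.modeConv I f s)‖ ^ 2
      = ∑ i ∈ I, -A.eig i * z i s ^ 2 := fun s => by
    rw [hnr]
    exact Finset.sum_congr rfl fun i _ => by rw [mul_pow, sq ((-A.eig i) ^ _), hhalf]
  have hn1 : ∀ s, ‖A.projTo I 1 (A.modeConv I f s)‖ ^ 2
      = ∑ i ∈ I, A.eig i ^ 2 * z i s ^ 2 := fun s => by
    rw [hnr]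
    exact Finset.sum_congr rfl fun i _ => by rw [Real.rpow_one]; ring
  have hinn0 : ∀ s (w : H), inner ℝ (A.modeConv I f s) w
      = ∑ i ∈ I, z i s * inner ℝ (A.basis i) w := fun s w => by
    rw [A.inner_eq_sum_of_mem_range ⟨_, A.proj_modeConv I f s⟩]
    exact Finset.sum_congr rfl fun i hi => by rw [hzI i hi]
  have hinnh : ∀ s (w : H), inner ℝ (A.projTo I (1 / 2) (A.modeConv I f s)) (A.projTo I (1 / 2) w)
      = ∑ i ∈ I, -A.eig i * (z i s * inner ℝ (A.basis i) w) := fun s w => by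
    rw [A.inner_interp_eq_sum (I := I) (by rw [DiagNegOp.toH_projTo]; exact mem_range_self _)]
    refine Finset.sum_congr rfl fun i hi => ?_
    rw [DiagNegOp.toH_projTo, DiagNegOp.toH_projTo, A.inner_basis_proj_mem hi,
      A.inner_basis_proj_mem hi, hzI i hi, mul_mul_mul_comm, hhalf]
  -- These weights make the square sum equal to ‖Z‖²_{H_{1/2}} + a‖Z‖²_H, whose dissipation
  -- −‖Z‖²_{H_1} − a‖Z‖²_{H_{1/2}} offsets the terms ε‖Z‖²_{H_1} and a‖Z‖²_{H_{1/2}} of the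
  -- coercivity bound.
  have key := A.sum_expConv_sq_le_of_dissipative I hf (w := fun i => -A.eig i + a)
    (fun i => add_nonneg (hl i).le ha) (T := T) (K := 2 * (c + 1)) (by positivity)
    (a := fun _ => K₁) (fun _ => hK₁0) (fun t => by simp) (by
      intro s hs
      change 2 * ∑ i ∈ I, (-A.eig i + a) * (z i s * (A.eig i * z i s + inner ℝ (A.basis i) (f s)))
        ≤ 2 * (c + 1) * (∑ i ∈ I, (-A.eig i + a) * z i s ^ 2) + K₁
      have e1 : ∑ i ∈ I, (-A.eig i + a) * z i s ^ 2
          = (∑ i ∈ I, -A.eig i * z i s ^ 2) + a * ∑ i ∈ I, z i s ^ 2 := by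
        rw [Finset.mul_sum, ← Finset.sum_add_distrib]
        exact Finset.sum_congr rfl fun i _ => by ring
      have e2 : ∑ i ∈ I, (-A.eig i + a) * (z i s * (A.eig i * z i s + inner ℝ (A.basis i) (f s)))
          = -(∑ i ∈ I, A.eig i ^ 2 * z i s ^ 2) - a * (∑ i ∈ I, -A.eig i * z i s ^ 2)
            + ∑ i ∈ I, (-A.eig i + a) * (z i s * inner ℝ (A.basis i) (f s)) := by
        rw [Finset.mul_sum, ← Finset.sum_neg_distrib, ← Finset.sum_sub_distrib,
          ← Finset.sum_add_distrib]
        exact Finset.sum_congr rfl fun i _ => by ring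
      have p0 : 0 ≤ ∑ i ∈ I, z i s ^ 2 := Finset.sum_nonneg fun i _ => sq_nonneg _
      have ph : 0 ≤ ∑ i ∈ I, -A.eig i * z i s ^ 2 :=
        Finset.sum_nonneg fun i _ => mul_nonneg (hl i).le (sq_nonneg _)
      have p1 : 0 ≤ ∑ i ∈ I, A.eig i ^ 2 * z i s ^ 2 :=
        Finset.sum_nonneg fun i _ => by positivity
      rw [e1, e2]
      rcases hcase s hs with h0 | ⟨f₀, hK, hco⟩
      · simp only [h0, inner_zero_right, mul_zero, Finset.sum_const_zero]
        have := mul_nonneg ha p0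
        have := mul_nonneg ha ph
        nlinarith
      · rw [hinnh, hinn0, hn1, hnh, hn0] at hco
        have e3 : ∑ i ∈ I, (-A.eig i + a) * (z i s * inner ℝ (A.basis i) (f s))
            = (∑ i ∈ I, -A.eig i * (z i s * inner ℝ (A.basis i) f₀)
              + a * ∑ i ∈ I, z i s * inner ℝ (A.basis i) f₀)
            + ∑ i ∈ I, (-A.eig i + a) * (z i s * inner ℝ (A.basis i) (f s - f₀)) := by
          rw [Finset.mul_sum, ← Finset.sum_add_distrib, ← Finset.sum_add_distrib]
          exact Finset.sum_congr rfl fun i _ => by rw [inner_sub_right]; ring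
        -- Young's inequality, tuned to spend exactly the (1 − ε)‖Z‖²_{H_1} that coercivity leaves
        -- over.
        have e4 : ∑ i ∈ I, (-A.eig i + a) * (z i s * inner ℝ (A.basis i) (f s - f₀))
            ≤ (1 - ε) * (∑ i ∈ I, A.eig i ^ 2 * z i s ^ 2) + a / 2 * (∑ i ∈ I, z i s ^ 2)
              + (1 / (4 * (1 - ε)) + a / 2) * ∑ i ∈ I, (inner ℝ (A.basis i) (f s - f₀)) ^ 2 := by
          rw [Finset.mul_sum, Finset.mul_sum, Finset.mul_sum, ← Finset.sum_add_distrib,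
            ← Finset.sum_add_distrib]
          refine Finset.sum_le_sum fun i _ => ?_
          set q := inner ℝ (A.basis i) (f s - f₀)
          have y1 : -A.eig i * z i s * q
              ≤ (1 - ε) * (A.eig i ^ 2 * z i s ^ 2) + 1 / (4 * (1 - ε)) * q ^ 2 := by
            have : 0 ≤ (1 - ε) * (A.eig i * z i s + q / (2 * (1 - ε))) ^ 2 := by positivity
            have e : (1 - ε) * (A.eig i * z i s + q / (2 * (1 - ε))) ^ 2
                = (1 - ε) * (A.eig i ^ 2 * z i s ^ 2) + 1 / (4 * (1 - ε)) * q ^ 2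
                  + A.eig i * z i s * q := by
              field_simp
              ring
            linarith
          have y2 : a * (z i s * q) ≤ a / 2 * z i s ^ 2 + a / 2 * q ^ 2 := by
            nlinarith [mul_nonneg ha (sq_nonneg (z i s - q))]
          linarith
        have e5 : ∑ i ∈ I, (inner ℝ (A.basis i) (f s - f₀)) ^ 2 ≤ K ^ 2 :=
          (A.sum_inner_sq_le I _).trans (pow_le_pow_left₀ (norm_nonneg _) hK 2)
        have e6 : (1 / (4 * (1 - ε)) + a / 2) * ∑ i ∈ I, (inner ℝ (A.basis i) (f s - f₀)) ^ 2
            ≤ (1 / (4 * (1 - ε)) + a / 2) * K ^ 2 := by gcongr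
        have e7 : K₁ = 2 * b + 2 * ((1 / (4 * (1 - ε)) + a / 2) * K ^ 2) := by
          rw [hK₁]; field_simp; ring
        rw [e3, e7]
        nlinarith [mul_nonneg ha p0]) ht
  have hE : ‖A.projTo I (1 / 2) (A.modeConv I f t)‖ ^ 2 ≤ ∑ i ∈ I, (-A.eig i + a) * z i t ^ 2 := by
    rw [hnh]
    refine Finset.sum_le_sum fun i _ => ?_
    have := mul_nonneg ha (sq_nonneg (z i t))
    linarith
  refine hE.trans (key.trans ?_)
  rw [intervalIntegral.integral_const, smul_eq_mul, sub_zero]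
  gcongr
  exact ht.2

/-- The perturbation estimate for the difference of the spectral projection of an exact path and
of a step scheme, under one-sided Lipschitz continuity. -/
theorem norm_sq_modeConv_sub_le_of_monotone (A : DiagNegOp ι H) {T c ρ : ℝ} (hc : 0 < c)
    (hρ1 : ρ ≤ 1) (jV : A.Interp ρ →L[ℝ] V) (iV : V →L[ℝ] H) {F : V → H} (hF : Continuous F)
    (I : Finset ι)
    (hmono : ∀ (v w : A.Interp 1), v.toH ∈ range (A.proj I) → w.toH ∈ range (A.proj I) →
      inner ℝ (v.toH - w.toH)
        (A.op v + F (jV (A.incl hρ1 v)) - A.op w - F (jV (A.incl hρ1 w)))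
        ≤ c * ‖v.toH - w.toH‖ ^ 2)
    {x o : ℝ → V} (hx : Continuous x) (ho : Continuous o) {f : ℝ → H} (hf : RightRegular f)
    (hxo : ∀ t ∈ Icc 0 T, A.proj I (iV (x t)) = A.modeConv I (fun s => F (x s)) t
      + A.proj I (iV (o t))) {t : ℝ} (ht : t ∈ Icc 0 T) :
    ‖A.proj I (iV (x t)) - A.proj I (iV (o t)) - A.modeConv I f t‖ ^ 2
      ≤ Real.exp (2 * (c + 1) * T) * ∫ s in (0 : ℝ)..t,
        (‖F (x s) - F (jV (A.projTo I ρ (iV (x s))))‖ ^ 2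
          + ‖F (jV (A.projTo I ρ (A.modeConv I f s + iV (o s)))) - f s‖ ^ 2) := by
  have hjP : Continuous fun v : H => jV (A.projTo I ρ v) :=
    jV.continuous.comp (A.projToL I ρ).continuous
  have hFx : Continuous fun s => F (x s) := hF.comp hx
  have hfX : RightRegular fun s => F (x s) := RightRegular.of_continuous hFx
  have hFPx : Continuous fun s => F (jV (A.projTo I ρ (iV (x s)))) :=
    hF.comp (hjP.comp (iV.continuous.comp hx))
  have hFw : Continuous fun s => F (jV (A.projTo I ρ (A.modeConv I f s + iV (o s)))) :=
    hF.comp (hjP.comp ((A.continuous_modeConv I hf).add (iV.continuous.comp ho)))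
  set a : ℝ → ℝ := fun s => ‖F (x s) - F (jV (A.projTo I ρ (iV (x s))))‖ ^ 2
      + ‖F (jV (A.projTo I ρ (A.modeConv I f s + iV (o s)))) - f s‖ ^ 2 with ha
  have har : RightRegular a :=
    (hfX.sub (RightRegular.of_continuous hFPx)).norm_sq.add
      ((RightRegular.of_continuous hFw).sub hf).norm_sq
  set d : ℝ → H := fun s => F (x s) - f s with hd
  have hdr : RightRegular d := hfX.sub hf
  have hcoord : ∀ s ∈ Icc 0 T, ∀ i ∈ I,
      inner ℝ (A.basis i) (A.proj I (iV (x s)) - A.proj I (iV (o s)) - A.modeConv I f s)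
        = expConv (A.eig i) (fun s => inner ℝ (A.basis i) (d s)) s := by
    intro s hs i hi
    rw [hxo s hs, add_sub_cancel_right, inner_sub_right, A.inner_basis_modeConv hi,
      A.inner_basis_modeConv hi, ← expConv_sub _ (A.rightRegular_inner hfX i)
        (A.rightRegular_inner hf i)]
    simp only [hd, inner_sub_right]
  have hmem : ∀ s, A.proj I (iV (x s)) - A.proj I (iV (o s)) - A.modeConv I f s
      ∈ range (A.proj I) := fun s =>
    ⟨iV (x s) - iV (o s) - A.modeConv I f s, by rw [map_sub, map_sub, A.proj_modeConv]⟩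
  have key := A.sum_expConv_sq_le_of_dissipative I hdr (w := fun _ => 1) (fun _ => zero_le_one)
    (T := T) (K := 2 * (c + 1)) (by positivity) (a := a) (fun s => by positivity)
    (fun t => by
      rcases le_total 0 t with h0 | h0
      · exact (intervalIntegrable_iff_integrableOn_Icc_of_le h0).1 (har.intervalIntegrable 0 t)
      · rcases h0.eq_or_lt with rfl | h0
        · simp
        · simp [Icc_eq_empty (not_le.2 h0)])
    (by
      intro s hs
      have hs' : s ∈ Icc 0 T := ⟨hs.1.le, hs.2.le⟩
      set v : A.Interp 1 := A.projTo I 1 (iV (x s)) with hv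
      -- The exact noise is used here, not that of the scheme, so that v − w is precisely the
      -- convolution of the drift difference and obeys a differential equation without noise.
      set w : A.Interp 1 := A.projTo I 1 (A.modeConv I f s + iV (o s)) with hw
      have hvH : v.toH = A.proj I (iV (x s)) := A.toH_projTo _ _ _
      have hwH : w.toH = A.modeConv I f s + A.proj I (iV (o s)) := by
        rw [hw, A.toH_projTo, map_add, A.proj_modeConv]
      have hvw : v.toH - w.toH
          = A.proj I (iV (x s)) - A.proj I (iV (o s)) - A.modeConv I f s := by
        rw [hvH, hwH]; abel
      have h1 := hmono v w (by rw [hvH]; exact mem_range_self _)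
        (by rw [hw, A.toH_projTo]; exact mem_range_self _)
      rw [A.incl_projTo, A.incl_projTo] at h1
      set e := v.toH - w.toH with he
      have hemem : e ∈ range (A.proj I) := by rw [hvw]; exact hmem s
      have hei : ∀ i ∈ I, inner ℝ (A.basis i) e
          = expConv (A.eig i) (fun s => inner ℝ (A.basis i) (d s)) s := by
        intro i hi
        rw [hvw, hcoord s hs' i hi]
      have e1 : ∑ i ∈ I, expConv (A.eig i) (fun s => inner ℝ (A.basis i) (d s)) s
          * (A.eig i * expConv (A.eig i) (fun s => inner ℝ (A.basis i) (d s)) s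
            + inner ℝ (A.basis i) (d s)) = inner ℝ e (A.op v - A.op w + d s) := by
        rw [A.inner_eq_sum_of_mem_range hemem]
        refine Finset.sum_congr rfl fun i hi => ?_
        rw [inner_add_right (A.basis i) (A.op v - A.op w) (d s),
          inner_sub_right (A.basis i) (A.op v) (A.op w), A.inner_basis_op, A.inner_basis_op, ← mul_sub,
          ← inner_sub_right, ← he, hei i hi]
      have e2 : ∑ i ∈ I, expConv (A.eig i) (fun s => inner ℝ (A.basis i) (d s)) s ^ 2
          = ‖e‖ ^ 2 := by
        rw [A.norm_sq_eq_sum_of_mem_range hemem]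
        exact Finset.sum_congr rfl fun i hi => by rw [hei i hi]
      simp only [one_mul]
      rw [e1, e2]
      set a₁ := F (x s) - F (jV (A.projTo I ρ (iV (x s))))
      set a₂ := F (jV (A.projTo I ρ (A.modeConv I f s + iV (o s)))) - f s
      have e3 : A.op v - A.op w + d s
          = (A.op v + F (jV (A.projTo I ρ (iV (x s)))) - A.op w
            - F (jV (A.projTo I ρ (A.modeConv I f s + iV (o s))))) + a₁ + a₂ := by
        simp only [hd, a₁, a₂]; abel
      rw [e3, inner_add_right, inner_add_right]
      -- Applied to both perturbations, this raises the Gronwall constant from 2c to 2(c + 1).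
      have y : ∀ q : H, 2 * inner ℝ e q ≤ ‖e‖ ^ 2 + ‖q‖ ^ 2 := fun q => by
        have := norm_sub_sq_real e q
        nlinarith [sq_nonneg ‖e - q‖]
      have y1 := y a₁
      have y2 := y a₂
      have : a s = ‖a₁‖ ^ 2 + ‖a₂‖ ^ 2 := rfl
      rw [this]
      linarith) ht
  rw [A.norm_sq_eq_sum_of_mem_range (hmem t)]
  refine le_trans (le_of_eq ?_) key
  exact Finset.sum_congr rfl fun i hi => by rw [hcoord t ht i hi, one_mul]

end Paths

/-! ### Calculus of uniform moment bounds. -/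

theorem ENNReal.add_rpow_le_two_rpow_mul {q : ℝ} (hq : 0 ≤ q) (x y : ℝ≥0∞) :
    (x + y) ^ q ≤ 2 ^ q * (x ^ q + y ^ q) := by
  rcases le_total x y with h | h
  · calc (x + y) ^ q ≤ (2 * y) ^ q := by
          refine ENNReal.rpow_le_rpow ?_ hq
          rw [two_mul]; gcongr
      _ = 2 ^ q * y ^ q := ENNReal.mul_rpow_of_nonneg _ _ hq
      _ ≤ _ := by gcongr; exact le_add_self
  · calc (x + y) ^ q ≤ (2 * x) ^ q := by
          refine ENNReal.rpow_le_rpow ?_ hq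
          rw [two_mul]; gcongr
      _ = 2 ^ q * x ^ q := ENNReal.mul_rpow_of_nonneg _ _ hq
      _ ≤ _ := by gcongr; exact le_self_add

theorem lintegral_rpow_le_measure_univ_rpow_mul {X : Type*} [MeasurableSpace X] (ν : Measure X)
    {f : X → ℝ≥0∞} (hf : AEMeasurable f ν) {q : ℝ} (hq : 1 ≤ q) :
    (∫⁻ x, f x ∂ν) ^ q ≤ ν univ ^ (q - 1) * ∫⁻ x, f x ^ q ∂ν := by
  rcases hq.eq_or_lt with rfl | hq
  · simp
  have hq0 : 0 < q := by linarith
  have hpq := Real.HolderConjugate.conjExponent hq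
  have h := ENNReal.lintegral_mul_le_Lp_mul_Lq ν hpq hf (aemeasurable_const (b := (1 : ℝ≥0∞)))
  simp only [Pi.mul_apply, mul_one, ENNReal.one_rpow, lintegral_const, one_mul] at h
  calc (∫⁻ x, f x ∂ν) ^ q
      ≤ ((∫⁻ x, f x ^ q ∂ν) ^ (1 / q) * ν univ ^ (1 / q.conjExponent)) ^ q :=
        ENNReal.rpow_le_rpow h hq0.le
    _ = ν univ ^ (q - 1) * ∫⁻ x, f x ^ q ∂ν := by
        rw [ENNReal.mul_rpow_of_nonneg _ _ hq0.le, ← ENNReal.rpow_mul, ← ENNReal.rpow_mul,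
          one_div_mul_cancel hq0.ne', ENNReal.rpow_one, mul_comm]
        congr 2
        rw [Real.conjExponent]
        field_simp

/-- Jensen's inequality for the measure with density k. Only integrability of the kernel matters, so
no power of its singularity is ever taken. -/
theorem lintegral_mul_rpow_le_of_weight {X : Type*} [MeasurableSpace X] (ν : Measure X)
    {k f : X → ℝ≥0∞} (hk : Measurable k) (hf : Measurable f) {q : ℝ} (hq : 1 ≤ q) :
    (∫⁻ x, k x * f x ∂ν) ^ q ≤ (∫⁻ x, k x ∂ν) ^ (q - 1) * ∫⁻ x, k x * f x ^ q ∂ν := by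
  have h := lintegral_rpow_le_measure_univ_rpow_mul (ν.withDensity k) hf.aemeasurable hq
  rw [lintegral_withDensity_eq_lintegral_mul ν hk hf,
    lintegral_withDensity_eq_lintegral_mul ν hk (hf.pow_const q),
    withDensity_apply _ MeasurableSet.univ, Measure.restrict_univ] at h
  exact h

/-- Uniform `L^q`-bounds: `E[(f a t)^q] ≤ K (R a)^q` with a finite constant `K`. -/
def MomentBound {α τ Ω : Type*} [MeasurableSpace Ω] (P : Measure Ω) (f : α → τ → Ω → ℝ≥0∞)
    (q : ℝ) (R : α → ℝ≥0∞) : Prop :=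
  ∃ K : ℝ≥0∞, K ≠ ∞ ∧ ∀ a t, ∫⁻ ω, f a t ω ^ q ∂P ≤ K * R a ^ q

namespace MomentBound

variable {α τ Ω : Type*} [MeasurableSpace Ω] {P : Measure Ω} {f g : α → τ → Ω → ℝ≥0∞} {q : ℝ}
  {R R' : α → ℝ≥0∞}

theorem of_le_const_mul (hf : MomentBound P f q R) (hq : 0 ≤ q) {C : ℝ≥0∞} (hC : C ≠ ∞)
    (h : ∀ a t, ∀ᵐ ω ∂P, g a t ω ≤ C * f a t ω) : MomentBound P g q R := by
  obtain ⟨K, hK, hKf⟩ := hf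
  have hCq : C ^ q ≠ ∞ := ENNReal.rpow_ne_top_of_nonneg hq hC
  refine ⟨C ^ q * K, ENNReal.mul_ne_top hCq hK, fun a t => ?_⟩
  calc ∫⁻ ω, g a t ω ^ q ∂P ≤ ∫⁻ ω, C ^ q * f a t ω ^ q ∂P := by
        refine lintegral_mono_ae ?_
        filter_upwards [h a t] with ω hω
        rw [← ENNReal.mul_rpow_of_nonneg _ _ hq]
        exact ENNReal.rpow_le_rpow hω hq
    _ = C ^ q * ∫⁻ ω, f a t ω ^ q ∂P := lintegral_const_mul' _ _ hCq
    _ ≤ C ^ q * (K * R a ^ q) := by gcongr; exact hKf a t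
    _ = _ := (mul_assoc _ _ _).symm

theorem of_le (hf : MomentBound P f q R) (hq : 0 ≤ q)
    (h : ∀ a t, ∀ᵐ ω ∂P, g a t ω ≤ f a t ω) : MomentBound P g q R :=
  hf.of_le_const_mul hq ENNReal.one_ne_top (by simpa using h)

theorem const_mul (hf : MomentBound P f q R) (hq : 0 ≤ q) {C : ℝ≥0∞} (hC : C ≠ ∞) :
    MomentBound P (fun a t ω => C * f a t ω) q R :=
  hf.of_le_const_mul hq hC fun _ _ => Eventually.of_forall fun _ => le_rfl

theorem mono_right (hf : MomentBound P f q R) (hq : 0 ≤ q) {C : ℝ≥0∞} (hC : C ≠ ∞)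
    (h : ∀ a, R a ≤ C * R' a) : MomentBound P f q R' := by
  obtain ⟨K, hK, hKf⟩ := hf
  have hCq : C ^ q ≠ ∞ := ENNReal.rpow_ne_top_of_nonneg hq hC
  refine ⟨K * C ^ q, ENNReal.mul_ne_top hK hCq, fun a t => (hKf a t).trans ?_⟩
  rw [mul_assoc, ← ENNReal.mul_rpow_of_nonneg _ _ hq]
  gcongr
  exact h a

theorem add (hf : MomentBound P f q R) (hg : MomentBound P g q R) (hq : 0 ≤ q)
    (hfm : ∀ a t, Measurable (f a t)) : MomentBound P (fun a t ω => f a t ω + g a t ω) q R := by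
  obtain ⟨K, hK, hKf⟩ := hf
  obtain ⟨L, hL, hLg⟩ := hg
  have h2 : (2 : ℝ≥0∞) ^ q ≠ ∞ := ENNReal.rpow_ne_top_of_nonneg hq (by norm_num)
  refine ⟨2 ^ q * (K + L), by finiteness, fun a t => ?_⟩
  calc ∫⁻ ω, (f a t ω + g a t ω) ^ q ∂P ≤ ∫⁻ ω, 2 ^ q * (f a t ω ^ q + g a t ω ^ q) ∂P :=
        lintegral_mono fun ω => ENNReal.add_rpow_le_two_rpow_mul hq _ _
    _ = 2 ^ q * (∫⁻ ω, f a t ω ^ q ∂P + ∫⁻ ω, g a t ω ^ q ∂P) := by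
        rw [lintegral_const_mul' _ _ h2, lintegral_add_left ((hfm a t).pow_const q)]
    _ ≤ 2 ^ q * (K * R a ^ q + L * R a ^ q) := by
        gcongr
        · exact hKf a t
        · exact hLg a t
    _ = _ := by ring

theorem const [IsProbabilityMeasure P] (q : ℝ) (R : α → ℝ≥0∞) :
    MomentBound P (fun a (_ : τ) _ => R a) q R :=
  ⟨1, ENNReal.one_ne_top, fun a t => by simp⟩

theorem mul_left (hf : MomentBound P f q fun _ => 1) (hq : 0 ≤ q)
    (hfm : ∀ a t, Measurable (f a t)) : MomentBound P (fun a t ω => R a * f a t ω) q R := by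
  obtain ⟨K, hK, hKf⟩ := hf
  refine ⟨K, hK, fun a t => ?_⟩
  simp only [ENNReal.mul_rpow_of_nonneg _ _ hq]
  rw [lintegral_const_mul _ ((hfm a t).pow_const q), mul_comm]
  gcongr
  simpa using hKf a t

/-- Cauchy–Schwarz: the small factor carries the rate, the polynomial weight only needs bounded
moments. -/
theorem mul (hf : MomentBound P f (2 * q) R) (hg : MomentBound P g (2 * q) fun _ => 1)
    (hq : 0 ≤ q) (hfm : ∀ a t, Measurable (f a t)) (hgm : ∀ a t, Measurable (g a t)) :
    MomentBound P (fun a t ω => f a t ω * g a t ω) q R := by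
  obtain ⟨K, hK, hKf⟩ := hf
  obtain ⟨L, hL, hLg⟩ := hg
  have h2 : (0 : ℝ) ≤ 1 / 2 := by norm_num
  refine ⟨K ^ (1 / 2 : ℝ) * L ^ (1 / 2 : ℝ),
    ENNReal.mul_ne_top (ENNReal.rpow_ne_top_of_nonneg h2 hK)
      (ENNReal.rpow_ne_top_of_nonneg h2 hL), fun a t => ?_⟩
  have hpq : Real.HolderConjugate 2 2 := Real.HolderConjugate.two_two
  have h := ENNReal.lintegral_mul_le_Lp_mul_Lq P hpq ((hfm a t).pow_const q).aemeasurable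
    ((hgm a t).pow_const q).aemeasurable
  simp only [Pi.mul_apply, ← ENNReal.rpow_mul, mul_comm q 2] at h
  simp only [ENNReal.mul_rpow_of_nonneg _ _ hq]
  refine h.trans ?_
  have h1 : (∫⁻ ω, g a t ω ^ (2 * q) ∂P) ≤ L := by simpa using hLg a t
  calc _ ≤ (K * R a ^ (2 * q)) ^ (1 / 2 : ℝ) * L ^ (1 / 2 : ℝ) := by
        gcongr
        exact hKf a t
    _ = _ := by
        rw [ENNReal.mul_rpow_of_nonneg _ _ h2, ← ENNReal.rpow_mul,
          show 2 * q * (1 / 2) = q by ring]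
        ring

theorem rpow {b : ℝ} (hf : MomentBound P f (b * q) R) :
    MomentBound P (fun a t ω => f a t ω ^ b) q fun a => R a ^ b := by
  obtain ⟨K, hK, hKf⟩ := hf
  refine ⟨K, hK, fun a t => ?_⟩
  simp only [← ENNReal.rpow_mul]
  exact hKf a t

theorem of_rpow {b : ℝ} (hf : MomentBound P (fun a t ω => f a t ω ^ b) q fun a => R a ^ b) :
    MomentBound P f (b * q) R := by
  obtain ⟨K, hK, hKf⟩ := hf
  refine ⟨K, hK, fun a t => ?_⟩
  simpa only [← ENNReal.rpow_mul] using hKf a t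

theorem of_exponent_le [IsProbabilityMeasure P] {r : ℝ} (hf : MomentBound P f q R) (hr : 0 < r)
    (hrq : r ≤ q) (hfm : ∀ a t, Measurable (f a t)) : MomentBound P f r R := by
  obtain ⟨K, hK, hKf⟩ := hf
  have hq : 0 < q := hr.trans_le hrq
  have hrq' : 0 ≤ r / q := by positivity
  refine ⟨K ^ (r / q), ENNReal.rpow_ne_top_of_nonneg hrq' hK, fun a t => ?_⟩
  have h := lintegral_rpow_le_measure_univ_rpow_mul P ((hfm a t).pow_const r).aemeasurable
    (q := q / r) ((one_le_div hr).2 hrq)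
  simp only [measure_univ, ENNReal.one_rpow, one_mul, ← ENNReal.rpow_mul,
    mul_div_cancel₀ _ hr.ne'] at h
  calc ∫⁻ ω, f a t ω ^ r ∂P = ((∫⁻ ω, f a t ω ^ r ∂P) ^ (q / r)) ^ (r / q) := by
        rw [← ENNReal.rpow_mul, show q / r * (r / q) = 1 by field_simp, ENNReal.rpow_one]
    _ ≤ (K * R a ^ q) ^ (r / q) := ENNReal.rpow_le_rpow (h.trans (hKf a t)) hrq'
    _ = _ := by
        rw [ENNReal.mul_rpow_of_nonneg _ _ hrq', ← ENNReal.rpow_mul,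
          show q * (r / q) = r by field_simp]

theorem measurable_kernel_integral {T : ℝ} (hT : 0 ≤ T) {f : Icc (0 : ℝ) T → Ω → ℝ≥0∞}
    (hf : Measurable (Function.uncurry f)) (θ : ℝ) (t : ℝ) :
    Measurable fun ω => ∫⁻ s in Ioc 0 t, ENNReal.ofReal ((t - s) ^ (-θ))
      * f (projIcc 0 T hT s) ω := by
  refine Measurable.lintegral_prod_left' (f := fun q : ℝ × Ω =>
    ENNReal.ofReal ((t - q.1) ^ (-θ)) * f (projIcc 0 T hT q.1) q.2) ?_
  have h1 : Measurable fun q : ℝ × Ω => f (projIcc 0 T hT q.1) q.2 :=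
    hf.comp (((continuous_projIcc (h := hT)).measurable.comp measurable_fst).prodMk measurable_snd)
  exact (((measurable_const.sub measurable_fst).pow_const _).ennreal_ofReal).mul h1

/-- Jensen for the kernel measure, then Tonelli; the mass of the kernel is bounded uniformly in t,
so the rate R is unchanged. -/
theorem kernel_integral [SFinite P] {T : ℝ} (hT : 0 ≤ T) {f : α → Icc (0 : ℝ) T → Ω → ℝ≥0∞}
    (hf : MomentBound P f q R) (hq : 1 ≤ q) (hfm : ∀ a, Measurable (Function.uncurry (f a)))
    {θ : ℝ} (hθ : θ < 1) :
    MomentBound P (fun a (t : Icc (0 : ℝ) T) ω => ∫⁻ s in Ioc 0 (t : ℝ),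
      ENNReal.ofReal (((t : ℝ) - s) ^ (-θ)) * f a (projIcc 0 T hT s) ω) q R := by
  obtain ⟨K, hK, hKf⟩ := hf
  obtain ⟨L, hL, hLt⟩ := exists_lintegral_kernel_le T hθ
  refine ⟨L ^ (q - 1) * (L * K), ENNReal.mul_ne_top
    (ENNReal.rpow_ne_top_of_nonneg (by linarith) hL) (ENNReal.mul_ne_top hL hK), fun a t => ?_⟩
  set k : ℝ → ℝ≥0∞ := fun s => ENNReal.ofReal (((t : ℝ) - s) ^ (-θ)) with hk
  have hkm : Measurable k := ((measurable_const.sub measurable_id).pow_const _).ennreal_ofReal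
  have hfm' : Measurable fun z : Ω × ℝ => f a (projIcc 0 T hT z.2) z.1 :=
    (hfm a).comp (((continuous_projIcc (h := hT)).measurable.comp measurable_snd).prodMk measurable_fst)
  have hkt : ∫⁻ s in Ioc 0 (t : ℝ), k s ≤ L := hLt t t.2
  have hLq : L ^ (q - 1) ≠ ∞ := ENNReal.rpow_ne_top_of_nonneg (by linarith) hL
  calc ∫⁻ ω, (∫⁻ s in Ioc 0 (t : ℝ), k s * f a (projIcc 0 T hT s) ω) ^ q ∂P
      ≤ ∫⁻ ω, L ^ (q - 1) * (∫⁻ s in Ioc 0 (t : ℝ), k s * f a (projIcc 0 T hT s) ω ^ q) ∂P := by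
        refine lintegral_mono fun ω => ?_
        refine (lintegral_mul_rpow_le_of_weight _ hkm
          (hfm'.comp (measurable_const.prodMk measurable_id)) hq).trans ?_
        simp only [Function.comp_def, id_eq]
        gcongr
    _ = L ^ (q - 1) * ∫⁻ ω, (∫⁻ s in Ioc 0 (t : ℝ), k s * f a (projIcc 0 T hT s) ω ^ q) ∂P :=
        lintegral_const_mul' _ _ hLq
    _ = L ^ (q - 1) * ∫⁻ s in Ioc 0 (t : ℝ), ∫⁻ ω, k s * f a (projIcc 0 T hT s) ω ^ q ∂P := by
        rw [lintegral_lintegral_swap]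
        exact ((hkm.comp measurable_snd).mul (hfm'.pow_const q)).aemeasurable
    _ ≤ L ^ (q - 1) * ∫⁻ s in Ioc 0 (t : ℝ), k s * (K * R a ^ q) := by
        gcongr with s
        rw [lintegral_const_mul' _ _ ENNReal.ofReal_ne_top]
        gcongr
        exact hKf a _
    _ = L ^ (q - 1) * ((∫⁻ s in Ioc 0 (t : ℝ), k s) * (K * R a ^ q)) := by
        rw [lintegral_mul_const _ hkm]
    _ ≤ L ^ (q - 1) * (L * (K * R a ^ q)) := by gcongr
    _ = _ := by ring

end MomentBound

/-! ### Spectral approximation along the exact path. -/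

namespace DiagNegOp

variable {ι H V : Type*} [NormedAddCommGroup H] [InnerProductSpace ℝ H]
  [NormedAddCommGroup V] [NormedSpace ℝ V] (A : DiagNegOp ι H)

theorem inner_basis_negFracPow {r : ℝ} (hr : 0 ≤ r) (v : H) (i : ι) :
    inner ℝ (A.basis i) (A.negFracPow r v) = (-A.eig i) ^ (-r) * inner ℝ (A.basis i) v := by
  have h := (A.hasSum_negFracPow hr v).mapL (innerSL ℝ (A.basis i))
  refine h.unique ?_
  convert hasSum_single i ?_ using 1
  · rw [innerSL_apply_apply, inner_smul_right, A.inner_basis_self, mul_one]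
  · intro j hj
    simp [A.inner_basis_basis_of_ne hj.symm]

/-- The discarded basis vector is a unit eigenvector of the operator; testing on it gives the bound.
-/
theorem rpow_neg_le_norm_negFracPow_comp {r : ℝ} (hr : 0 ≤ r) {I : Finset ι} {i : ι}
    (hi : i ∉ I) : (-A.eig i) ^ (-r)
      ≤ ‖(A.negFracPow r).comp (ContinuousLinearMap.id ℝ H - A.proj I)‖ := by
  set L := (A.negFracPow r).comp (ContinuousLinearMap.id ℝ H - A.proj I) with hL
  have hb : ‖A.basis i‖ = 1 := A.basis.orthonormal.norm_eq_one i
  have hP : A.proj I (A.basis i) = 0 := by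
    rw [A.proj_apply]
    refine Finset.sum_eq_zero fun j hj => ?_
    rw [A.inner_basis_basis_of_ne (fun h : j = i => hi (h ▸ hj)), zero_smul]
  have h1 : inner ℝ (A.basis i) (L (A.basis i)) = (-A.eig i) ^ (-r) := by
    rw [hL, ContinuousLinearMap.comp_apply, _root_.sub_apply,
      ContinuousLinearMap.id_apply, hP, sub_zero, A.inner_basis_negFracPow hr,
      A.inner_basis_self, mul_one]
  calc (-A.eig i) ^ (-r) = inner ℝ (A.basis i) (L (A.basis i)) := h1.symm
    _ ≤ ‖A.basis i‖ * ‖L (A.basis i)‖ := real_inner_le_norm _ _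
    _ ≤ ‖L‖ := by
        rw [hb, one_mul]
        simpa [hb] using L.le_opNorm (A.basis i)

theorem enorm_projTo_modeConv_le [CompleteSpace H] (I : Finset ι) {f : ℝ → H}
    (hf : RightRegular f) {t : ℝ} (ht : 0 ≤ t) {r : ℝ} (hr0 : 0 ≤ r) (hr1 : r ≤ 1) :
    ‖A.projTo I r (A.modeConv I f t)‖ₑ
      ≤ ∫⁻ s in Ioc 0 t, ENNReal.ofReal ((t - s) ^ (-r)) * ‖f s‖ₑ := by
  classical
  refine A.enorm_interp_le_lintegral hf ht (d := fun i => if i ∈ I then (-A.eig i) ^ r else 0)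
    (g := fun τ => τ ^ (-r)) (fun i τ hτ => ?_) _ (fun i => ?_)
  · split_ifs with hi
    · rw [abs_of_pos (Real.rpow_pos_of_pos (A.neg_eig_pos i) r)]
      have := rpow_mul_exp_le (A.neg_eig_pos i) hr0 hr1 hτ
      rwa [neg_neg] at this
    · rw [abs_zero, zero_mul]
      positivity
  · rw [toH_projTo]
    by_cases hi : i ∈ I
    · rw [A.inner_basis_proj_mem hi, A.inner_basis_modeConv hi, if_pos hi]
    · rw [A.inner_basis_proj_notMem hi, if_neg hi, mul_zero, zero_mul]

section ExactPath

variable {ρ : ℝ} (jV : A.Interp ρ →L[ℝ] V) (iV : V →L[ℝ] H)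

theorem proj_eq_modeConv_add {x o : V} {f : ℝ → H} {t : ℝ}
    (hxo : ∀ i, inner ℝ (A.basis i) (iV x)
      = expConv (A.eig i) (fun s => inner ℝ (A.basis i) (f s)) t + inner ℝ (A.basis i) (iV o))
    (I : Finset ι) : A.proj I (iV x) = A.modeConv I f t + A.proj I (iV o) := by
  refine A.ext_inner_basis fun i => ?_
  rw [inner_add_right]
  by_cases hi : i ∈ I
  · rw [A.inner_basis_proj_mem hi, A.inner_basis_proj_mem hi, A.inner_basis_modeConv hi, hxo]
  · rw [A.inner_basis_proj_notMem hi, A.inner_basis_proj_notMem hi,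
      A.inner_basis_modeConv_notMem hi, add_zero]

variable [CompleteSpace H]

/-- No uniform bound of P_I on V is assumed, so P_I X is controlled through P_I O and the
H_ρ-smoothing of the drift convolution. -/
theorem enorm_proj_le_of_expConv (hρ : 0 ≤ ρ) (hρ1 : ρ ≤ 1) {x o : V} {f : ℝ → H}
    (hf : RightRegular f) {t : ℝ} (ht : 0 ≤ t)
    (hxo : ∀ i, inner ℝ (A.basis i) (iV x)
      = expConv (A.eig i) (fun s => inner ℝ (A.basis i) (f s)) t + inner ℝ (A.basis i) (iV o))
    (I : Finset ι) : ‖jV (A.projTo I ρ (iV x))‖ₑ ≤ ‖jV (A.projTo I ρ (iV o))‖ₑ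
      + ‖jV‖ₑ * ∫⁻ s in Ioc 0 t, ENNReal.ofReal ((t - s) ^ (-ρ)) * ‖f s‖ₑ := by
  have e : A.projTo I ρ (iV x) = A.projTo I ρ (iV o) + A.projTo I ρ (A.modeConv I f t) := by
    refine Interp.ext_toH ?_
    rw [Interp.toH_add, toH_projTo, toH_projTo, toH_projTo, A.proj_modeConv,
      A.proj_eq_modeConv_add iV hxo, add_comm]
  rw [e, map_add]
  refine (enorm_add_le _ _).trans (add_le_add le_rfl ((jV.le_opENorm _).trans ?_))
  gcongr
  exact A.enorm_projTo_modeConv_le I hf ht hρ hρ1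

/-- On modes outside I write (-μ)^ρ = (-μ)^{-r}(-μ)^{ρ+r}: the first factor is at most the operator
norm, and the second is smoothed at the cost of the kernel of order ρ + r. -/
theorem enorm_sub_proj_le_of_expConv (hρ : 0 ≤ ρ) {r : ℝ} (hr : 0 ≤ r) (hρr : ρ + r < 1)
    (hiV : Function.Injective iV) (hji : ∀ v : A.Interp ρ, iV (jV v) = v.toH) {x o : V}
    {f : ℝ → H} (hf : RightRegular f) {t : ℝ} (ht : 0 ≤ t)
    (hxo : ∀ i, inner ℝ (A.basis i) (iV x)
      = expConv (A.eig i) (fun s => inner ℝ (A.basis i) (f s)) t + inner ℝ (A.basis i) (iV o))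
    (I : Finset ι) : ‖x - jV (A.projTo I ρ (iV x))‖ₑ ≤ ‖o - jV (A.projTo I ρ (iV o))‖ₑ
      + ‖jV‖ₑ * (ENNReal.ofReal ‖(A.negFracPow r).comp (ContinuousLinearMap.id ℝ H - A.proj I)‖
        * ∫⁻ s in Ioc 0 t, ENNReal.ofReal ((t - s) ^ (-(ρ + r))) * ‖f s‖ₑ) := by
  classical
  set κ := ‖(A.negFracPow r).comp (ContinuousLinearMap.id ℝ H - A.proj I)‖ with hκ
  have hκ0 : 0 ≤ κ := norm_nonneg _
  set w : H := iV x - iV o with hw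
  have hwi : ∀ i, inner ℝ (A.basis i) w
      = expConv (A.eig i) (fun s => inner ℝ (A.basis i) (f s)) t := fun i => by
    rw [hw, inner_sub_right, hxo, add_sub_cancel_right]
  have hmem : w - A.proj I w ∈ diagDom A.basis (fun i => (-A.eig i) ^ ρ) :=
    Submodule.sub_mem _ (A.mem_diagDom_of_expConv hf ht hρ (by linarith) hwi)
      (A.proj_mem_diagDom I _ w)
  set v : A.Interp ρ := ⟨w - A.proj I w, hmem⟩ with hv
  have hvH : v.toH = w - A.proj I w := Interp.toH_mk _ _
  -- An identity in V, checked in H by injectivity; only x − o, not x itself, is known to lie in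
  -- H_ρ.
  have hdec : x - jV (A.projTo I ρ (iV x)) = (o - jV (A.projTo I ρ (iV o))) + jV v := by
    apply hiV
    rw [map_add, map_sub, map_sub, hji, hji, hji, hvH, toH_projTo, toH_projTo, hw, map_sub]
    abel
  rw [hdec]
  refine (enorm_add_le _ _).trans (add_le_add le_rfl ((jV.le_opENorm _).trans ?_))
  gcongr
  refine (A.enorm_interp_le_lintegral hf ht
    (d := fun i => if i ∈ I then 0 else (-A.eig i) ^ ρ)
    (g := fun τ => κ * τ ^ (-(ρ + r))) (fun i τ hτ => ?_) v (fun i => ?_)).trans ?_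
  · split_ifs with hi
    · rw [abs_zero, zero_mul]
      positivity
    · have hl := A.neg_eig_pos i
      rw [abs_of_pos (Real.rpow_pos_of_pos hl ρ)]
      have h1 := rpow_mul_exp_le hl (by positivity : 0 ≤ ρ + r) hρr.le hτ
      rw [neg_neg] at h1
      have h2 : (-A.eig i) ^ ρ = (-A.eig i) ^ (-r) * (-A.eig i) ^ (ρ + r) := by
        rw [← Real.rpow_add hl]; congr 1; ring
      rw [h2, mul_assoc]
      have h3 := A.rpow_neg_le_norm_negFracPow_comp hr hi
      rw [← hκ] at h3
      gcongr
  · rw [hvH, inner_sub_right]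
    by_cases hi : i ∈ I
    · rw [A.inner_basis_proj_mem hi, if_pos hi, sub_self, mul_zero, zero_mul]
    · rw [A.inner_basis_proj_notMem hi, if_neg hi, sub_zero, hwi]
  · rw [← lintegral_const_mul' _ _ ENNReal.ofReal_ne_top]
    refine lintegral_mono fun s => ?_
    dsimp only
    rw [ENNReal.ofReal_mul hκ0, mul_assoc]

theorem forall_expConv_eq_of_dense [TopologicalSpace.SeparableSpace H] {T : ℝ} {x o : ℝ → V}
    (hx : Continuous x) (ho : Continuous o) {f : ℝ → H} (hf : RightRegular f)
    {S : Set ℝ} (hS : Icc 0 T ⊆ closure S) (hS0 : S ⊆ Icc 0 T)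
    (heq : ∀ t ∈ S, iV (x t) = (∫ s in (0 : ℝ)..t, A.semigroup (t - s) (f s)) + iV (o t)) :
    ∀ t ∈ Icc 0 T, ∀ i, inner ℝ (A.basis i) (iV (x t))
      = expConv (A.eig i) (fun s => inner ℝ (A.basis i) (f s)) t
        + inner ℝ (A.basis i) (iV (o t)) := by
  intro t ht i
  have h1 : Continuous fun t => inner ℝ (A.basis i) (iV (x t)) :=
    continuous_const.inner (iV.continuous.comp hx)
  have h2 : Continuous fun t => expConv (A.eig i) (fun s => inner ℝ (A.basis i) (f s)) t
        + inner ℝ (A.basis i) (iV (o t)) :=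
    (continuous_expConv _ (A.rightRegular_inner hf i)).add
      (continuous_const.inner (iV.continuous.comp ho))
  have hcl : IsClosed {t | inner ℝ (A.basis i) (iV (x t))
      = expConv (A.eig i) (fun s => inner ℝ (A.basis i) (f s)) t
        + inner ℝ (A.basis i) (iV (o t))} := isClosed_eq h1 h2
  refine hcl.closure_subset_iff.2 (fun s hs => ?_) (hS ht)
  rw [mem_ofPred_eq, heq s hs, inner_add_right, A.inner_basis_integral_semigroup hf (hS0 hs).1]

end ExactPath

end DiagNegOp

/-! ### Extended-norm forms of the bounds on F; rounding to the grid. -/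

theorem enorm_le_ofReal_of_norm_le {E : Type*} [SeminormedAddCommGroup E] {v : E} {r : ℝ}
    (h : ‖v‖ ≤ r) : ‖v‖ₑ ≤ ENNReal.ofReal r := by
  rw [← ofReal_norm]
  exact ENNReal.ofReal_le_ofReal h

theorem enorm_sub_le_of_norm_sub_le {H V : Type*} [NormedAddCommGroup H] [NormedAddCommGroup V]
    {F : V → H} {C s : ℝ} (hC : 0 ≤ C) (hs : 0 ≤ s)
    (hF : ∀ v w : V, ‖F v - F w‖ ≤ C * ‖v - w‖ * (1 + ‖v‖ + ‖w‖) ^ s) (v w : V) :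
    ‖F v - F w‖ₑ ≤ ENNReal.ofReal C * (‖v - w‖ₑ * (1 + ‖v‖ₑ + ‖w‖ₑ) ^ s) := by
  refine (enorm_le_ofReal_of_norm_le (hF v w)).trans (le_of_eq ?_)
  rw [mul_assoc, ENNReal.ofReal_mul hC, ENNReal.ofReal_mul (norm_nonneg _),
    ← ENNReal.ofReal_rpow_of_nonneg (by positivity) hs, ENNReal.ofReal_add (by positivity)
    (norm_nonneg _), ENNReal.ofReal_add zero_le_one (norm_nonneg _), ENNReal.ofReal_one,
    ofReal_norm, ofReal_norm, ofReal_norm]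

theorem enorm_le_of_norm_le_rpow {H V : Type*} [NormedAddCommGroup H] [NormedAddCommGroup V]
    {F : V → H} {C s : ℝ} (hC : 0 ≤ C) (hs : 0 ≤ s)
    (hF : ∀ v : V, ‖F v‖ ≤ C * (1 + ‖v‖) ^ s) (v : V) :
    ‖F v‖ₑ ≤ ENNReal.ofReal C * (1 + ‖v‖ₑ) ^ s := by
  refine (enorm_le_ofReal_of_norm_le (hF v)).trans (le_of_eq ?_)
  rw [ENNReal.ofReal_mul hC, ← ENNReal.ofReal_rpow_of_nonneg (by positivity) hs,
    ENNReal.ofReal_add zero_le_one (norm_nonneg _), ENNReal.ofReal_one, ofReal_norm]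

theorem gridFloor_nonneg {h t : ℝ} (hh : 0 < h) (ht : 0 ≤ t) : 0 ≤ gridFloor h t :=
  mul_nonneg (by exact_mod_cast Int.floor_nonneg.2 (div_nonneg ht hh.le)) hh.le

theorem gridFloor_le {h : ℝ} (hh : 0 < h) (t : ℝ) : gridFloor h t ≤ t :=
  (isGreatest_gridFloor hh t).1.2

/-- The three local errors over one cell: the increment of Z, the increment of the exact noise, and
the noise approximation at the grid point. -/
theorem DiagNegOp.projTo_add_sub_incl {ι H : Type*} [NormedAddCommGroup H]
    [InnerProductSpace ℝ H] (A : DiagNegOp ι H) (I : Finset ι) {ρ γ r : ℝ} (hργ : ρ ≤ γ)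
    (hρr : ρ ≤ r) {y : A.Interp γ} {o : A.Interp r} {u v : H} (hv : A.proj I v = v)
    (hy : y.toH = v + o.toH) (a b : H) :
    A.projTo I ρ (u + a) - A.incl hργ y = A.projTo I ρ (u - v) + A.projTo I ρ (a - b)
      + (A.projTo I ρ b - A.incl hρr o) := by
  refine Interp.ext_toH ?_
  rw [Interp.toH_sub, Interp.toH_add, Interp.toH_add, Interp.toH_sub, toH_projTo, toH_projTo,
    toH_projTo, toH_projTo, toH_incl, toH_incl, hy, map_add, map_sub, map_sub, hv]
  abel

/-! ### Estimates along the truncated step scheme. -/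

section Scheme

variable {ι H V : Type*} [NormedAddCommGroup H] [InnerProductSpace ℝ H]
  [NormedAddCommGroup V] [NormedSpace ℝ V]

-- Combines the truncation lemma with the energy bound. The constant is uniform in I, in the step
-- size and in the noise path, whose influence is linear in Φ and ϕ.
open Classical in
theorem exists_norm_sq_scheme_le (A : DiagNegOp ι H) {T c φ ε ρ γ χ : ℝ} (hT : 0 < T)
    (hc : 0 < c) (hφ : 0 < φ) (hε : ε < 1) (hρ : 0 ≤ ρ) (hργ : ρ ≤ γ) (hγ : γ ≤ 1)
    (hρ1 : ρ ≤ 1) (hh1 : (1 / 2 : ℝ) ≤ 1)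
    (hχ₁ : χ * (1 + φ / 2) ≤ γ - ρ) (hχ₂ : χ * (1 + φ) ≤ 1 - ρ) (jV : A.Interp ρ →L[ℝ] V)
    {F : V → H} {C D : ℝ} (hC : 0 < C) (hD : 0 < D)
    (hF : ∀ v w : V, ‖F v - F w‖ ≤ C * ‖v - w‖ * (1 + ‖v‖ + ‖w‖) ^ (φ / 2))
    (hF' : ∀ v : V, ‖F v‖ ≤ D * (1 + ‖v‖) ^ (1 + φ / 2))
    {phi Phi : C(Icc (0 : ℝ) T, A.Interp 1) → ℝ} (hphi : ∀ x, 0 ≤ phi x) (hPhi : ∀ x, 0 ≤ Phi x)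
    (hcoer : ∀ (I : Finset ι) (v : A.Interp 1), v.toH ∈ range (A.proj I) →
      ∀ (x : C(Icc (0 : ℝ) T, A.Interp 1)) (t : Icc (0 : ℝ) T),
      inner ℝ (A.incl hh1 v : A.Interp (1 / 2))
          (A.projTo I (1 / 2) (F (jV (A.incl hρ1 (v + x t)))))
        + phi x * inner ℝ v.toH (F (jV (A.incl hρ1 (v + x t))))
        ≤ ε * ‖v‖ ^ 2 + (c + phi x) * ‖(A.incl hh1 v : A.Interp (1 / 2))‖ ^ 2
          + c * phi x * ‖v.toH‖ ^ 2 + Phi x) :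
    ∃ K : ℝ, 0 ≤ K ∧ ∀ (I : Finset ι) (h : ℝ), 0 < h → h ≤ T → ∀ (g : ℤ → H)
      (x : C(Icc (0 : ℝ) T, A.Interp 1)) (y : ℤ → A.Interp γ),
      (∀ t, (x t).toH ∈ range (A.proj I)) →
      (∀ t, g ⌊t / h⌋ = if ‖y ⌊t / h⌋‖
          + ‖A.incl hγ (x (projIcc 0 T hT.le (gridFloor h t)))‖ ≤ (1 / h) ^ χ
        then F (jV (A.incl hργ (y ⌊t / h⌋))) else 0) →
      (∀ t ∈ Icc 0 T, (y ⌊t / h⌋).toH = A.modeConv I (fun q => g ⌊q / h⌋) (gridFloor h t)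
        + (x (projIcc 0 T hT.le (gridFloor h t))).toH) →
      ∀ t ∈ Icc 0 T, ‖A.projTo I (1 / 2) (A.modeConv I (fun q => g ⌊q / h⌋) t)‖ ^ 2
        ≤ K * (1 + Phi x + phi x) := by
  obtain ⟨K, hK, hKb⟩ := exists_norm_nonlinearity_sub_le A hT hφ hρ hργ hγ hρ1 hχ₁ hχ₂ jV hC hD
    hF hF'
  have h1ε : 0 < 1 - ε := sub_pos.2 hε
  refine ⟨Real.exp (2 * (c + 1) * T) * (T * (2 + K ^ 2 / (2 * (1 - ε)) + K ^ 2)), by positivity,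
    ?_⟩
  intro I h hh hhT g x y hx hg hy t ht
  set f : ℝ → H := fun q => g ⌊q / h⌋ with hf
  refine (norm_sq_modeConv_le_of_coercive A hc hε I (RightRegular.comp_floor g hh) (hphi x)
    (hPhi x) (K := K) (fun s hs => ?_) ht).trans ?_
  · by_cases hcase : ‖y ⌊s / h⌋‖
        + ‖A.incl hγ (x (projIcc 0 T hT.le (gridFloor h s)))‖ ≤ (1 / h) ^ χ
    · right
      set v : A.Interp 1 := A.projTo I 1 (A.modeConv I f s) with hv
      have hgs := hg s
      rw [if_pos hcase] at hgs
      refine ⟨F (jV (A.incl hρ1 (v + x (projIcc 0 T hT.le (gridFloor h s))))), ?_, ?_⟩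
      · rw [hgs]
        exact hKb I h hh hhT g s _ _ (hy s ⟨hs.1.le, hs.2.le⟩) (hx _) hcase hgs
      · have hvH : v.toH = A.modeConv I f s := by rw [hv, A.toH_projTo, A.proj_modeConv]
        have := hcoer I v (by rw [hv, A.toH_projTo]; exact mem_range_self _) x
          (projIcc 0 T hT.le (gridFloor h s))
        rw [hvH] at this
        rw [hv, A.incl_projTo, ← hv] at this
        exact this
    · left
      rw [hg s, if_neg hcase]
  · rw [mul_assoc (Real.exp _), mul_assoc T]
    have h1 : 0 ≤ K ^ 2 / (2 * (1 - ε)) := by positivity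
    have h2 := hphi x
    have h3 := hPhi x
    refine mul_le_mul_of_nonneg_left (mul_le_mul_of_nonneg_left ?_ hT.le) (Real.exp_pos _).le
    nlinarith [mul_nonneg h1 h2, mul_nonneg h1 h3, sq_nonneg K, mul_nonneg (sq_nonneg K) h2,
      mul_nonneg (sq_nonneg K) h3]

-- The error of freezing the drift on a cell. Q bounds both the grid value of Z in H_{ρ+ϱ} and the
-- current drift, so the cell increment is of order h^ϱ Q; the last summand accounts for truncated
-- cells. No smallness of Y is used here, all weights being left for moment estimates.
open Classical in
theorem exists_enorm_nonlinearity_sub_step_le [CompleteSpace H] (A : DiagNegOp ι H)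
    {T φ ρ γ χ ϑ ϱ : ℝ} (hT : 0 < T)
    (hφ : 0 < φ) (hρ : 0 ≤ ρ) (hργ : ρ ≤ γ) (hγ : γ ≤ 1) (hρ1 : ρ ≤ 1) (hϑ : 0 < ϑ) (hϱ : 0 ≤ ϱ)
    (hϱ1 : ρ + ϱ ≤ 1) (jV : A.Interp ρ →L[ℝ] V) (iV : V →L[ℝ] H)
    {F : V → H} {C D : ℝ} (hC : 0 < C) (hD : 0 < D)
    (hF : ∀ v w : V, ‖F v - F w‖ ≤ C * ‖v - w‖ * (1 + ‖v‖ + ‖w‖) ^ (φ / 2))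
    (hF' : ∀ v : V, ‖F v‖ ≤ D * (1 + ‖v‖) ^ (1 + φ / 2)) :
    ∃ K : ℝ≥0∞, K ≠ ∞ ∧ ∀ (I : Finset ι) (h : ℝ), 0 < h → h ≤ T → ∀ (g : ℤ → H) (t : ℝ), 0 ≤ t →
      ∀ (y : A.Interp γ) (o : A.Interp 1) (Ot Ok : V) (Q : ℝ≥0∞),
      (g ⌊t / h⌋ = if ‖y‖ + ‖A.incl hγ o‖ ≤ (1 / h) ^ χ then F (jV (A.incl hργ y)) else 0) →
      y.toH = A.modeConv I (fun q => g ⌊q / h⌋) (gridFloor h t) + o.toH →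
      Q = (∫⁻ s in Ioc 0 (gridFloor h t), ENNReal.ofReal ((gridFloor h t - s) ^ (-(ρ + ϱ)))
        * ‖g ⌊s / h⌋‖ₑ) + ‖g ⌊t / h⌋‖ₑ →
      ‖F (jV (A.projTo I ρ (A.modeConv I (fun q => g ⌊q / h⌋) t + iV Ot))) - g ⌊t / h⌋‖ₑ
        ≤ K * ((ENNReal.ofReal (h ^ ϱ) * Q + ‖jV (A.projTo I ρ (iV (Ot - Ok)))‖ₑ
              + ‖jV (A.projTo I ρ (iV Ok)) - jV (A.incl hρ1 o)‖ₑ)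
            * (1 + Q + ‖jV (A.projTo I ρ (iV Ot))‖ₑ + ‖y‖ₑ) ^ (φ / 2)
          + ENNReal.ofReal (h ^ (χ * ϑ))
            * ((‖y‖ₑ + ‖A.incl hγ o‖ₑ) ^ ϑ * (1 + ‖y‖ₑ) ^ (1 + φ / 2))) := by
  obtain ⟨E₁, hE₁, hE₁'⟩ := A.exists_norm_incl_le hργ
  obtain ⟨E₂, hE₂, hE₂'⟩ := A.exists_norm_incl_le (le_add_of_nonneg_right hϱ : ρ ≤ ρ + ϱ)
  set J : ℝ≥0∞ := ‖jV‖ₑ with hJ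
  have hJt : J ≠ ∞ := enorm_ne_top
  set e₁ := ENNReal.ofReal E₁ with he₁
  set e₂ := ENNReal.ofReal E₂ with he₂
  -- The second summand turns the drift's contribution h^{1-ρ} into h^ϱ, using h ≤ T.
  set c₁ : ℝ≥0∞ := 1 + ENNReal.ofReal (T ^ (1 - ρ - ϱ)) with hc₁
  set c₄ : ℝ≥0∞ := 1 + J * (c₁ * ENNReal.ofReal (T ^ ϱ) + e₂) + J * e₁ with hc₄
  have hφ2 : 0 ≤ φ / 2 := by positivity
  have hφ3 : 0 ≤ 1 + φ / 2 := by positivity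
  refine ⟨ENNReal.ofReal C * ((1 + J * c₁) * c₄ ^ (φ / 2))
    + ENNReal.ofReal D * (1 + J * e₁) ^ (1 + φ / 2), ?_, ?_⟩
  · have : c₄ ^ (φ / 2) ≠ ∞ := ENNReal.rpow_ne_top_of_nonneg hφ2 (by finiteness)
    have : (1 + J * e₁) ^ (1 + φ / 2) ≠ ∞ := ENNReal.rpow_ne_top_of_nonneg hφ3 (by finiteness)
    finiteness
  intro I h hh hhT g t ht y o Ot Ok Q hg hy hQ
  set f : ℝ → H := fun q => g ⌊q / h⌋ with hf
  have hfr : RightRegular f := RightRegular.comp_floor g hh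
  set u := A.modeConv I f t with hu
  set uk := A.modeConv I f (gridFloor h t) with huk
  set η := ENNReal.ofReal (h ^ ϱ) with hη
  have hk0 : 0 ≤ gridFloor h t := gridFloor_nonneg hh ht
  have hηT : η ≤ ENNReal.ofReal (T ^ ϱ) :=
    ENNReal.ofReal_le_ofReal (Real.rpow_le_rpow hh.le hhT hϱ)
  have hq : ‖A.projTo I (ρ + ϱ) uk‖ₑ ≤ Q := by
    rw [hQ]
    exact (A.enorm_projTo_modeConv_le I hfr hk0 (by positivity) hϱ1).trans le_self_add
  have hgQ : ‖g ⌊t / h⌋‖ₑ ≤ Q := by rw [hQ]; exact le_add_self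
  have hinc : ‖A.projTo I ρ (u - uk)‖ₑ ≤ c₁ * (η * Q) := by
    have h0 := A.norm_modeConv_sub_le I (g := g) hh hρ (le_add_of_nonneg_right hϱ) hϱ1 t
    rw [add_sub_cancel_left, ← hf, ← hu, ← huk] at h0
    have h1 := enorm_le_ofReal_of_norm_le h0
    rw [ENNReal.ofReal_add (by positivity) (by positivity), ENNReal.ofReal_mul (by positivity),
      ENNReal.ofReal_mul (by positivity), ofReal_norm, ofReal_norm, ← hη] at h1
    have h2 : ENNReal.ofReal (h ^ (1 - ρ)) ≤ ENNReal.ofReal (T ^ (1 - ρ - ϱ)) * η := by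
      rw [hη, ← ENNReal.ofReal_mul (by positivity)]
      refine ENNReal.ofReal_le_ofReal ?_
      have e : h ^ (1 - ρ) = h ^ (1 - ρ - ϱ) * h ^ ϱ := by
        rw [← Real.rpow_add hh]; congr 1; ring
      rw [e]
      exact mul_le_mul_of_nonneg_right (Real.rpow_le_rpow hh.le hhT (by linarith)) (by positivity)
    calc _ ≤ _ := h1
      _ ≤ η * Q + (ENNReal.ofReal (T ^ (1 - ρ - ϱ)) * η) * Q := by gcongr
      _ = _ := by rw [hc₁]; ring
  have hjV : ∀ v, ‖jV v‖ₑ ≤ J * ‖v‖ₑ := jV.le_opENorm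
  set w := jV (A.projTo I ρ (u + iV Ot)) with hw
  set yV := jV (A.incl hργ y) with hyV
  set d := ‖jV (A.projTo I ρ (iV (Ot - Ok)))‖ₑ with hd
  set b := ‖jV (A.projTo I ρ (iV Ok)) - jV (A.incl hρ1 o)‖ₑ with hb
  have hwy : w - yV = jV (A.projTo I ρ (u - uk)) + jV (A.projTo I ρ (iV (Ot - Ok)))
      + (jV (A.projTo I ρ (iV Ok)) - jV (A.incl hρ1 o)) := by
    have h0 := A.projTo_add_sub_incl I hργ hρ1 (u := u) (A.proj_modeConv I f (gridFloor h t)) hy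
      (iV Ot) (iV Ok)
    rw [hw, hyV, ← map_sub, h0, map_add, map_add, map_sub jV, map_sub iV]
  have hwy' : ‖w - yV‖ₑ ≤ (1 + J * c₁) * (η * Q + d + b) := by
    rw [hwy]
    calc _ ≤ ‖jV (A.projTo I ρ (u - uk))‖ₑ + d + b :=
          (enorm_add_le _ _).trans (add_le_add (enorm_add_le _ _) le_rfl)
      _ ≤ J * (c₁ * (η * Q)) + d + b := by
          gcongr
          exact (hjV _).trans (by gcongr)
      _ ≤ (1 + J * c₁) * (η * Q) + (1 + J * c₁) * d + (1 + J * c₁) * b := by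
          refine add_le_add (add_le_add ?_ ?_) ?_
          · rw [← mul_assoc]; gcongr; exact le_add_self
          · exact le_mul_of_one_le_left zero_le le_self_add
          · exact le_mul_of_one_le_left zero_le le_self_add
      _ = _ := by ring
  have hyV' : ‖yV‖ₑ ≤ J * e₁ * ‖y‖ₑ := by
    rw [mul_assoc]
    refine (hjV _).trans ?_
    gcongr
    refine (enorm_le_ofReal_of_norm_le (hE₁' y)).trans (le_of_eq ?_)
    rw [ENNReal.ofReal_mul hE₁.le, ofReal_norm]
  have huk' : ‖A.projTo I ρ uk‖ₑ ≤ e₂ * Q := by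
    have h0 := hE₂' (A.projTo I (ρ + ϱ) uk)
    rw [A.incl_projTo] at h0
    refine (enorm_le_ofReal_of_norm_le h0).trans ?_
    rw [ENNReal.ofReal_mul hE₂.le, ofReal_norm]
    gcongr
  have hw' : ‖w‖ₑ ≤ J * (c₁ * ENNReal.ofReal (T ^ ϱ) + e₂) * Q
      + ‖jV (A.projTo I ρ (iV Ot))‖ₑ := by
    have : w = jV (A.projTo I ρ (u - uk) + A.projTo I ρ uk) + jV (A.projTo I ρ (iV Ot)) := by
      rw [hw, ← map_add, A.projTo_add, A.projTo_sub, sub_add_cancel]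
    rw [this]
    refine (enorm_add_le _ _).trans (add_le_add ((hjV _).trans ?_) le_rfl)
    rw [mul_assoc]
    gcongr
    calc _ ≤ c₁ * (η * Q) + e₂ * Q := (enorm_add_le _ _).trans (add_le_add hinc huk')
      _ ≤ c₁ * (ENNReal.ofReal (T ^ ϱ) * Q) + e₂ * Q := by gcongr
      _ = _ := by ring
  set W := 1 + Q + ‖jV (A.projTo I ρ (iV Ot))‖ₑ + ‖y‖ₑ with hW
  have hbase : 1 + ‖w‖ₑ + ‖yV‖ₑ ≤ c₄ * W := by
    set a₁ := J * (c₁ * ENNReal.ofReal (T ^ ϱ) + e₂) with ha₁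
    set p := ‖jV (A.projTo I ρ (iV Ot))‖ₑ
    calc 1 + ‖w‖ₑ + ‖yV‖ₑ ≤ 1 + (a₁ * Q + p) + J * e₁ * ‖y‖ₑ := by gcongr
      _ ≤ 1 * W + a₁ * W + J * e₁ * W := by
          have e : 1 + (a₁ * Q + p) + J * e₁ * ‖y‖ₑ = (1 + p) + a₁ * Q + J * e₁ * ‖y‖ₑ := by ring
          rw [e]
          refine add_le_add (add_le_add ?_ (mul_le_mul' le_rfl ?_)) (mul_le_mul' le_rfl ?_)
          · rw [one_mul, hW]
            calc 1 + p ≤ 1 + p + (Q + ‖y‖ₑ) := le_self_add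
              _ = _ := by ring
          · rw [hW]
            calc Q ≤ Q + (1 + p + ‖y‖ₑ) := le_self_add
              _ = _ := by ring
          · exact le_add_self
      _ = _ := by rw [hc₄]; ring
  have hmain : ‖F w - F yV‖ₑ
      ≤ ENNReal.ofReal C * ((1 + J * c₁) * c₄ ^ (φ / 2)) * ((η * Q + d + b) * W ^ (φ / 2)) := by
    refine (enorm_sub_le_of_norm_sub_le hC.le hφ2 hF w yV).trans ?_
    calc _ ≤ ENNReal.ofReal C * (((1 + J * c₁) * (η * Q + d + b)) * (c₄ * W) ^ (φ / 2)) := by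
          gcongr
      _ = _ := by rw [ENNReal.mul_rpow_of_nonneg _ _ hφ2]; ring
  have htrunc : ‖F yV - g ⌊t / h⌋‖ₑ ≤ ENNReal.ofReal D * (1 + J * e₁) ^ (1 + φ / 2)
      * (ENNReal.ofReal (h ^ (χ * ϑ))
        * ((‖y‖ₑ + ‖A.incl hγ o‖ₑ) ^ ϑ * (1 + ‖y‖ₑ) ^ (1 + φ / 2))) := by
    rw [hg]
    split_ifs with hcase
    · rw [hyV, sub_self, enorm_zero]; exact zero_le
    · rw [sub_zero]
      push Not at hcase
      -- A pathwise Markov inequality: beyond the threshold, an arbitrary power ϑ of norm over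
      -- threshold is at least one.
      have h1 : 1 ≤ ENNReal.ofReal (h ^ (χ * ϑ)) * (‖y‖ₑ + ‖A.incl hγ o‖ₑ) ^ ϑ := by
        have hs : 0 ≤ ‖y‖ + ‖A.incl hγ o‖ := by positivity
        rw [← ofReal_norm, ← ofReal_norm, ← ENNReal.ofReal_add (norm_nonneg _) (norm_nonneg _),
          ENNReal.ofReal_rpow_of_nonneg hs hϑ.le, ← ENNReal.ofReal_mul (by positivity),
          ENNReal.one_le_ofReal, Real.rpow_mul hh.le, ← Real.mul_rpow (by positivity) hs]
        refine Real.one_le_rpow ?_ hϑ.le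
        have h2 : h ^ χ * (1 / h) ^ χ = 1 := by
          rw [← Real.mul_rpow hh.le (by positivity), mul_one_div_cancel hh.ne', Real.one_rpow]
        calc 1 = h ^ χ * (1 / h) ^ χ := h2.symm
          _ ≤ _ := by gcongr
      have h2 : ‖F yV‖ₑ ≤ ENNReal.ofReal D * ((1 + J * e₁) ^ (1 + φ / 2)
          * (1 + ‖y‖ₑ) ^ (1 + φ / 2)) := by
        refine (enorm_le_of_norm_le_rpow hD.le hφ3 hF' yV).trans ?_
        rw [← ENNReal.mul_rpow_of_nonneg _ _ hφ3]
        gcongr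
        calc 1 + ‖yV‖ₑ ≤ 1 + J * e₁ * ‖y‖ₑ := by gcongr
          _ ≤ 1 + J * e₁ * ‖y‖ₑ + (J * e₁ + ‖y‖ₑ) := le_self_add
          _ = _ := by ring
      calc ‖F yV‖ₑ ≤ 1 * (ENNReal.ofReal D * ((1 + J * e₁) ^ (1 + φ / 2)
          * (1 + ‖y‖ₑ) ^ (1 + φ / 2))) := by rwa [one_mul]
        _ ≤ (ENNReal.ofReal (h ^ (χ * ϑ)) * (‖y‖ₑ + ‖A.incl hγ o‖ₑ) ^ ϑ)
            * (ENNReal.ofReal D * ((1 + J * e₁) ^ (1 + φ / 2) * (1 + ‖y‖ₑ) ^ (1 + φ / 2))) := by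
          gcongr
        _ = _ := by ring
  have haux : ∀ a b X Y : ℝ≥0∞, a * X + b * Y ≤ (a + b) * (X + Y) := fun a b X Y => by
    calc a * X + b * Y ≤ a * X + b * Y + (a * Y + b * X) := le_self_add
      _ = _ := by ring
  calc ‖F w - g ⌊t / h⌋‖ₑ ≤ ‖F w - F yV‖ₑ + ‖F yV - g ⌊t / h⌋‖ₑ := by
        rw [← sub_add_sub_cancel (F w) (F yV)]
        exact enorm_add_le _ _
    _ ≤ _ := add_le_add hmain htrunc
    _ ≤ _ := haux _ _ _ _

end Scheme

/-! ### Moments of the error terms. -/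

namespace MomentBound

variable {α Ω : Type*} [MeasurableSpace Ω] {P : Measure Ω} {R : α → ℝ≥0∞}

theorem rpow_one_right {τ : Type*} {f : α → τ → Ω → ℝ≥0∞} {b q s : ℝ}
    (hf : MomentBound P f s fun _ => 1) (hs : b * q = s) :
    MomentBound P (fun a t ω => f a t ω ^ b) q fun _ => 1 := by
  subst hs
  simpa using hf.rpow

theorem reindex {τ τ' : Type*} {f : α → τ → Ω → ℝ≥0∞} {q : ℝ} (hf : MomentBound P f q R)
    (e : α → τ' → τ) : MomentBound P (fun a t ω => f a (e a t) ω) q R := by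
  obtain ⟨K, hK, hKf⟩ := hf
  exact ⟨K, hK, fun a t => hKf a (e a t)⟩

variable [IsProbabilityMeasure P] {T : ℝ}

theorem growth {τ : Type*} {x f : α → τ → Ω → ℝ≥0∞} {b r : ℝ} (hb : 0 < b) (hr : 0 < r)
    {D : ℝ≥0∞} (hD : D ≠ ∞) (hxm : MomentBound P x (b * r) fun _ => 1)
    (hf : ∀ a t ω, f a t ω ≤ D * (1 + x a t ω) ^ b) : MomentBound P f r fun _ => 1 := by
  have h1 : MomentBound P (fun a t ω => 1 + x a t ω) (b * r) fun _ => 1 :=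
    (MomentBound.const _ _).add hxm (by positivity) fun a t => measurable_const
  exact (h1.rpow_one_right rfl).of_le_const_mul hr.le hD
    fun a t => Eventually.of_forall fun ω => hf a t ω

/-- The letters stand for the norms of X (x), F(X) (f), P_I O (po), O − P_I O (dO), X − P_I X (xd),
P_I X (px) and F(X) − F(P_I X) (u). The drift needs r ≥ 2p moments for xd and r ≥ pφ for px, since a
weight to the power φ/2 in L^{2p} is a weight in L^{pφ}. -/
theorem spectral_projection (hT : 0 ≤ T) {x f po dO xd px u : α → Icc (0 : ℝ) T → Ω → ℝ≥0∞}
    {p φ ρ θ r : ℝ} {κ : α → ℝ≥0∞} {J D C : ℝ≥0∞} (hJ : J ≠ ∞) (hD : D ≠ ∞) (hC : C ≠ ∞)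
    (hφ : 0 < φ) (hp : 2 ≤ p) (hpφ : 1 ≤ p * φ) (hr₁ : 2 * p ≤ r) (hr₂ : p * φ ≤ r)
    (hρ : ρ < 1) (hθ : θ < 1)
    (hx : ∀ a t, Measurable (x a t)) (hfm : ∀ a, Measurable (Function.uncurry (f a)))
    (hpom : ∀ a t, Measurable (po a t)) (hdOm : ∀ a t, Measurable (dO a t))
    (hxdm : ∀ a t, Measurable (xd a t)) (hpxm : ∀ a t, Measurable (px a t))
    (hxb : MomentBound P x ((1 + φ / 2) * r) fun _ => 1)
    (hpo : MomentBound P po (p * φ) fun _ => 1) (hdO : MomentBound P dO (2 * p) R)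
    (hf : ∀ a t ω, f a t ω ≤ D * (1 + x a t ω) ^ (1 + φ / 2))
    (hxd : ∀ a (t : Icc (0 : ℝ) T), ∀ᵐ ω ∂P, xd a t ω ≤ dO a t ω
      + J * (κ a * ∫⁻ s in Ioc 0 (t : ℝ), ENNReal.ofReal (((t : ℝ) - s) ^ (-θ))
        * f a (projIcc 0 T hT s) ω))
    (hpx : ∀ a (t : Icc (0 : ℝ) T), ∀ᵐ ω ∂P, px a t ω ≤ po a t ω
      + J * ∫⁻ s in Ioc 0 (t : ℝ), ENNReal.ofReal (((t : ℝ) - s) ^ (-ρ))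
        * f a (projIcc 0 T hT s) ω)
    (hu : ∀ a t ω, u a t ω ≤ C * (xd a t ω * (1 + x a t ω + px a t ω) ^ (φ / 2)))
    (hκ : ∀ a, κ a ≤ R a) : MomentBound P xd (2 * p) R ∧ MomentBound P u p R := by
  have hr0 : 0 < r := by linarith
  have hfm' : ∀ a t, Measurable (f a t) := fun a t => (hfm a).of_uncurry_left
  have hf0 : MomentBound P f r fun _ => 1 := growth (by positivity) hr0 hD hxb hf
  have hf1 := hf0.of_exponent_le (by linarith) hr₁ hfm'
  have hf2 := hf0.of_exponent_le (by linarith) hr₂ hfm'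
  have hk1 := hf1.kernel_integral hT (by linarith) hfm hθ
  have hk2 := hf2.kernel_integral hT hpφ hfm hρ
  have hκ1 := ((hk1.mul_left (R := κ) (by linarith) fun a t =>
    measurable_kernel_integral hT (hfm a) θ t).mono_right (R' := R) (C := 1) (by linarith)
      ENNReal.one_ne_top (by simpa using hκ)).const_mul (by linarith) hJ
  have hxd' : MomentBound P xd (2 * p) R :=
    (hdO.add hκ1 (by linarith) hdOm).of_le (by linarith) hxd
  have hpx' : MomentBound P px (p * φ) fun _ => 1 :=
    (hpo.add (hk2.const_mul (by linarith) hJ) (by linarith) hpom).of_le (by linarith) hpx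
  have hx' : MomentBound P x (p * φ) fun _ => 1 :=
    hxb.of_exponent_le (by linarith) (by nlinarith) hx
  have hw : MomentBound P (fun a t ω => 1 + x a t ω + px a t ω) (p * φ) fun _ => 1 :=
    ((MomentBound.const _ _).add hx' (by linarith) fun a t => measurable_const).add hpx'
      (by linarith) fun a t => measurable_const.add (hx a t)
  have hw' := hw.rpow_one_right (b := φ / 2) (q := 2 * p) (by ring)
  refine ⟨hxd', (hxd'.mul hw' (by linarith) hxdm fun a t => ?_).of_le_const_mul (by linarith) hC
    fun a t => Eventually.of_forall fun ω => hu a t ω⟩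
  exact ((measurable_const.add (hx a t)).add (hpxm a t)).pow_const _

/-- Here yb and ob are the norms of Y and O^{M,I} at the grid point, gg that of the frozen drift, q
its kernel integral up to the grid point, d the noise increment, b the noise approximation error, po
the norm of P_I O. The map e will be rounding down to the grid; η and η' are the rates of the cell
increment and of the truncation. -/
theorem step_scheme (hT : 0 ≤ T) {yb ob gg q d b po : α → Icc (0 : ℝ) T → Ω → ℝ≥0∞}
    {p φ ϑ θ r s : ℝ} {η η' : α → ℝ≥0∞} {D c c' : ℝ≥0∞} (hD : D ≠ ∞) (hc : c ≠ ∞) (hc' : c' ≠ ∞)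
    (hφ : 0 < φ) (hϑ : 0 < ϑ) (hp : 2 ≤ p) (hpφ : 1 ≤ p * φ) (hr₁ : 2 * p ≤ r) (hr₂ : p * φ ≤ r)
    (hs₁ : (1 + φ / 2) * r ≤ s) (hs₂ : ϑ * (2 * p) ≤ s) (hθ : θ < 1)
    (hybm : ∀ a t, Measurable (yb a t)) (hobm : ∀ a t, Measurable (ob a t))
    (hggm : ∀ a, Measurable (Function.uncurry (gg a)))
    (hdm : ∀ a t, Measurable (d a t)) (hbm : ∀ a t, Measurable (b a t))
    (hpom : ∀ a t, Measurable (po a t))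
    (hyb : MomentBound P yb s fun _ => 1) (hob : MomentBound P ob s fun _ => 1)
    (hd : MomentBound P d (2 * p) R) (hb : MomentBound P b (2 * p) R)
    (hpo : MomentBound P po (p * φ) fun _ => 1)
    (hgg : ∀ a t ω, gg a t ω ≤ D * (1 + yb a t ω) ^ (1 + φ / 2)) (e : α → Icc (0 : ℝ) T → Icc (0 : ℝ) T)
    (hq : ∀ a t ω, q a t ω = ∫⁻ s in Ioc 0 (e a t : ℝ),
      ENNReal.ofReal (((e a t : ℝ) - s) ^ (-θ)) * gg a (projIcc 0 T hT s) ω)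
    (hη : ∀ a, η a ≤ c * R a) (hη' : ∀ a, η' a ≤ c' * R a) :
    MomentBound P (fun a t ω => (η a * (q a t ω + gg a t ω) + d a t ω + b a t ω)
        * (1 + (q a t ω + gg a t ω) + po a t ω + yb a t ω) ^ (φ / 2)
      + η' a * ((yb a t ω + ob a t ω) ^ ϑ * (1 + yb a t ω) ^ (1 + φ / 2))) p R := by
  have hr0 : 0 < r := by linarith
  have hs0 : 0 < (1 + φ / 2) * r := by positivity
  have hrs : r ≤ s := by nlinarith
  have hggm' : ∀ a t, Measurable (gg a t) := fun a t => (hggm a).of_uncurry_left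
  have hqm : ∀ a t, Measurable (q a t) := fun a t => by
    have : q a t = _ := funext (hq a t)
    rw [this]
    exact measurable_kernel_integral hT (hggm a) θ _
  have hg0 : MomentBound P gg r fun _ => 1 :=
    growth (by positivity) hr0 hD (hyb.of_exponent_le hs0 hs₁ hybm) hgg
  have hq0 : MomentBound P q r fun _ => 1 :=
    ((hg0.kernel_integral hT (by linarith) hggm hθ).reindex e).of_le hr0.le
      fun a t => Eventually.of_forall fun ω => (hq a t ω).le
  have hQ0 := hq0.add hg0 hr0.le hqm
  have hQm : ∀ a t, Measurable fun ω => q a t ω + gg a t ω := fun a t => (hqm a t).add (hggm' a t)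
  have hQ1 := hQ0.of_exponent_le (by linarith) hr₁ hQm
  have hQ2 := hQ0.of_exponent_le (by linarith) hr₂ hQm
  have hD1 := (((hQ1.mul_left (R := η) (by linarith) hQm).mono_right (R' := R) (by linarith) hc
    hη).add hd (by linarith) fun a t => (hQm a t).const_mul _).add hb (by linarith)
      fun a t => ((hQm a t).const_mul _).add (hdm a t)
  have hW : MomentBound P (fun a t ω => 1 + (q a t ω + gg a t ω) + po a t ω + yb a t ω) (p * φ)
      fun _ => 1 :=
    ((((MomentBound.const _ _).add hQ2 (by linarith) fun a t => measurable_const).add hpo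
      (by linarith) fun a t => measurable_const.add (hQm a t)).add
      (hyb.of_exponent_le (by linarith) (by linarith) hybm) (by linarith)
      fun a t => (measurable_const.add (hQm a t)).add (hpom a t))
  have hW' := hW.rpow_one_right (b := φ / 2) (q := 2 * p) (by ring)
  have hWm : ∀ a t, Measurable fun ω =>
      (1 + (q a t ω + gg a t ω) + po a t ω + yb a t ω) ^ (φ / 2) := fun a t =>
    (((measurable_const.add (hQm a t)).add (hpom a t)).add (hybm a t)).pow_const _
  have hDm : ∀ a t, Measurable fun ω => η a * (q a t ω + gg a t ω) + d a t ω + b a t ω :=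
    fun a t => (((hQm a t).const_mul _).add (hdm a t)).add (hbm a t)
  have h1 := hD1.mul hW' (by linarith) hDm hWm
  have hyo : MomentBound P (fun a t ω => yb a t ω + ob a t ω) (ϑ * (2 * p)) fun _ => 1 :=
    (hyb.add hob (by linarith) hybm).of_exponent_le (by nlinarith) hs₂
      fun a t => (hybm a t).add (hobm a t)
  have hyom : ∀ a t, Measurable fun ω => (yb a t ω + ob a t ω) ^ ϑ := fun a t =>
    ((hybm a t).add (hobm a t)).pow_const _
  have hy1 : MomentBound P (fun a t ω => (1 + yb a t ω) ^ (1 + φ / 2)) (2 * p) fun _ => 1 := by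
    refine ((MomentBound.const _ _).add (hyb.of_exponent_le (r := (1 + φ / 2) * (2 * p))
      (by nlinarith) ?_ hybm) (by nlinarith) fun a t => measurable_const).rpow_one_right rfl
    exact le_trans (by gcongr) hs₁
  have hy1m : ∀ a t, Measurable fun ω => (1 + yb a t ω) ^ (1 + φ / 2) := fun a t =>
    (measurable_const.add (hybm a t)).pow_const _
  have h2 := (((hyo.rpow_one_right rfl).mul hy1 (by linarith) hyom hy1m).mul_left (R := η')
    (by linarith) fun a t => (hyom a t).mul (hy1m a t)).mono_right (R' := R) (by linarith) hc' hη'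
  exact h1.add h2 (by linarith) fun a t => (hDm a t).mul (hWm a t)

/-- Pass to squares in L^{p/2}, where p ≥ 2 makes Jensen applicable, and use the trivial kernel θ =
0. -/
theorem of_sq_le_integral (hT : 0 ≤ T) {u v w : α → Icc (0 : ℝ) T → Ω → ℝ≥0∞} {p : ℝ}
    {C : ℝ≥0∞} (hC : C ≠ ∞) (hp : 2 ≤ p) (hum : ∀ a, Measurable (Function.uncurry (u a)))
    (hvm : ∀ a, Measurable (Function.uncurry (v a))) (hu : MomentBound P u p R)
    (hv : MomentBound P v p R)
    (hw : ∀ a (t : Icc (0 : ℝ) T), ∀ᵐ ω ∂P, w a t ω ^ (2 : ℝ) ≤ C * ∫⁻ s in Ioc 0 (t : ℝ),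
      (u a (projIcc 0 T hT s) ω ^ (2 : ℝ) + v a (projIcc 0 T hT s) ω ^ (2 : ℝ))) :
    MomentBound P w p R := by
  have hp2 : (2 : ℝ) * (p / 2) = p := by ring
  have hu2 : MomentBound P (fun a t ω => u a t ω ^ (2 : ℝ)) (p / 2) fun a => R a ^ (2 : ℝ) :=
    MomentBound.rpow (by rwa [hp2])
  have hv2 : MomentBound P (fun a t ω => v a t ω ^ (2 : ℝ)) (p / 2) fun a => R a ^ (2 : ℝ) :=
    MomentBound.rpow (by rwa [hp2])
  have hs := hu2.add hv2 (by linarith) fun a t => ((hum a).of_uncurry_left.pow_const _)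
  have hk := hs.kernel_integral hT (by linarith)
    (fun a => ((hum a).pow_const _).add ((hvm a).pow_const _)) zero_lt_one
  simp only [neg_zero, Real.rpow_zero, ENNReal.ofReal_one, one_mul] at hk
  have := (hk.of_le_const_mul (by linarith) hC hw).of_rpow
  rwa [hp2] at this

end MomentBound

/-! ### Expectations, measurability on the grid, matching of exponents. -/

theorem ofReal_norm_rpow {E : Type*} [SeminormedAddCommGroup E] (v : E) {q : ℝ} (hq : 0 ≤ q) :
    ENNReal.ofReal (‖v‖ ^ q) = ‖v‖ₑ ^ q := by
  rw [← ofReal_norm, ENNReal.ofReal_rpow_of_nonneg (norm_nonneg _) hq]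

theorem expect_norm_rpow {E Ω : Type*} [SeminormedAddCommGroup E] [MeasurableSpace Ω]
    (P : Measure Ω) (v : Ω → E) {q : ℝ} (hq : 0 ≤ q) :
    expect P (fun ω => ‖v ω‖ ^ q) = ∫⁻ ω, ‖v ω‖ₑ ^ q ∂P := by
  simp only [expect, ofReal_norm_rpow _ hq]

theorem lintegral_enorm_rpow_le_expect {E Ω : Type*} [SeminormedAddCommGroup E]
    [MeasurableSpace Ω] (P : Measure Ω) (v : Ω → E) {q : ℝ} (hq : 0 ≤ q) {f : Ω → ℝ}
    (hf : ∀ ω, ‖v ω‖ ^ q ≤ f ω) : ∫⁻ ω, ‖v ω‖ₑ ^ q ∂P ≤ expect P f := by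
  rw [← expect_norm_rpow P v hq]
  exact lintegral_mono fun ω => ENNReal.ofReal_le_ofReal (hf ω)

theorem measurable_gridFloor (h : ℝ) : Measurable (gridFloor h) := by
  have h1 : Measurable fun t : ℝ => (⌊t / h⌋ : ℤ) := Int.measurable_floor.comp
    (measurable_id.div_const h)
  have h2 : Measurable fun k : ℤ => (k : ℝ) * h := measurable_of_countable _
  exact h2.comp h1

theorem measurable_uncurry_comp_floor {Ω β : Type*} [MeasurableSpace Ω] [MeasurableSpace β]
    {s : Set ℝ} {G : ℤ → Ω → β} (hG : ∀ k, Measurable (G k)) (h : ℝ) :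
    Measurable (Function.uncurry fun (t : s) ω => G ⌊(t : ℝ) / h⌋ ω) := by
  have h1 : Measurable fun z : ℤ × Ω => G z.1 z.2 :=
    measurable_from_prod_countable_right fun k => hG k
  have h2 : Measurable fun z : s × Ω => ((⌊(z.1 : ℝ) / h⌋ : ℤ), z.2) :=
    (Int.measurable_floor.comp ((measurable_subtype_coe.comp measurable_fst).div_const h)).prodMk
      measurable_snd
  exact h1.comp h2

theorem coe_projIcc_gridFloor {T h t : ℝ} (hT : 0 ≤ T) (hh : 0 < h) (ht : t ∈ Icc 0 T) :
    (projIcc 0 T hT (gridFloor h t) : ℝ) = gridFloor h t :=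
  congrArg Subtype.val (projIcc_of_mem hT ⟨gridFloor_nonneg hh ht.1, (gridFloor_le hh t).trans ht.2⟩)

theorem ofReal_intervalIntegral_le {a : ℝ → ℝ} {t : ℝ} (ht : 0 ≤ t) :
    ENNReal.ofReal (∫ s in (0 : ℝ)..t, a s) ≤ ∫⁻ s in Ioc 0 t, ‖a s‖ₑ := by
  rw [intervalIntegral.integral_of_le ht]
  refine le_trans ?_ (enorm_integral_le_lintegral_enorm _)
  rw [← ofReal_norm]
  exact ENNReal.ofReal_le_ofReal (le_abs_self _)

/-- The moments of Y obtained in (i) are those required of Y in the step estimate, whose drift needs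
p·max(2, φ) moments. -/
theorem one_add_half_mul_max_le {p φ ϑ : ℝ} (hp : 0 ≤ p) (hφ : 0 < φ) :
    (1 + φ / 2) * (p * max 2 φ)
      ≤ 2 * (p * max (2 * ϑ) (max (2 + φ) ((1 + φ / 2) * (φ / 2)))) := by
  have h1 : (1 + φ / 2) * max 2 φ
      ≤ 2 * max (2 * ϑ) (max (2 + φ) ((1 + φ / 2) * (φ / 2))) := by
    rw [mul_max_of_nonneg _ _ (by positivity)]
    refine max_le ?_ ?_
    · have : 2 + φ ≤ max (2 * ϑ) (max (2 + φ) ((1 + φ / 2) * (φ / 2))) :=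
        (le_max_left _ _).trans (le_max_right _ _)
      linarith
    · have : (1 + φ / 2) * (φ / 2) ≤ max (2 * ϑ) (max (2 + φ) ((1 + φ / 2) * (φ / 2))) :=
        (le_max_right _ _).trans (le_max_right _ _)
      linarith
  nlinarith [mul_le_mul_of_nonneg_left h1 hp]

theorem two_mul_mul_max_eq {p φ ϑ : ℝ} :
    2 * (p * max (2 * ϑ) (max (2 + φ) ((1 + φ / 2) * (φ / 2))))
      = p * max (4 * ϑ) (max (4 + 2 * φ) (φ * (1 + φ / 2))) := by
  have h : 2 * max (2 * ϑ) (max (2 + φ) ((1 + φ / 2) * (φ / 2)))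
      = max (4 * ϑ) (max (4 + 2 * φ) (φ * (1 + φ / 2))) := by
    rw [mul_max_of_nonneg _ _ (by norm_num), mul_max_of_nonneg _ _ (by norm_num)]
    congr 1
    · ring
    · congr 1 <;> ring
  rw [← h]; ring

theorem ofReal_step_rpow_le {T m x y : ℝ} (hT : 0 < T) (hm : 1 ≤ m) (hxy : x ≤ y) :
    ENNReal.ofReal ((T / m) ^ y) ≤ ENNReal.ofReal (T ^ y) * ENNReal.ofReal (m ^ (-x)) := by
  rw [← ENNReal.ofReal_mul (by positivity)]
  refine ENNReal.ofReal_le_ofReal ?_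
  rw [Real.div_rpow hT.le (by linarith), div_eq_mul_inv, ← Real.rpow_neg (by linarith)]
  gcongr

namespace MomentBound

variable {α τ Ω : Type*} [MeasurableSpace Ω] {P : Measure Ω}

theorem of_lintegral_le {f : α → τ → Ω → ℝ≥0∞} {q : ℝ} {K : ℝ≥0∞} (hK : K ≠ ∞)
    (h : ∀ a t, ∫⁻ ω, f a t ω ^ q ∂P ≤ K) : MomentBound P f q fun _ => 1 :=
  ⟨K, hK, fun a t => by simpa using h a t⟩

theorem of_rpow_inv_le {f : α → τ → Ω → ℝ≥0∞} {q : ℝ} (hq : 0 < q) {R : α → ℝ≥0∞}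
    {E : α → τ → ℝ≥0∞} (hE : ∀ a t, E a t ^ (1 / q) ≤ R a)
    (h : ∀ a t, ∫⁻ ω, f a t ω ^ q ∂P ≤ E a t) : MomentBound P f q R := by
  refine ⟨1, ENNReal.one_ne_top, fun a t => ?_⟩
  rw [one_mul]
  refine (h a t).trans ?_
  calc E a t = (E a t ^ (1 / q)) ^ q := by
        rw [← ENNReal.rpow_mul, one_div_mul_cancel hq.ne', ENNReal.rpow_one]
    _ ≤ _ := ENNReal.rpow_le_rpow (hE a t) hq.le

theorem exists_rpow_inv_le {f : α → τ → Ω → ℝ≥0∞} {q : ℝ} (hq : 0 < q) {R : α → ℝ≥0∞}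
    (hf : MomentBound P f q R) :
    ∃ C : ℝ, 0 < C ∧ ∀ a t, (∫⁻ ω, f a t ω ^ q ∂P) ^ (1 / q) ≤ ENNReal.ofReal C * R a := by
  obtain ⟨K, hK, hKf⟩ := hf
  have hq' : 0 ≤ 1 / q := by positivity
  have hK' : K ^ (1 / q) ≠ ∞ := ENNReal.rpow_ne_top_of_nonneg hq' hK
  refine ⟨(K ^ (1 / q)).toReal + 1, by positivity, fun a t => ?_⟩
  calc (∫⁻ ω, f a t ω ^ q ∂P) ^ (1 / q) ≤ (K * R a ^ q) ^ (1 / q) :=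
        ENNReal.rpow_le_rpow (hKf a t) hq'
    _ = K ^ (1 / q) * R a := by
        rw [ENNReal.mul_rpow_of_nonneg _ _ hq', ← ENNReal.rpow_mul, mul_one_div_cancel hq.ne',
          ENNReal.rpow_one]
    _ ≤ _ := by
        gcongr
        rw [ENNReal.ofReal_add ENNReal.toReal_nonneg zero_le_one, ENNReal.ofReal_toReal hK']
        exact le_self_add

end MomentBound

/-! ### From the almost sure equations to pathwise mode identities. -/

theorem ae_forall_inner_eq_expConv {ι H V Ω : Type*} [NormedAddCommGroup H]
    [InnerProductSpace ℝ H] [CompleteSpace H] [TopologicalSpace.SeparableSpace H]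
    [NormedAddCommGroup V] [NormedSpace ℝ V] (A : DiagNegOp ι H) {T : ℝ} (hT : 0 ≤ T)
    (iV : V →L[ℝ] H) {F : V → H} (hF : Continuous F) [MeasurableSpace Ω] {P : Measure Ω}
    {X O : Ω → C(Icc (0 : ℝ) T, V)}
    (hXeq : ∀ t : Icc (0 : ℝ) T, ∀ᵐ ω ∂P,
      iV (X ω t) = (∫ s in (0 : ℝ)..t, A.semigroup (t - s) (F (X ω (projIcc 0 T hT s))))
        + iV (O ω t)) :
    ∀ᵐ ω ∂P, ∀ (t : Icc (0 : ℝ) T) i, inner ℝ (A.basis i) (iV (X ω t))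
      = expConv (A.eig i) (fun s => inner ℝ (A.basis i) (F (X ω (projIcc 0 T hT s)))) t
        + inner ℝ (A.basis i) (iV (O ω t)) := by
  -- The exceptional null set depends on t. Countably many times share one, and continuity of each
  -- coordinate extends the identity to all times.
  obtain ⟨S, hSc, hSd⟩ := TopologicalSpace.exists_countable_dense (Icc (0 : ℝ) T)
  filter_upwards [(ae_ball_iff hSc).2 fun t _ => hXeq t] with ω hω t i
  have hx : Continuous fun s => X ω (projIcc 0 T hT s) := (X ω).continuous.comp continuous_projIcc
  have ho : Continuous fun s => O ω (projIcc 0 T hT s) := (O ω).continuous.comp continuous_projIcc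
  have hf : RightRegular fun s => F (X ω (projIcc 0 T hT s)) :=
    RightRegular.of_continuous (hF.comp hx)
  have h := A.forall_expConv_eq_of_dense iV hx ho hf (Subtype.dense_iff.1 hSd)
    (by rintro _ ⟨s, -, rfl⟩; exact s.2)
    (by
      rintro _ ⟨s, hs, rfl⟩
      simpa only [projIcc_val] using hω s hs) t t.2 i
  simpa only [projIcc_val] using h

/-! ### The scheme as a mode sum, and its moments. -/

namespace DiagNegOp

variable {ι H V Ω : Type*} [NormedAddCommGroup H] [InnerProductSpace ℝ H]
  [NormedAddCommGroup V] [NormedSpace ℝ V] [MeasurableSpace Ω] {P : Measure Ω}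

theorem ae_eq_modeConv_of_scheme [CompleteSpace H] [TopologicalSpace.SeparableSpace H]
    (A : DiagNegOp ι H) {T h κ ρ γ : ℝ} (hT : 0 < T) (hh : 0 < h) (hργ : ρ ≤ γ) (hγ : γ ≤ 1)
    (jV : A.Interp ρ →L[ℝ] V) {F : V → H} (I : Finset ι) {Y : Icc (0 : ℝ) T → Ω → A.Interp γ}
    {Z : Ω → C(Icc (0 : ℝ) T, A.Interp 1)} {g : Ω → ℤ → H}
    (hg : ∀ ω (k : ℤ), g ω k = if ‖Y (projIcc 0 T hT.le (k * h)) ω‖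
        + ‖A.incl hγ (Z ω (projIcc 0 T hT.le (k * h)))‖ ≤ κ
      then F (jV (A.incl hργ (Y (projIcc 0 T hT.le (k * h)) ω))) else 0)
    {t : Icc (0 : ℝ) T} (hY : ∀ᵐ ω ∂P, (Y t ω).toH =
      (∫ s in (0 : ℝ)..t, if ‖Y (projIcc 0 T hT.le (gridFloor h s)) ω‖
          + ‖A.incl hγ (Z ω (projIcc 0 T hT.le (gridFloor h s)))‖ ≤ κ
        then A.proj I (A.semigroup (t - s)
          (F (jV (A.incl hργ (Y (projIcc 0 T hT.le (gridFloor h s)) ω)))))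
        else 0) + (Z ω t).toH) :
    ∀ᵐ ω ∂P, (Y t ω).toH = A.modeConv I (fun q => g ω ⌊q / h⌋) t + (Z ω t).toH := by
  filter_upwards [hY] with ω hω
  rw [hω, ← A.integral_proj_semigroup_eq_modeConv (RightRegular.comp_floor (g ω) hh) t.2.1]
  congr 1
  refine intervalIntegral.integral_congr fun s _ => ?_
  -- Grid rounding is by definition ⌊s/h⌋·h, so the drift g, indexed by the cell, already contains
  -- the truncation indicator.
  have hgs : g ω ⌊s / h⌋ = if ‖Y (projIcc 0 T hT.le (gridFloor h s)) ω‖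
        + ‖A.incl hγ (Z ω (projIcc 0 T hT.le (gridFloor h s)))‖ ≤ κ
      then F (jV (A.incl hργ (Y (projIcc 0 T hT.le (gridFloor h s)) ω))) else 0 := hg ω ⌊s / h⌋
  rw [hgs]
  split_ifs with hs
  · rfl
  · rw [map_zero, map_zero]

/-- Only countably many grid times enter, so one null set serves them all and no path regularity of
Y is needed. -/
theorem ae_forall_gridFloor_eq_modeConv (A : DiagNegOp ι H) {T h γ : ℝ} (hT : 0 ≤ T) (hh : 0 < h)
    {I : Finset ι} {Y : Icc (0 : ℝ) T → Ω → A.Interp γ}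
    {Z : Ω → C(Icc (0 : ℝ) T, A.Interp 1)} {g : Ω → ℤ → H}
    (hY : ∀ t : Icc (0 : ℝ) T, ∀ᵐ ω ∂P,
      (Y t ω).toH = A.modeConv I (fun q => g ω ⌊q / h⌋) t + (Z ω t).toH) :
    ∀ᵐ ω ∂P, ∀ t ∈ Icc 0 T, (Y (projIcc 0 T hT (gridFloor h t)) ω).toH
      = A.modeConv I (fun q => g ω ⌊q / h⌋) (gridFloor h t)
        + (Z ω (projIcc 0 T hT (gridFloor h t))).toH := by
  have hk : ∀ᵐ ω ∂P, ∀ k : ℤ, (Y (projIcc 0 T hT (k * h)) ω).toH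
      = A.modeConv I (fun q => g ω ⌊q / h⌋) (projIcc 0 T hT (k * h))
        + (Z ω (projIcc 0 T hT (k * h))).toH := ae_all_iff.2 fun k => hY _
  filter_upwards [hk] with ω hω t ht
  have h1 : (Y (projIcc 0 T hT (gridFloor h t)) ω).toH
      = A.modeConv I (fun q => g ω ⌊q / h⌋) (projIcc 0 T hT (gridFloor h t))
        + (Z ω (projIcc 0 T hT (gridFloor h t))).toH := hω ⌊t / h⌋
  rwa [coe_projIcc_gridFloor hT hh ht] at h1

theorem norm_sq_le_of_toH_eq (A : DiagNegOp ι H) {γ E K S a : ℝ} (hγ : γ ≤ 1 / 2) (hγ1 : γ ≤ 1)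
    (hE : ∀ v : A.Interp (1 / 2), ‖A.incl hγ v‖ ≤ E * ‖v‖) {I : Finset ι} {m : H}
    (hm : A.proj I m = m) {y : A.Interp γ} {z : A.Interp 1} (hy : y.toH = m + z.toH)
    (hK : 0 ≤ K) (ha : 0 ≤ a) (hw : ‖A.projTo I (1 / 2) m‖ ^ 2 ≤ K * (1 + a))
    (hS : ‖A.incl hγ1 z‖ ^ 2 + a = S) : ‖y‖ ^ 2 ≤ (2 * E ^ 2 * K + 2) * (1 + S) := by
  have hyw : y = A.incl hγ (A.projTo I (1 / 2) m) + A.incl hγ1 z := by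
    apply Interp.ext_toH
    rw [Interp.toH_add, toH_incl, toH_incl, toH_projTo, hm, hy]
  have h1 : ‖y‖ ≤ E * ‖A.projTo I (1 / 2) m‖ + ‖A.incl hγ1 z‖ := by
    rw [hyw]
    exact (norm_add_le _ _).trans (by gcongr; exact hE _)
  have h2 : ‖y‖ ^ 2 ≤ (E * ‖A.projTo I (1 / 2) m‖ + ‖A.incl hγ1 z‖) ^ 2 := by gcongr
  have h3 : E ^ 2 * ‖A.projTo I (1 / 2) m‖ ^ 2 ≤ E ^ 2 * (K * (1 + a)) := by gcongr
  have h4 : 0 ≤ E ^ 2 * K * ‖A.incl hγ1 z‖ ^ 2 := by positivity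
  subst hS
  nlinarith [sq_nonneg (E * ‖A.projTo I (1 / 2) m‖ - ‖A.incl hγ1 z‖)]

/-- Almost surely at each fixed time, ‖Y‖² is at most a constant times 1 + S with S =
‖O^{M,I}‖²_{H_γ} + Φ + ϕ, using H_{1/2} ⊆ H_γ. The bound is quadratic on the left, so q moments of S
give 2q moments of Y. -/
theorem momentBound_scheme [IsProbabilityMeasure P] {α : Type*} (A : DiagNegOp ι H)
    {T c φ ε ρ γ χ : ℝ} (hT : 0 < T)
    (hc : 0 < c) (hφ : 0 < φ) (hε : ε < 1) (hρ : 0 ≤ ρ) (hργ : ρ ≤ γ) (hγ : γ ≤ 1 / 2)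
    (hγ1 : γ ≤ 1) (hρ1 : ρ ≤ 1) (hh1 : (1 / 2 : ℝ) ≤ 1)
    (hχ₁ : χ * (1 + φ / 2) ≤ γ - ρ) (hχ₂ : χ * (1 + φ) ≤ 1 - ρ) (jV : A.Interp ρ →L[ℝ] V)
    {F : V → H} {C D : ℝ} (hC : 0 < C) (hD : 0 < D)
    (hF : ∀ v w : V, ‖F v - F w‖ ≤ C * ‖v - w‖ * (1 + ‖v‖ + ‖w‖) ^ (φ / 2))
    (hF' : ∀ v : V, ‖F v‖ ≤ D * (1 + ‖v‖) ^ (1 + φ / 2))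
    {phi Phi : C(Icc (0 : ℝ) T, A.Interp 1) → ℝ} (hphi : ∀ x, 0 ≤ phi x) (hPhi : ∀ x, 0 ≤ Phi x)
    (hcoer : ∀ (I : Finset ι) (v : A.Interp 1), v.toH ∈ range (A.proj I) →
      ∀ (x : C(Icc (0 : ℝ) T, A.Interp 1)) (t : Icc (0 : ℝ) T),
      inner ℝ (A.incl hh1 v : A.Interp (1 / 2))
          (A.projTo I (1 / 2) (F (jV (A.incl hρ1 (v + x t)))))
        + phi x * inner ℝ v.toH (F (jV (A.incl hρ1 (v + x t))))
        ≤ ε * ‖v‖ ^ 2 + (c + phi x) * ‖(A.incl hh1 v : A.Interp (1 / 2))‖ ^ 2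
          + c * phi x * ‖v.toH‖ ^ 2 + Phi x)
    {h : α → ℝ} (hh : ∀ a, 0 < h a) (hhT : ∀ a, h a ≤ T) {I : α → Finset ι}
    {Y : α → Icc (0 : ℝ) T → Ω → A.Interp γ} {Z : α → Ω → C(Icc (0 : ℝ) T, A.Interp 1)}
    {g : α → Ω → ℤ → H} (hZI : ∀ a ω t, (Z a ω t).toH ∈ range (A.proj (I a)))
    (hg : ∀ a ω (k : ℤ), g a ω k = if ‖Y a (projIcc 0 T hT.le (k * h a)) ω‖
        + ‖A.incl hγ1 (Z a ω (projIcc 0 T hT.le (k * h a)))‖ ≤ (1 / h a) ^ χ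
      then F (jV (A.incl hργ (Y a (projIcc 0 T hT.le (k * h a)) ω))) else 0)
    (hY : ∀ a (t : Icc (0 : ℝ) T), ∀ᵐ ω ∂P, (Y a t ω).toH
      = A.modeConv (I a) (fun q => g a ω ⌊q / h a⌋) t + (Z a ω t).toH)
    {q : ℝ} (hq : 0 ≤ q)
    (hS : MomentBound P (fun a (t : Icc (0 : ℝ) T) ω => ENNReal.ofReal
      |‖A.incl hγ1 (Z a ω t)‖ ^ 2 + Phi (Z a ω) + phi (Z a ω)|) q fun _ => 1) :
    MomentBound P (fun a t ω => ‖Y a t ω‖ₑ) (2 * q) (fun _ => 1)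
      ∧ MomentBound P (fun a (t : Icc (0 : ℝ) T) ω => ‖A.incl hγ1 (Z a ω t)‖ₑ) (2 * q)
        fun _ => 1 := by
  obtain ⟨K, hK, hKw⟩ := exists_norm_sq_scheme_le A hT hc hφ hε hρ hργ hγ1 hρ1 hh1 hχ₁ hχ₂ jV hC
    hD hF hF' hphi hPhi hcoer
  obtain ⟨E, -, hE⟩ := A.exists_norm_incl_le hγ
  have key : ∀ {f : α → Icc (0 : ℝ) T → Ω → ℝ≥0∞} {L : ℝ}, 0 ≤ L →
      (∀ a t, ∀ᵐ ω ∂P, f a t ω ^ (2 : ℝ) ≤ ENNReal.ofReal (L *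
        (1 + (‖A.incl hγ1 (Z a ω t)‖ ^ 2 + Phi (Z a ω) + phi (Z a ω))))) →
      MomentBound P f (2 * q) fun _ => 1 := by
    intro f L hL hf
    have h1 := ((MomentBound.const q _).add hS hq fun a t =>
      measurable_const).of_le_const_mul (g := fun a t ω => f a t ω ^ (2 : ℝ)) hq
      (ENNReal.ofReal_ne_top (r := L)) fun a t => by
        filter_upwards [hf a t] with ω hω
        refine hω.trans ?_
        rw [ENNReal.ofReal_mul hL]
        gcongr
        refine ENNReal.ofReal_add_le.trans ?_
        rw [ENNReal.ofReal_one]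
        gcongr
        exact le_abs_self _
    refine MomentBound.of_rpow (b := 2) ?_
    simpa only [ENNReal.one_rpow] using h1
  constructor
  · refine key (L := 2 * E ^ 2 * K + 2) (by positivity) fun a t => ?_
    filter_upwards [hY a t, A.ae_forall_gridFloor_eq_modeConv hT.le (hh a) (hY a)] with ω hω hgrid
    have hw := hKw (I a) (h a) (hh a) (hhT a) (g a ω) (Z a ω)
      (fun k => Y a (projIcc 0 T hT.le (k * h a)) ω) (hZI a ω)
      (fun s => hg a ω ⌊s / h a⌋) hgrid t t.2
    rw [← ofReal_norm_rpow _ zero_le_two, Real.rpow_two]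
    refine ENNReal.ofReal_le_ofReal ?_
    refine A.norm_sq_le_of_toH_eq hγ hγ1 hE (A.proj_modeConv _ _ _) hω hK
      (add_nonneg (hPhi (Z a ω)) (hphi (Z a ω))) ?_ (by ring)
    rwa [← add_assoc]
  · refine key (L := 1) zero_le_one fun a t => Eventually.of_forall fun ω => ?_
    rw [← ofReal_norm_rpow _ zero_le_two, Real.rpow_two]
    refine ENNReal.ofReal_le_ofReal ?_
    linarith [hPhi (Z a ω), hphi (Z a ω)]

end DiagNegOp

theorem measurable_uncurry_paths {Ω E : Type*} [MeasurableSpace Ω] [NormedAddCommGroup E]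
    [MeasurableSpace E] [BorelSpace E] {T : ℝ} {X : Ω → C(Icc (0 : ℝ) T, E)}
    (hX : ∀ t, Measurable fun ω => X ω t) : Measurable (Function.uncurry fun t ω => X ω t) :=
  measurable_uncurry_of_continuous_of_measurable (fun ω => (X ω).continuous) hX

/-! ### Moments of the two drift perturbations. -/

namespace DiagNegOp

variable {ι H V : Type*} [NormedAddCommGroup H] [InnerProductSpace ℝ H]
  [NormedAddCommGroup V] [NormedSpace ℝ V]

theorem continuous_projTo_comp (A : DiagNegOp ι H) {ρ : ℝ} (jV : A.Interp ρ →L[ℝ] V)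
    (iV : V →L[ℝ] H) (I : Finset ι) : Continuous fun v => jV (A.projTo I ρ (iV v)) :=
  ((jV.comp (A.projToL I ρ)).comp iV).continuous.congr fun v => by simp

theorem exists_norm_comp_incl_le (A : DiagNegOp ι H) {φ ρ γ D : ℝ} (hφ : 0 < φ) (hργ : ρ ≤ γ)
    (jV : A.Interp ρ →L[ℝ] V) {F : V → H} (hD : 0 ≤ D)
    (hF' : ∀ v : V, ‖F v‖ ≤ D * (1 + ‖v‖) ^ (1 + φ / 2)) :
    ∃ L : ℝ, 0 ≤ L ∧ ∀ y : A.Interp γ,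
      ‖F (jV (A.incl hργ y))‖ ≤ D * (1 + L) ^ (1 + φ / 2) * (1 + ‖y‖) ^ (1 + φ / 2) := by
  obtain ⟨E, hE, hEy⟩ := A.exists_norm_incl_le hργ
  refine ⟨‖jV‖ * E, by positivity, fun y => (hF' _).trans ?_⟩
  rw [mul_assoc, ← Real.mul_rpow (by positivity) (by positivity)]
  gcongr
  have h1 : ‖jV (A.incl hργ y)‖ ≤ ‖jV‖ * E * ‖y‖ := by
    rw [mul_assoc]
    exact (jV.le_opNorm _).trans (by gcongr; exact hEy y)
  have h2 : 0 ≤ ‖jV‖ * E := by positivity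
  nlinarith [norm_nonneg y]

variable {Ω : Type*} [CompleteSpace H] [MeasurableSpace V] [BorelSpace V] [MeasurableSpace Ω] {P : Measure Ω} [IsProbabilityMeasure P]
  {α : Type*} {R : α → ℝ≥0∞}

theorem momentBound_exact (A : DiagNegOp ι H) {T φ ρ p ϱ C D : ℝ} (hT : 0 ≤ T)
    (hφ : 0 < φ) (hρ : 0 ≤ ρ) (hρ1 : ρ < 1) (hϱ : 0 ≤ ϱ) (hρϱ : ρ + ϱ < 1) (hp : 2 ≤ p)
    (hpφ : 1 ≤ p * φ)
    (jV : A.Interp ρ →L[ℝ] V) (iV : V →L[ℝ] H) (hiV : Function.Injective iV)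
    (hji : ∀ v : A.Interp ρ, iV (jV v) = v.toH) {F : V → H} (hFc : Continuous F)
    (hC : 0 < C) (hD : 0 < D)
    (hF : ∀ v w : V, ‖F v - F w‖ ≤ C * ‖v - w‖ * (1 + ‖v‖ + ‖w‖) ^ (φ / 2))
    (hF' : ∀ v : V, ‖F v‖ ≤ D * (1 + ‖v‖) ^ (1 + φ / 2))
    {X O : Ω → C(Icc (0 : ℝ) T, V)} (hX : ∀ t, Measurable fun ω => X ω t)
    (hO : ∀ t, Measurable fun ω => O ω t)
    (hXO : ∀ᵐ ω ∂P, ∀ (t : Icc (0 : ℝ) T) i, inner ℝ (A.basis i) (iV (X ω t))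
      = expConv (A.eig i) (fun s => inner ℝ (A.basis i) (F (X ω (projIcc 0 T hT s)))) t
        + inner ℝ (A.basis i) (iV (O ω t)))
    {I : α → Finset ι}
    (hXb : MomentBound P (fun (_ : α) (t : Icc (0 : ℝ) T) ω => ‖X ω t‖ₑ)
      ((1 + φ / 2) * (p * max 2 φ)) fun _ => 1)
    (hpo : MomentBound P (fun a (t : Icc (0 : ℝ) T) ω => ‖jV (A.projTo (I a) ρ (iV (O ω t)))‖ₑ)
      (p * φ) fun _ => 1)
    (hdO : MomentBound P (fun a (t : Icc (0 : ℝ) T) ω =>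
      ‖O ω t - jV (A.projTo (I a) ρ (iV (O ω t)))‖ₑ) (2 * p) R)
    (hR : ∀ a, ENNReal.ofReal
      ‖(A.negFracPow ϱ).comp (ContinuousLinearMap.id ℝ H - A.proj (I a))‖ ≤ R a) :
    MomentBound P (fun a (t : Icc (0 : ℝ) T) ω =>
        ‖X ω t - jV (A.projTo (I a) ρ (iV (X ω t)))‖ₑ) (2 * p) R
      ∧ MomentBound P (fun a (t : Icc (0 : ℝ) T) ω =>
        ‖F (X ω t) - F (jV (A.projTo (I a) ρ (iV (X ω t))))‖ₑ) p R := by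
  have hpr : ∀ a, Continuous fun v => jV (A.projTo (I a) ρ (iV v)) :=
    fun a => A.continuous_projTo_comp jV iV (I a)
  have hreg : ∀ ω, RightRegular fun s => F (X ω (projIcc 0 T hT s)) := fun ω =>
    RightRegular.of_continuous (hFc.comp ((X ω).continuous.comp continuous_projIcc))
  refine MomentBound.spectral_projection hT
    (x := fun _ t ω => ‖X ω t‖ₑ) (f := fun _ t ω => ‖F (X ω t)‖ₑ)
    (px := fun a t ω => ‖jV (A.projTo (I a) ρ (iV (X ω t)))‖ₑ) (r := p * max 2 φ)
    (κ := fun a => ENNReal.ofReal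
      ‖(A.negFracPow ϱ).comp (ContinuousLinearMap.id ℝ H - A.proj (I a))‖)
    (J := ‖jV‖ₑ) (D := ENNReal.ofReal D) (C := ENNReal.ofReal C) (θ := ρ + ϱ) (ρ := ρ)
    enorm_ne_top ENNReal.ofReal_ne_top ENNReal.ofReal_ne_top hφ hp hpφ ?_ ?_ hρ1 hρϱ
    (fun _ t => (hX t).enorm) (fun _ => ?_) (fun a t => ?_) (fun a t => ?_) (fun a t => ?_)
    (fun a t => ?_) hXb hpo hdO
    (fun a t ω => enorm_le_of_norm_le_rpow hD.le (by positivity) hF' _)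
    (fun a t => ?_) (fun a t => ?_)
    (fun a t ω => enorm_sub_le_of_norm_sub_le hC.le (by positivity) hF _ _) hR
  · nlinarith [le_max_left 2 φ]
  · nlinarith [le_max_right 2 φ]
  · exact (hFc.enorm.measurable).comp (measurable_uncurry_paths hX)
  · exact (hpr a).enorm.measurable.comp (hO t)
  · exact (continuous_id.sub (hpr a)).enorm.measurable.comp (hO t)
  · exact (continuous_id.sub (hpr a)).enorm.measurable.comp (hX t)
  · exact (hpr a).enorm.measurable.comp (hX t)
  · filter_upwards [hXO] with ω hω
    exact A.enorm_sub_proj_le_of_expConv jV iV hρ hϱ hρϱ hiV hji (hreg ω) t.2.1 (hω t) (I a)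
  · filter_upwards [hXO] with ω hω
    exact A.enorm_proj_le_of_expConv jV iV hρ hρ1.le (hreg ω) t.2.1 (hω t) (I a)

/-- A jointly measurable majorant v is produced, because Tonelli is going to be applied to v and not
to the drift difference itself. -/
theorem exists_momentBound_step [SecondCountableTopology V] (A : DiagNegOp ι H) {T φ ρ γ χ p ϑ ϱ s C D : ℝ} (hT : 0 < T)
    (hφ : 0 < φ) (hρ : 0 ≤ ρ) (hργ : ρ ≤ γ) (hγ : γ ≤ 1) (hρ1 : ρ ≤ 1) (hϑ : 0 < ϑ) (hϱ : 0 ≤ ϱ)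
    (hρϱ : ρ + ϱ < 1) (hp : 2 ≤ p) (hpφ : 1 ≤ p * φ)
    (hs₁ : (1 + φ / 2) * (p * max 2 φ) ≤ s) (hs₂ : ϑ * (2 * p) ≤ s)
    (jV : A.Interp ρ →L[ℝ] V) (iV : V →L[ℝ] H) {F : V → H} (hFc : Continuous F)
    (hC : 0 < C) (hD : 0 < D)
    (hF : ∀ v w : V, ‖F v - F w‖ ≤ C * ‖v - w‖ * (1 + ‖v‖ + ‖w‖) ^ (φ / 2))
    (hF' : ∀ v : V, ‖F v‖ ≤ D * (1 + ‖v‖) ^ (1 + φ / 2))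
    {O : Ω → C(Icc (0 : ℝ) T, V)} (hO : ∀ t, Measurable fun ω => O ω t)
    {h : α → ℝ} (hh : ∀ a, 0 < h a) (hhT : ∀ a, h a ≤ T) {I : α → Finset ι}
    {Y : α → Icc (0 : ℝ) T → Ω → A.Interp γ} {Z : α → Ω → C(Icc (0 : ℝ) T, A.Interp 1)}
    {g : α → Ω → ℤ → H} (hYm : ∀ a t, Measurable (Y a t))
    (hZm : ∀ a t, Measurable fun ω => Z a ω t)
    (hg : ∀ a ω (k : ℤ), g a ω k = if ‖Y a (projIcc 0 T hT.le (k * h a)) ω‖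
        + ‖A.incl hγ (Z a ω (projIcc 0 T hT.le (k * h a)))‖ ≤ (1 / h a) ^ χ
      then F (jV (A.incl hργ (Y a (projIcc 0 T hT.le (k * h a)) ω))) else 0)
    (hY : ∀ a (t : Icc (0 : ℝ) T), ∀ᵐ ω ∂P, (Y a t ω).toH
      = A.modeConv (I a) (fun q => g a ω ⌊q / h a⌋) t + (Z a ω t).toH)
    (hYb : MomentBound P (fun a t ω => ‖Y a t ω‖ₑ) s fun _ => 1)
    (hZb : MomentBound P (fun a (t : Icc (0 : ℝ) T) ω => ‖A.incl hγ (Z a ω t)‖ₑ) s fun _ => 1)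
    (hpo : MomentBound P (fun a (t : Icc (0 : ℝ) T) ω => ‖jV (A.projTo (I a) ρ (iV (O ω t)))‖ₑ)
      (p * φ) fun _ => 1)
    (hd : MomentBound P (fun a (t : Icc (0 : ℝ) T) ω => ‖jV (A.projTo (I a) ρ
      (iV (O ω t - O ω (projIcc 0 T hT.le (gridFloor (h a) t)))))‖ₑ) (2 * p) R)
    (hb : MomentBound P (fun a (t : Icc (0 : ℝ) T) ω =>
      ‖jV (A.projTo (I a) ρ (iV (O ω t))) - jV (A.incl hρ1 (Z a ω t))‖ₑ) (2 * p) R)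
    {c c' : ℝ≥0∞} (hc : c ≠ ∞) (hc' : c' ≠ ∞)
    (hη : ∀ a, ENNReal.ofReal (h a ^ ϱ) ≤ c * R a)
    (hη' : ∀ a, ENNReal.ofReal (h a ^ (χ * ϑ)) ≤ c' * R a) :
    ∃ v : α → Icc (0 : ℝ) T → Ω → ℝ≥0∞, MomentBound P v p R
      ∧ (∀ a, Measurable (Function.uncurry (v a)))
      ∧ ∀ a, ∀ᵐ ω ∂P, ∀ t : Icc (0 : ℝ) T,
        ‖F (jV (A.projTo (I a) ρ (A.modeConv (I a) (fun q => g a ω ⌊q / h a⌋) t + iV (O ω t))))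
          - g a ω ⌊(t : ℝ) / h a⌋‖ₑ ≤ v a t ω := by
  obtain ⟨K, hK, hKv⟩ := exists_enorm_nonlinearity_sub_step_le A (χ := χ) hT hφ hρ hργ hγ hρ1 hϑ
    hϱ hρϱ.le jV iV hC hD hF hF'
  obtain ⟨L, hL, hL'⟩ := A.exists_norm_comp_incl_le hφ hργ jV hD.le hF'
  have hpr : ∀ a, Continuous fun v => jV (A.projTo (I a) ρ (iV v)) :=
    fun a => A.continuous_projTo_comp jV iV (I a)
  have hincl : ∀ {r : ℝ} (hr : r ≤ 1), Continuous (A.incl hr) := fun hr =>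
    (A.inclL hr).continuous.congr fun v => by simp
  have hinclγ : Continuous (A.incl hργ) := (A.inclL hργ).continuous.congr fun v => by simp
  let e : α → Icc (0 : ℝ) T → Icc (0 : ℝ) T := fun a t => projIcc 0 T hT.le (gridFloor (h a) t)
  have hem : ∀ a, Measurable (e a) := fun a =>
    continuous_projIcc.measurable.comp ((measurable_gridFloor (h a)).comp measurable_subtype_coe)
  have hgm : ∀ a k, Measurable fun ω => ‖g a ω k‖ₑ := by
    intro a k
    have h1 : (fun ω => ‖g a ω k‖ₑ) = fun ω => if ‖Y a (projIcc 0 T hT.le (k * h a)) ω‖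
        + ‖A.incl hγ (Z a ω (projIcc 0 T hT.le (k * h a)))‖ ≤ (1 / h a) ^ χ
      then ‖F (jV (A.incl hργ (Y a (projIcc 0 T hT.le (k * h a)) ω)))‖ₑ else 0 := by
      ext ω
      rw [hg]
      split_ifs
      · rfl
      · exact enorm_zero
    rw [h1]
    refine Measurable.ite (measurableSet_le ?_ measurable_const) ?_ measurable_const
    · exact (hYm a _).norm.add ((hincl hγ).norm.measurable.comp (hZm a _))
    · exact (hFc.comp (jV.continuous.comp hinclγ)).enorm.measurable.comp (hYm a _)
  have hggm : ∀ a, Measurable (Function.uncurry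
      fun (t : Icc (0 : ℝ) T) ω => ‖g a ω ⌊(t : ℝ) / h a⌋‖ₑ) := fun a =>
    measurable_uncurry_comp_floor (G := fun k ω => ‖g a ω k‖ₑ) (hgm a) (h a)
  -- Rounded to the grid, Y depends on t through an integer, so measurability at each time gives
  -- joint measurability without continuity.
  have hybm : ∀ a, Measurable (Function.uncurry fun t ω => ‖Y a (e a t) ω‖ₑ) := fun a =>
    measurable_uncurry_comp_floor (G := fun k ω => ‖Y a (projIcc 0 T hT.le (k * h a)) ω‖ₑ)
      (fun k => (hYm a _).enorm) (h a)
  have hobm : ∀ a, Measurable (Function.uncurry fun t ω => ‖A.incl hγ (Z a ω (e a t))‖ₑ) :=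
    fun a => measurable_uncurry_comp_floor
      (G := fun k ω => ‖A.incl hγ (Z a ω (projIcc 0 T hT.le (k * h a)))‖ₑ)
      (fun k => (hincl hγ).enorm.measurable.comp (hZm a _)) (h a)
  let q : α → Icc (0 : ℝ) T → Ω → ℝ≥0∞ := fun a t ω => ∫⁻ s in Ioc 0 (e a t : ℝ),
    ENNReal.ofReal (((e a t : ℝ) - s) ^ (-(ρ + ϱ))) * ‖g a ω ⌊(projIcc 0 T hT.le s : ℝ) / h a⌋‖ₑ
  have hqm : ∀ a, Measurable (Function.uncurry (q a)) := fun a =>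
    measurable_uncurry_comp_floor
      (G := fun k ω => ∫⁻ s in Ioc 0 (projIcc 0 T hT.le (k * h a) : ℝ),
        ENNReal.ofReal (((projIcc 0 T hT.le (k * h a) : ℝ) - s) ^ (-(ρ + ϱ)))
          * ‖g a ω ⌊(projIcc 0 T hT.le s : ℝ) / h a⌋‖ₑ)
      (fun k => MomentBound.measurable_kernel_integral hT.le (hggm a) (ρ + ϱ) _) (h a)
  have hOm : Measurable (Function.uncurry fun t ω => O ω t) := measurable_uncurry_paths hO
  have hOem : ∀ a, Measurable (Function.uncurry fun t ω => O ω (e a t)) := fun a =>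
    hOm.comp (((hem a).comp measurable_fst).prodMk measurable_snd)
  have hdm : ∀ a, Measurable (Function.uncurry fun t ω =>
      ‖jV (A.projTo (I a) ρ (iV (O ω t - O ω (e a t))))‖ₑ) := fun a =>
    (hpr a).enorm.measurable.comp (hOm.sub (hOem a))
  have hbm : ∀ a, Measurable (Function.uncurry fun t ω =>
      ‖jV (A.projTo (I a) ρ (iV (O ω (e a t)))) - jV (A.incl hρ1 (Z a ω (e a t)))‖ₑ) := fun a =>
    measurable_uncurry_comp_floor
      (G := fun k ω => ‖jV (A.projTo (I a) ρ (iV (O ω (projIcc 0 T hT.le (k * h a)))))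
        - jV (A.incl hρ1 (Z a ω (projIcc 0 T hT.le (k * h a))))‖ₑ)
      (fun k => (((hpr a).measurable.comp (hO _)).sub
        ((jV.continuous.comp (hincl hρ1)).measurable.comp (hZm a _))).enorm) (h a)
  have hpom : ∀ a, Measurable (Function.uncurry fun t ω =>
      ‖jV (A.projTo (I a) ρ (iV (O ω t)))‖ₑ) := fun a => (hpr a).enorm.measurable.comp hOm
  have hstep := MomentBound.step_scheme hT.le (q := q) (D := ENNReal.ofReal (D * (1 + L) ^ (1 + φ / 2)))
    (r := p * max 2 φ) (θ := ρ + ϱ)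
    (gg := fun a t ω => ‖g a ω ⌊(t : ℝ) / h a⌋‖ₑ) ENNReal.ofReal_ne_top hc hc' hφ hϑ
    hp hpφ (by nlinarith [le_max_left 2 φ]) (by nlinarith [le_max_right 2 φ]) hs₁ hs₂ hρϱ
    (fun a t => (hybm a).of_uncurry_left) (fun a t => (hobm a).of_uncurry_left) hggm
    (fun a t => (hdm a).of_uncurry_left) (fun a t => (hbm a).of_uncurry_left)
    (fun a t => (hpom a).of_uncurry_left) (hYb.reindex e) (hZb.reindex e) hd (hb.reindex e) hpo
    (fun a t ω => ?_) e (fun a t ω => rfl) hη hη'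
  · refine ⟨_, hstep.const_mul (by linarith) hK, fun a => ?_, fun a => ?_⟩
    · have hQ := (hqm a).add (hggm a)
      exact ((((((hQ.const_mul _).add (hdm a)).add (hbm a)).mul
        (((((measurable_const (a := (1 : ℝ≥0∞))).add hQ).add (hpom a)).add (hybm a)).pow_const
          (φ / 2)))).add (((((hybm a).add (hobm a)).pow_const ϑ).mul
            (((measurable_const (a := (1 : ℝ≥0∞))).add (hybm a)).pow_const
              (1 + φ / 2))).const_mul _)).const_mul K
    · filter_upwards [A.ae_forall_gridFloor_eq_modeConv hT.le (hh a) (hY a)] with ω hω t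
      refine hKv (I a) (h a) (hh a) (hhT a) (g a ω) t t.2.1 (Y a (e a t) ω) (Z a ω (e a t))
        (O ω t) (O ω (e a t)) _ (hg a ω _) (hω t t.2) ?_
      have he : (e a t : ℝ) = gridFloor (h a) t := coe_projIcc_gridFloor hT.le (hh a) t.2
      simp only [q]
      rw [he]
      congr 1
      refine setLIntegral_congr_fun measurableSet_Ioc fun r hr => ?_
      have hrT : r ∈ Icc 0 T := ⟨hr.1.le, hr.2.trans ((gridFloor_le (hh a) t).trans t.2.2)⟩
      simp only [projIcc_of_mem hT.le hrT]
  · simp only [hg]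
    split_ifs with hif
    · exact enorm_le_of_norm_le_rpow (F := fun y => F (jV (A.incl hργ y))) (by positivity)
        (by positivity) hL' _
    · simp

end DiagNegOp

/-! ### The strong error. -/

namespace DiagNegOp

variable {ι H V : Type*} [NormedAddCommGroup H] [InnerProductSpace ℝ H]
  [NormedAddCommGroup V] [NormedSpace ℝ V]

/-- The error splits into X − P_I X, P_I O − O^{M,I} and P_I X − P_I O − Z; the first two are
measured in V. -/
theorem enorm_sub_le_of_proj (A : DiagNegOp ι H) {ρ : ℝ} (hρ1 : ρ ≤ 1) (jV : A.Interp ρ →L[ℝ] V)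
    (iV : V →L[ℝ] H) (hji : ∀ v : A.Interp ρ, iV (jV v) = v.toH) (I : Finset ι) (x o : V)
    (z : A.Interp 1) (m : H) :
    ‖iV x - (m + z.toH)‖ₑ ≤ ‖iV‖ₑ * (‖x - jV (A.projTo I ρ (iV x))‖ₑ
        + ‖jV (A.projTo I ρ (iV o)) - jV (A.incl hρ1 z)‖ₑ)
      + ‖A.proj I (iV x) - A.proj I (iV o) - m‖ₑ := by
  have h1 : iV (x - jV (A.projTo I ρ (iV x))) = iV x - A.proj I (iV x) := by
    rw [map_sub, hji, toH_projTo]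
  have h2 : iV (jV (A.projTo I ρ (iV o)) - jV (A.incl hρ1 z)) = A.proj I (iV o) - z.toH := by
    rw [map_sub, hji, hji, toH_projTo, toH_incl]
  have h3 : iV x - (m + z.toH) = iV (x - jV (A.projTo I ρ (iV x)))
      + iV (jV (A.projTo I ρ (iV o)) - jV (A.incl hρ1 z))
      + (A.proj I (iV x) - A.proj I (iV o) - m) := by
    rw [h1, h2]; abel
  rw [h3, mul_add]
  refine (enorm_add_le _ _).trans (add_le_add_left ((enorm_add_le _ _).trans ?_) _)
  exact add_le_add (iV.le_opENorm _) (iV.le_opENorm _)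

variable {Ω : Type*} [MeasurableSpace V] [BorelSpace V]
  [SecondCountableTopology V] [MeasurableSpace Ω] {P : Measure Ω} [IsProbabilityMeasure P]
  {α : Type*} {R : α → ℝ≥0∞}

theorem momentBound_error (A : DiagNegOp ι H) {T c ρ γ p : ℝ} (hT : 0 < T) (hc : 0 < c)
    (hρ1 : ρ ≤ 1) (hp : 2 ≤ p)
    (jV : A.Interp ρ →L[ℝ] V) (iV : V →L[ℝ] H)
    (hji : ∀ v : A.Interp ρ, iV (jV v) = v.toH) {F : V → H} (hFc : Continuous F)
    (hmono : ∀ (I : Finset ι) (v w : A.Interp 1), v.toH ∈ range (A.proj I) →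
      w.toH ∈ range (A.proj I) →
      inner ℝ (v.toH - w.toH)
        (A.op v + F (jV (A.incl hρ1 v)) - A.op w - F (jV (A.incl hρ1 w)))
        ≤ c * ‖v.toH - w.toH‖ ^ 2)
    {X O : Ω → C(Icc (0 : ℝ) T, V)} (hX : ∀ t, Measurable fun ω => X ω t)
    (hO : ∀ t, Measurable fun ω => O ω t)
    (hXO : ∀ᵐ ω ∂P, ∀ (t : Icc (0 : ℝ) T) i, inner ℝ (A.basis i) (iV (X ω t))
      = expConv (A.eig i) (fun s => inner ℝ (A.basis i) (F (X ω (projIcc 0 T hT.le s)))) t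
        + inner ℝ (A.basis i) (iV (O ω t)))
    {h : α → ℝ} (hh : ∀ a, 0 < h a) {I : α → Finset ι}
    {Y : α → Icc (0 : ℝ) T → Ω → A.Interp γ} {Z : α → Ω → C(Icc (0 : ℝ) T, A.Interp 1)}
    {g : α → Ω → ℤ → H} (hZm : ∀ a t, Measurable fun ω => Z a ω t)
    (hY : ∀ a (t : Icc (0 : ℝ) T), ∀ᵐ ω ∂P, (Y a t ω).toH
      = A.modeConv (I a) (fun q => g a ω ⌊q / h a⌋) t + (Z a ω t).toH)
    (hxd : MomentBound P (fun a (t : Icc (0 : ℝ) T) ω =>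
        ‖X ω t - jV (A.projTo (I a) ρ (iV (X ω t)))‖ₑ) (2 * p) R)
    (hu : MomentBound P (fun a (t : Icc (0 : ℝ) T) ω =>
        ‖F (X ω t) - F (jV (A.projTo (I a) ρ (iV (X ω t))))‖ₑ) p R)
    (hb : MomentBound P (fun a (t : Icc (0 : ℝ) T) ω =>
      ‖jV (A.projTo (I a) ρ (iV (O ω t))) - jV (A.incl hρ1 (Z a ω t))‖ₑ) (2 * p) R)
    {v : α → Icc (0 : ℝ) T → Ω → ℝ≥0∞} (hv : MomentBound P v p R)
    (hvm : ∀ a, Measurable (Function.uncurry (v a)))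
    (hv' : ∀ a, ∀ᵐ ω ∂P, ∀ t : Icc (0 : ℝ) T,
      ‖F (jV (A.projTo (I a) ρ (A.modeConv (I a) (fun q => g a ω ⌊q / h a⌋) t + iV (O ω t))))
        - g a ω ⌊(t : ℝ) / h a⌋‖ₑ ≤ v a t ω) :
    MomentBound P (fun a (t : Icc (0 : ℝ) T) ω => ‖iV (X ω t) - (Y a t ω).toH‖ₑ) p R := by
  have hpr : ∀ a, Continuous fun v => jV (A.projTo (I a) ρ (iV v)) :=
    fun a => A.continuous_projTo_comp jV iV (I a)
  have hincl : Continuous (A.incl hρ1) := (A.inclL hρ1).continuous.congr fun v => by simp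
  have hum : ∀ a, Measurable (Function.uncurry fun (t : Icc (0 : ℝ) T) ω =>
      ‖F (X ω t) - F (jV (A.projTo (I a) ρ (iV (X ω t))))‖ₑ) := fun a =>
    (hFc.sub (hFc.comp (hpr a))).enorm.measurable.comp (measurable_uncurry_paths hX)
  have hw : MomentBound P (fun a (t : Icc (0 : ℝ) T) ω =>
      ‖A.proj (I a) (iV (X ω t)) - A.proj (I a) (iV (O ω t))
        - A.modeConv (I a) (fun q => g a ω ⌊q / h a⌋) t‖ₑ) p R := by
    refine MomentBound.of_sq_le_integral hT.le (C := ENNReal.ofReal (Real.exp (2 * (c + 1) * T)))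
      ENNReal.ofReal_ne_top hp hum hvm hu hv fun a t => ?_
    filter_upwards [hXO, hv' a] with ω hω hvω
    have hx : Continuous fun s => X ω (projIcc 0 T hT.le s) :=
      (X ω).continuous.comp continuous_projIcc
    have ho : Continuous fun s => O ω (projIcc 0 T hT.le s) :=
      (O ω).continuous.comp continuous_projIcc
    have h1 := norm_sq_modeConv_sub_le_of_monotone A hc hρ1 jV iV hFc (I a) (hmono (I a)) hx ho
      (RightRegular.comp_floor (g a ω) (hh a))
      (fun s hs => by
        have h2 := A.proj_eq_modeConv_add iV (hω ⟨s, hs⟩) (I a)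
        rw [projIcc_of_mem hT.le hs]
        exact h2) t.2
    rw [projIcc_val] at h1
    rw [← ofReal_norm_rpow _ zero_le_two, Real.rpow_two]
    refine (ENNReal.ofReal_le_ofReal h1).trans ?_
    rw [ENNReal.ofReal_mul (Real.exp_pos _).le]
    gcongr
    refine (ofReal_intervalIntegral_le t.2.1).trans
      (setLIntegral_mono' measurableSet_Ioc fun s hs => ?_)
    have hsT : s ∈ Icc 0 T := ⟨hs.1.le, hs.2.trans t.2.2⟩
    have h3 := hvω (projIcc 0 T hT.le s)
    rw [projIcc_of_mem hT.le hsT] at h3 ⊢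
    rw [Real.enorm_eq_ofReal (by positivity), ENNReal.ofReal_add (by positivity) (by positivity),
      ← Real.rpow_two, ← Real.rpow_two, ofReal_norm_rpow _ zero_le_two,
      ofReal_norm_rpow _ zero_le_two]
    gcongr
  have hxdm : ∀ a (t : Icc (0 : ℝ) T), Measurable fun ω =>
      ‖X ω t - jV (A.projTo (I a) ρ (iV (X ω t)))‖ₑ := fun a t =>
    (continuous_id.sub (hpr a)).enorm.measurable.comp (hX t)
  have hbm : ∀ a (t : Icc (0 : ℝ) T), Measurable fun ω =>
      ‖jV (A.projTo (I a) ρ (iV (O ω t))) - jV (A.incl hρ1 (Z a ω t))‖ₑ := fun a t =>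
    (((hpr a).measurable.comp (hO t)).sub
      ((jV.continuous.comp hincl).measurable.comp (hZm a t))).enorm
  have hsum := (hxd.of_exponent_le (r := p) (by linarith) (by linarith) hxdm).add
    (hb.of_exponent_le (r := p) (by linarith) (by linarith) hbm) (by linarith) hxdm
  refine ((hsum.const_mul (C := ‖iV‖ₑ) (by linarith) enorm_ne_top).add hw (by linarith)
    fun a t => ((hxdm a t).add (hbm a t)).const_mul _).of_le (by linarith) fun a t => ?_
  filter_upwards [hY a t] with ω hω
  rw [hω]
  exact A.enorm_sub_le_of_proj hρ1 jV iV hji (I a) (X ω t) (O ω t) (Z a ω t) _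

end DiagNegOp

/-! ### The main theorem: assembling moments and rates. -/

theorem mainTheorem2
    {ι H V Ω : Type*} [Nonempty ι]
    [NormedAddCommGroup H] [InnerProductSpace ℝ H] [CompleteSpace H]
    [TopologicalSpace.SeparableSpace H]
    [NormedAddCommGroup V] [NormedSpace ℝ V] [CompleteSpace V] [MeasurableSpace V] [BorelSpace V]
    (A : DiagNegOp ι H)
    (T c φ ε ρ γ χ : ℝ) (hT : 0 < T) (hc : 0 < c) (hφ : 0 < φ) (hε : 0 ≤ ε ∧ ε < 1)
    (hρ : 0 ≤ ρ ∧ ρ < 1 / 2) (hργ : ρ < γ) (hγ : γ ≤ 1 / 2)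
    (hχ : 0 < χ ∧ χ ≤ (γ - ρ) / (1 + φ / 2) ∧ χ ≤ (1 - ρ) / (1 + φ))
    (𝒟 : Set (Finset ι)) (h𝒟 : ∀ I ∈ 𝒟, I.Nonempty)
    -- `H_ρ ⊆ V ⊆ H` continuously and densely
    (jV : A.Interp ρ →L[ℝ] V) (iV : V →L[ℝ] H) (hiV : Function.Injective iV)
    (hji : ∀ v : A.Interp ρ, iV (jV v) = v.toH) (hjd : DenseRange jV) (hid : DenseRange iV)
    -- the path functionals and the nonlinearity
    (phi Phi : C(Icc (0 : ℝ) T, A.Interp 1) → ℝ)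
    (hphi : (∀ x, 0 ≤ phi x) ∧ @Measurable _ _ (borel _) _ phi)
    (hPhi : (∀ x, 0 ≤ Phi x) ∧ @Measurable _ _ (borel _) _ Phi)
    (F : V → H) (hF : Continuous F)
    (hmono : ∀ (I : Finset ι) (v w : A.Interp 1), v.toH ∈ range (A.proj I) →
      w.toH ∈ range (A.proj I) →
      inner ℝ (v.toH - w.toH)
        (A.op v + F (jV (A.incl (by linarith) v)) - A.op w - F (jV (A.incl (by linarith) w)))
        ≤ c * ‖v.toH - w.toH‖ ^ 2)
    (hcoer : ∀ (I : Finset ι) (v : A.Interp 1), v.toH ∈ range (A.proj I) →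
      ∀ (x : C(Icc (0 : ℝ) T, A.Interp 1)) (t : Icc (0 : ℝ) T),
      inner ℝ (A.incl (by linarith) v : A.Interp (1 / 2))
          (A.projTo I (1 / 2) (F (jV (A.incl (by linarith) (v + x t)))))
        + phi x * inner ℝ v.toH (F (jV (A.incl (by linarith) (v + x t))))
        ≤ ε * ‖v‖ ^ 2 + (c + phi x) * ‖(A.incl (by linarith) v : A.Interp (1 / 2))‖ ^ 2
          + c * phi x * ‖v.toH‖ ^ 2 + Phi x)
    (hlip : ∀ (I : Finset ι) (v w : A.Interp ρ), v.toH ∈ range (A.proj I) →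
      w.toH ∈ range (A.proj I) →
      ‖F (jV v) - F (jV w)‖ ^ 2 ≤ c * ‖jV v - jV w‖ ^ 2 * (1 + ‖jV v‖ ^ φ + ‖jV w‖ ^ φ))
    -- the stochastic processes; those with continuous sample paths are given by their paths
    [MeasurableSpace Ω] (P : Measure Ω) [IsProbabilityMeasure P]
    (X O : Ω → C(Icc (0 : ℝ) T, V))
    (hX : ∀ t, Measurable fun ω => X ω t) (hO : ∀ t, Measurable fun ω => O ω t)
    (OM : ℕ+ → Finset ι → Ω → C(Icc (0 : ℝ) T, A.Interp 1))
    (hOM : ∀ M, ∀ I ∈ 𝒟, ∀ t, Measurable fun ω => OM M I ω t)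
    (hOMI : ∀ M, ∀ I ∈ 𝒟, ∀ ω t, (OM M I ω t).toH ∈ range (A.proj I))
    (Y : ℕ+ → Finset ι → Icc (0 : ℝ) T → Ω → A.Interp γ)
    (hY : ∀ M, ∀ I ∈ 𝒟, ∀ t, Measurable (Y M I t))
    (hXeq : ∀ t : Icc (0 : ℝ) T, ∀ᵐ ω ∂P,
      iV (X ω t) = (∫ s in (0 : ℝ)..t, A.semigroup (t - s) (F (X ω (projIcc 0 T hT.le s))))
        + iV (O ω t))
    (hYeq : ∀ (M : ℕ+), ∀ I ∈ 𝒟, ∀ t : Icc (0 : ℝ) T, ∀ᵐ ω ∂P,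
      (Y M I t ω).toH =
        (∫ s in (0 : ℝ)..t,
          if ‖Y M I (projIcc 0 T hT.le (gridFloor (T / (M : ℕ)) s)) ω‖
              + ‖(A.incl (by linarith) (OM M I ω (projIcc 0 T hT.le (gridFloor (T / (M : ℕ)) s))) :
                  A.Interp γ)‖ ≤ ((M : ℕ) / T) ^ χ
          then A.proj I (A.semigroup (t - s)
            (F (jV (A.incl hργ.le (Y M I (projIcc 0 T hT.le (gridFloor (T / (M : ℕ)) s)) ω)))))
          else 0)
        + (OM M I ω t).toH)
    -- the additional parameters and the moment assumptions
    (ϑ p ϱ : ℝ) (hϑ : 0 < ϑ) (hp : max 2 (1 / φ) ≤ p) (hϱ : 0 ≤ ϱ ∧ ϱ < 1 - ρ)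
    (hmom : (⨆ t : Icc (0 : ℝ) T, ⨆ I ∈ 𝒟,
        expect P fun ω => ‖X ω t‖ ^ (p * (1 + φ / 2) * max 2 φ)
          + ‖jV (A.projTo I ρ (iV (O ω t)))‖ ^ (p * φ))
      + (⨆ M : ℕ+, ⨆ I ∈ 𝒟, ⨆ t : Icc (0 : ℝ) T,
        expect P fun ω =>
          |‖(A.incl (by linarith) (OM M I ω t) : A.Interp γ)‖ ^ 2
              + Phi (OM M I ω) + phi (OM M I ω)|
            ^ (p * max (2 * ϑ) (max (2 + φ) ((1 + φ / 2) * (φ / 2))))) < ∞) :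
    (⨆ M : ℕ+, ⨆ I ∈ 𝒟, ⨆ t : Icc (0 : ℝ) T,
      expect P fun ω =>
        ‖Y M I t ω‖ ^ (p * max (4 * ϑ) (max (4 + 2 * φ) (φ * (1 + φ / 2))))) < ∞ ∧
    ∃ C : ℝ, 0 < C ∧ ∀ (M : ℕ+), ∀ I ∈ 𝒟,
      (⨆ t : Icc (0 : ℝ) T,
          (expect P fun ω => ‖iV (X ω t) - (Y M I t ω).toH‖ ^ p) ^ (1 / p))
        ≤ ENNReal.ofReal C *
          (ENNReal.ofReal (((M : ℕ) : ℝ) ^ (-min (ϑ * χ) ϱ))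
            + ENNReal.ofReal ‖(A.negFracPow ϱ).comp (ContinuousLinearMap.id ℝ H - A.proj I)‖
            + ⨆ t : Icc (0 : ℝ) T,
              (expect P fun ω =>
                ‖O ω t - jV (A.projTo I ρ (iV (O ω t)))‖ ^ (2 * p)
                + ‖jV (A.projTo I ρ (iV (O ω t)))
                    - jV (A.incl (by linarith) (OM M I ω t))‖ ^ (2 * p)
                + ‖jV (A.projTo I ρ (iV (O ω t - O ω
                    (projIcc 0 T hT.le (gridFloor (T / (M : ℕ)) t)))))‖ ^ (2 * p))
              ^ (1 / (2 * p))) := by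
  have hφ2 : 0 < 1 + φ / 2 := by positivity
  obtain ⟨B, hB, hFB⟩ := exists_norm_sub_le_of_forall_proj A hc hφ jV hjd hF hlip
  obtain ⟨D, hD, hFD⟩ := exists_norm_le_of_norm_sub_le hφ hB hFB
  have hχ₁ : χ * (1 + φ / 2) ≤ γ - ρ := (le_div_iff₀ hφ2).1 hχ.2.1
  have hχ₂ : χ * (1 + φ) ≤ 1 - ρ := (le_div_iff₀ (by positivity)).1 hχ.2.2
  -- V inherits separability from the dense image of H_ρ; measurability of differences of V-valued
  -- maps relies on it.
  have hsep : TopologicalSpace.SeparableSpace V := hjd.separableSpace jV.continuous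
  have hsec : SecondCountableTopology V := UniformSpace.secondCountable_of_separable V
  have hp2 : 2 ≤ p := (le_max_left _ _).trans hp
  have hpφ : 1 ≤ p * φ := (div_le_iff₀ hφ).1 ((le_max_right _ _).trans hp)
  have hγ1 : γ ≤ 1 := by linarith
  have hρ1 : ρ ≤ 1 := by linarith
  have hρϱ : ρ + ϱ < 1 := by linarith [hϱ.2]
  have hXO := ae_forall_inner_eq_expConv A hT.le iV hF hXeq
  -- All bounds are uniform over this index set, which yields one constant C for all M and I.
  let α := {x : ℕ+ × Finset ι // x.2 ∈ 𝒟}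
  have hM1 : ∀ a : α, (1 : ℝ) ≤ ((a.1.1 : ℕ) : ℝ) := fun a => by exact_mod_cast a.1.1.2
  obtain ⟨h, hha⟩ : ∃ h : α → ℝ, ∀ a, h a = T / ((a.1.1 : ℕ) : ℝ) := ⟨_, fun _ => rfl⟩
  have hh : ∀ a, 0 < h a := fun a => by
    rw [hha]
    exact div_pos hT (zero_lt_one.trans_le (hM1 a))
  have hhT : ∀ a, h a ≤ T := fun a => by
    rw [hha]
    exact div_le_self hT.le (hM1 a)
  obtain ⟨g, hg⟩ : ∃ g : α → Ω → ℤ → H, ∀ a ω (k : ℤ),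
      g a ω k = if ‖Y a.1.1 a.1.2 (projIcc 0 T hT.le (k * h a)) ω‖
          + ‖A.incl hγ1 (OM a.1.1 a.1.2 ω (projIcc 0 T hT.le (k * h a)))‖ ≤ (1 / h a) ^ χ
        then F (jV (A.incl hργ.le (Y a.1.1 a.1.2 (projIcc 0 T hT.le (k * h a)) ω))) else 0 :=
    ⟨_, fun _ _ _ => rfl⟩
  have hYmc : ∀ (a : α) (t : Icc (0 : ℝ) T), ∀ᵐ ω ∂P, (Y a.1.1 a.1.2 t ω).toH
      = A.modeConv a.1.2 (fun q => g a ω ⌊q / h a⌋) t + (OM a.1.1 a.1.2 ω t).toH := fun a t =>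
    A.ae_eq_modeConv_of_scheme hT (hh a) hργ.le hγ1 jV a.1.2 (hg a)
      (by simpa only [hha, one_div_div] using hYeq a.1.1 a.1.2 a.2 t)
  obtain ⟨hm1, hm2⟩ := ENNReal.add_lt_top.1 hmom
  have hXb : MomentBound P (fun (_ : α) (t : Icc (0 : ℝ) T) ω => ‖X ω t‖ₑ)
      ((1 + φ / 2) * (p * max 2 φ)) fun _ => 1 := by
    refine MomentBound.of_lintegral_le hm1.ne fun a t => ?_
    rw [show (1 + φ / 2) * (p * max 2 φ) = p * (1 + φ / 2) * max 2 φ by ring]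
    exact (lintegral_enorm_rpow_le_expect P (fun ω => X ω t) (by positivity) fun ω =>
      le_add_of_nonneg_right (by positivity)).trans
        (le_iSup_of_le t (le_iSup₂_of_le a.1.2 a.2 le_rfl))
  have hpo : MomentBound P (fun (a : α) (t : Icc (0 : ℝ) T) ω =>
      ‖jV (A.projTo a.1.2 ρ (iV (O ω t)))‖ₑ) (p * φ) fun _ => 1 := by
    refine MomentBound.of_lintegral_le hm1.ne fun a t => ?_
    exact (lintegral_enorm_rpow_le_expect P (fun ω => jV (A.projTo a.1.2 ρ (iV (O ω t))))
      (by positivity) fun ω => le_add_of_nonneg_left (by positivity)).trans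
        (le_iSup_of_le t (le_iSup₂_of_le a.1.2 a.2 le_rfl))
  have hq0 : 0 ≤ p * max (2 * ϑ) (max (2 + φ) ((1 + φ / 2) * (φ / 2))) := by positivity
  have hS : MomentBound P (fun (a : α) (t : Icc (0 : ℝ) T) ω => ENNReal.ofReal
      |‖A.incl hγ1 (OM a.1.1 a.1.2 ω t)‖ ^ 2 + Phi (OM a.1.1 a.1.2 ω) + phi (OM a.1.1 a.1.2 ω)|)
      (p * max (2 * ϑ) (max (2 + φ) ((1 + φ / 2) * (φ / 2)))) fun _ => 1 := by
    refine MomentBound.of_lintegral_le hm2.ne fun a t => ?_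
    simp only [ENNReal.ofReal_rpow_of_nonneg (abs_nonneg _) hq0]
    exact le_iSup_of_le a.1.1 (le_iSup₂_of_le a.1.2 a.2 (le_iSup_of_le t le_rfl))
  obtain ⟨hYb, hZb⟩ := A.momentBound_scheme (Y := fun a : α => Y a.1.1 a.1.2)
    (Z := fun a : α => OM a.1.1 a.1.2) (I := fun a : α => a.1.2) hT hc hφ hε.2 hρ.1 hργ.le hγ hγ1
    hρ1 (by norm_num) hχ₁ hχ₂ jV hB hD hFB hFD hphi.1 hPhi.1 hcoer hh hhT
    (fun a => hOMI a.1.1 a.1.2 a.2) hg hYmc hq0 hS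
  constructor
  · obtain ⟨K, hK, hKb⟩ := hYb
    refine lt_of_le_of_lt (iSup_le fun M => iSup₂_le fun I hI => iSup_le fun t => ?_) hK.lt_top
    rw [← two_mul_mul_max_eq, expect_norm_rpow P _ (by positivity)]
    simpa using hKb ⟨(M, I), hI⟩ t
  let E : α → Icc (0 : ℝ) T → ℝ≥0∞ := fun a t => expect P fun ω =>
    ‖O ω t - jV (A.projTo a.1.2 ρ (iV (O ω t)))‖ ^ (2 * p)
      + ‖jV (A.projTo a.1.2 ρ (iV (O ω t))) - jV (A.incl hρ1 (OM a.1.1 a.1.2 ω t))‖ ^ (2 * p)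
      + ‖jV (A.projTo a.1.2 ρ (iV (O ω t - O ω
          (projIcc 0 T hT.le (gridFloor (T / (a.1.1 : ℕ)) t)))))‖ ^ (2 * p)
  -- The rate is the whole right-hand side of (ii), so each error source only has to be bounded by
  -- one of its summands.
  let R : α → ℝ≥0∞ := fun a => ENNReal.ofReal (((a.1.1 : ℕ) : ℝ) ^ (-min (ϑ * χ) ϱ))
    + ENNReal.ofReal ‖(A.negFracPow ϱ).comp (ContinuousLinearMap.id ℝ H - A.proj a.1.2)‖
    + ⨆ t : Icc (0 : ℝ) T, E a t ^ (1 / (2 * p))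
  have hR₁ : ∀ a, ENNReal.ofReal (((a.1.1 : ℕ) : ℝ) ^ (-min (ϑ * χ) ϱ)) ≤ R a := fun a =>
    le_self_add.trans le_self_add
  have hR₂ : ∀ a : α, ENNReal.ofReal
      ‖(A.negFracPow ϱ).comp (ContinuousLinearMap.id ℝ H - A.proj a.1.2)‖ ≤ R a := fun a =>
    le_add_self.trans le_self_add
  have hR₃ : ∀ {f : α → Icc (0 : ℝ) T → Ω → V}, (∀ a t ω, ‖f a t ω‖ ^ (2 * p)
      ≤ ‖O ω t - jV (A.projTo a.1.2 ρ (iV (O ω t)))‖ ^ (2 * p)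
        + ‖jV (A.projTo a.1.2 ρ (iV (O ω t)))
            - jV (A.incl hρ1 (OM a.1.1 a.1.2 ω t))‖ ^ (2 * p)
        + ‖jV (A.projTo a.1.2 ρ (iV (O ω t - O ω
            (projIcc 0 T hT.le (gridFloor (T / (a.1.1 : ℕ)) t)))))‖ ^ (2 * p)) →
      MomentBound P (fun a t ω => ‖f a t ω‖ₑ) (2 * p) R := fun hf =>
    MomentBound.of_rpow_inv_le (E := E) (by positivity)
      (fun a t => (le_iSup (fun t => E a t ^ (1 / (2 * p))) t).trans le_add_self)
      fun a t => lintegral_enorm_rpow_le_expect P _ (by positivity) (hf a t)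
  have hdO : MomentBound P (fun (a : α) (t : Icc (0 : ℝ) T) ω =>
      ‖O ω t - jV (A.projTo a.1.2 ρ (iV (O ω t)))‖ₑ) (2 * p) R := hR₃ fun a t ω => by
    rw [add_assoc]
    exact le_add_of_nonneg_right (by positivity)
  have hb : MomentBound P (fun (a : α) (t : Icc (0 : ℝ) T) ω =>
      ‖jV (A.projTo a.1.2 ρ (iV (O ω t))) - jV (A.incl hρ1 (OM a.1.1 a.1.2 ω t))‖ₑ) (2 * p) R :=
    hR₃ fun a t ω => (le_add_of_nonneg_left (by positivity)).trans
      (le_add_of_nonneg_right (by positivity))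
  have hd : MomentBound P (fun (a : α) (t : Icc (0 : ℝ) T) ω =>
      ‖jV (A.projTo a.1.2 ρ (iV (O ω t - O ω (projIcc 0 T hT.le (gridFloor (h a) t)))))‖ₑ)
      (2 * p) R := hR₃ fun a t ω => by
    rw [hha]
    exact le_add_of_nonneg_left (by positivity)
  obtain ⟨hxd, hu⟩ := A.momentBound_exact hT.le hφ hρ.1 (by linarith) hϱ.1 hρϱ hp2 hpφ jV iV hiV hji
    hF hB hD hFB hFD hX hO hXO hXb hpo hdO hR₂
  obtain ⟨v, hv, hvm, hv'⟩ := A.exists_momentBound_step (R := R)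
    (Y := fun a : α => Y a.1.1 a.1.2) (Z := fun a : α => OM a.1.1 a.1.2) (I := fun a : α => a.1.2)
    hT hφ hρ.1 hργ.le hγ1 hρ1 hϑ hϱ.1 hρϱ hp2 hpφ
    (one_add_half_mul_max_le (ϑ := ϑ) (by linarith) hφ)
    (by nlinarith [le_max_left (2 * ϑ) (max (2 + φ) ((1 + φ / 2) * (φ / 2)))])
    jV iV hF hB hD hFB hFD hO hh hhT (fun a => hY a.1.1 a.1.2 a.2) (fun a => hOM a.1.1 a.1.2 a.2)
    hg hYmc hYb hZb hpo hd hb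
    (c := ENNReal.ofReal (T ^ ϱ)) (c' := ENNReal.ofReal (T ^ (χ * ϑ)))
    ENNReal.ofReal_ne_top ENNReal.ofReal_ne_top
    (fun a => by
      rw [hha]
      refine (ofReal_step_rpow_le hT (hM1 a) (min_le_right (ϑ * χ) ϱ)).trans ?_
      gcongr
      exact hR₁ a)
    (fun a => by
      rw [hha]
      refine (ofReal_step_rpow_le hT (hM1 a)
        ((min_le_left (ϑ * χ) ϱ).trans (mul_comm ϑ χ).le)).trans ?_
      gcongr
      exact hR₁ a)
  obtain ⟨C, hC, hCb⟩ := (A.momentBound_error (Y := fun a : α => Y a.1.1 a.1.2)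
    (Z := fun a : α => OM a.1.1 a.1.2) (I := fun a : α => a.1.2) hT hc hρ1 hp2 jV iV hji hF
    hmono hX hO hXO hh (fun a => hOM a.1.1 a.1.2 a.2) hYmc hxd hu hb hv hvm
    hv').exists_rpow_inv_le (by linarith)
  refine ⟨C, hC, fun M I hI => iSup_le fun t => ?_⟩
  rw [expect_norm_rpow P _ (by linarith)]
  exact hCb ⟨(M, I), hI⟩ t
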